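/- **Setting.** Let $n\in\{2,3\}$, let $\Omega\subset\mathbb R^n$ be a bounded open set (for instance a bounded Lipschitz domain), $J=[0,T]$ with $T>0$, and let $(\cdot,\cdot)$, $\|\cdot\|_0$, $\|\cdot\|_m$ be the $L^2(\Omega)$ inner product and norm and the $H^m(\Omega)$ norm for scalar, vector ($\mathbb V=\mathbb R^n$) or matrix ($\mathbb M=\mathbb R^{n\times n}$, Frobenius product) fields. Let $\mathbb S$, $\mathbb K$ be the symmetric and skew-symmetric matrices and $\mathbf I$ the identity matrix; $\operatorname{div}$ of a matrix field is taken row-wise, and $\|\tau\|_{\operatorname{div}}^2=\|\tau\|_0^2+\|\operatorname{div}\tau\|_0^2$. The norms of $L^q(J;X)$ and $W^{1,q}(J;X)$ (the latter being $\|f\|_{L^qX}+\|\dot f\|_{L^qX}$) are written $\|\cdot\|_{L^qX}$ and $\|\cdot\|_{W^{1,q}X}$; $\|f,g\|=\|f\|+\|g\|$; norms of functions outside the space are $+\infty$. The coefficients are measurable functions of $x\in\Omega$: a stiffness tensor $\mathcal C(x):\mathbb S\to\mathbb S$ and a conductivity tensor $\kappa(x):\mathbb V\to\mathbb V$, both symmetric,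 bounded and uniformly positive definite; $s_0\ge 0$ and $\alpha>0$ bounded ($s_0$ may vanish). $\mathcal A(x):\mathbb M\to\mathbb M$ equals $\mathcal C(x)^{-1}$ on $\mathbb S$ and a fixed positive constant times the identity on $\mathbb K$; $\|\tau\|_{\mathcal A}=(\mathcal A\tau,\tau)^{1/2}$, and $L^2_{\mathcal A}$ is $L^2$ with this norm. **Exact problem.** Put $\Sigma=H(\operatorname{div},\Omega;\mathbb M)$, $V=L^2(\Omega;\mathbb V)$, $\Gamma=L^2(\Omega;\mathbb K)$, $W=H(\operatorname{div},\Omega)$, $Q=L^2(\Omega)$. Given $f(t)\in V$ and $g(t)\in Q$, an exact solution consists of $(\sigma,p)\in C^1(J;\Sigma\times Q)$ and $(u,\gamma,z)\in C^0(J;V\times\Gamma\times W)$ such that for every $t\in J$ $$\begin{aligned} (\mathcal A(\sigma+\alpha p\mathbf I),\tau)+(u,\operatorname{div}\tau)+(\gamma,\tau)&=0 &&\forall\tau\in\Sigma,\\ (\operatorname{div}\sigma,v)+(\sigma,\eta)&=-(f,v)&&\forall(v,\eta)\in V\times\Gamma,\\ (\kappa^{-1}z,w)+(p,\operatorname{div}w)&=0&&\forall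 w\in W,\\ (s_0\dot p,q)+(\mathcal A(\dot\sigma+\alpha\dot p\mathbf I),\alpha q\mathbf I)-(\operatorname{div}z,q)&=(g,q)&&\forall q\in Q. \end{aligned}$$ **Discrete problem.** Let $r,r'\ge1$ be integers with $r'=r$ or $r'=r-1$. For mesh sizes $h>0$ let $\Sigma_h\subset\Sigma$, $V_h\subset V$, $\Gamma_h\subset\Gamma$, $W_h\subset W$, $Q_h\subset Q$ be finite-dimensional, with $L^2$ projections $P_h^V$, $P_h^\Gamma$, $P_h^Q$ into $V_h$, $\Gamma_h$, $Q_h$, such that, with a constant $c_S>0$ independent of $h$: * (approximation) for every $\xi$ in $\Gamma$ (respectively $Q$), $\inf_{\xi_h}\|\xi-\xi_h\|_0\le c_Sh^m\|\xi\|_m$ over $\Gamma_h$ (respectively $Q_h$) for $1\le m\le r$; the same holds for $V$ and $V_h$ for $1\le m\le r'$; * (S1) $\operatorname{div}\Sigma_h=V_h$ and $\operatorname{div}W_h=Q_h$; * (S2) there are linear maps $\Pi_h^\Sigma:H^1(\Omega;\mathbb M)\to\Sigma_h$ and $\Pi_h^W:H^1(\Omega;\mathbb V)\to W_h$ with $\operatorname{div}\Pi_h^\Sigma\tau=P_h^V\operatorname{div}\tau$,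 $\operatorname{div}\Pi_h^Ww=P_h^Q\operatorname{div}w$, $\|\tau-\Pi_h^\Sigma\tau\|_0\le c_Sh^m\|\tau\|_m$ and $\|w-\Pi_h^Ww\|_0\le c_Sh^m\|w\|_m$ for $1\le m\le r$; * (S3) for every $q\in Q_h$ there is $w\in W_h$ with $\operatorname{div}w=q$ and $\|w\|_{\operatorname{div}}\le c_S\|q\|_0$; * (S4) for every $(v,\eta)\in V_h\times\Gamma_h$ there is $\tau\in\Sigma_h$ with $\operatorname{div}\tau=v$, $(\tau,\eta')=(\eta,\eta')$ for all $\eta'\in\Gamma_h$, and $\|\tau\|_{\operatorname{div}}\le c_S(\|v\|_0+\|\eta\|_0)$. A semidiscrete solution consists of $(\sigma_h,p_h)\in C^1(J;\Sigma_h\times Q_h)$ and $(u_h,\gamma_h,z_h)\in C^0(J;V_h\times\Gamma_h\times W_h)$ satisfying the four equations above for the same $f,g$ with all test functions restricted to the discrete spaces. Let $I_h^\Sigma:\Sigma\to\Sigma_h$ be the weakly symmetric elliptic projection: $I_h^\Sigma\sigma=\tilde\sigma_h$, where $(\tilde\sigma_h,\tilde u_h,\tilde\gamma_h)\in\Sigma_h\times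 V_h\times\Gamma_h$ solves $(\tilde\sigma_h,\tau)+(\tilde u_h,\operatorname{div}\tau)+(\tilde\gamma_h,\tau)=(\sigma,\tau)$, $(\operatorname{div}\tilde\sigma_h,v)=(\operatorname{div}\sigma,v)$, $(\tilde\sigma_h,\eta)=(\sigma,\eta)$ for all $(\tau,v,\eta)\in\Sigma_h\times V_h\times\Gamma_h$. Put $I_h^W=\Pi_h^W$ and $$e_\sigma^h=I_h^\Sigma\sigma-\sigma_h,\quad e_u^h=P_h^Vu-u_h,\quad e_\gamma^h=P_h^\Gamma\gamma-\gamma_h,\quad e_z^h=I_h^Wz-z_h,\quad e_p^h=P_h^Qp-p_h .$$ **Theorem.** For every $c_0\ge0$ there is a constant $c>0$, depending only on $\Omega$, $T$, the coefficients, $r$, $r'$, $c_S$ and $c_0$ (not on $h$, the discrete spaces or the solutions), such that the following holds. Let $1\le m\le r$, and let exact and semidiscrete solutions as above satisfy, for some $K\ge0$, $$\|\sigma(0)-\sigma_h(0),\,p(0)-p_h(0)\|_0\le h^m\big(K+c_0\|\sigma(0),p(0)\|_m\big),\qquad \|z(0)-z_h(0)\|_0\le h^m\big(K+c_0\|\sigma(0),p(0),z(0)\|_m\big).$$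 Then $$\begin{aligned} \|e_\sigma^h+\alpha e_p^h\mathbf I\|_{L^\infty L^2_{\mathcal A}}&\le c\,h^m\big(K+\max\{\|\sigma,p,\gamma\|_{W^{1,1}H^m},\|z\|_{L^2H^m}\}\big),\\ \|e_\sigma^h\|_{L^\infty L^2}&\le c\,h^m\big(K+\|\sigma,p,\gamma\|_{W^{1,2}H^m}+\|z\|_{W^{1,1}H^m}\big),\\ \|e_u^h,e_\gamma^h\|_{L^\infty L^2}&\le c\,h^m\big(K+\max\{\|\sigma,p,\gamma\|_{W^{1,1}H^m},\|z\|_{L^2H^m}\}\big),\\ \|e_z^h\|_{L^\infty L^2}&\le c\,h^m\big(K+\|\sigma,p,\gamma\|_{W^{1,2}H^m}+\|z\|_{W^{1,1}H^m}\big),\\ \|e_p^h\|_{L^\infty L^2}&\le c\,h^m\big(K+\|\sigma,p,\gamma\|_{W^{1,2}H^m}+\|z\|_{W^{1,1}H^m}\big). \end{aligned}$$ In particular, for sufficiently regular solutions, $\|e_u^h\|_{L^\infty L^2}=O(h^r)$ even when $V_h$ only has order $r'=r-1$. -/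

import Mathlib

open MeasureTheory Set
open scoped ENNReal ContDiff

noncomputable section

/-- Column vectors of length `n` with the Euclidean inner product. -/
abbrev Vec (n : ℕ) := EuclideanSpace ℝ (Fin n)

/-- Real `n × n` matrices, the entry in row `i` and column `j` of `ξ` being `ξ (i, j)`,
with the Frobenius inner product. -/
abbrev Mat (n : ℕ) := EuclideanSpace ℝ (Fin n × Fin n)

/-- The identity matrix. -/
def idMat (n : ℕ) : Mat n := WithLp.toLp 2 (fun ij => if ij.1 = ij.2 then 1 else 0)

/-- Symmetric matrices. -/
def IsSymMat {n : ℕ} (ξ : Mat n) : Prop := ∀ i j, ξ (i, j) = ξ (j, i)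

/-- Skew-symmetric matrices. -/
def IsSkewMat {n : ℕ} (ξ : Mat n) : Prop := ∀ i j, ξ (i, j) = - ξ (j, i)

/-- The Hilbert space `L²(Ω; F)`. -/
abbrev L2 {n : ℕ} (Ω : Set (Vec n)) (F : Type*) [NormedAddCommGroup F] :=
  Lp F 2 (volume.restrict Ω)

section Sobolev

variable {n : ℕ}

/-- Test functions: `φ ∈ C_c^∞(Ω)`. -/
def IsTest (Ω : Set (Vec n)) (φ : Vec n → ℝ) : Prop :=
  ContDiff ℝ ∞ φ ∧ HasCompactSupport φ ∧ tsupport φ ⊆ Ω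

/-- The classical partial derivative `∂φ/∂x_i`. -/
def partialD (i : Fin n) (φ : Vec n → ℝ) : Vec n → ℝ :=
  fun x => fderiv ℝ φ x (EuclideanSpace.single i 1)

/-- The classical derivative `∂^β φ = ∂_0^{β_0} ⋯ ∂_{n-1}^{β_{n-1}} φ`. -/
def multiD (β : Fin n → ℕ) (φ : Vec n → ℝ) : Vec n → ℝ :=
  (List.finRange n).foldr (fun i ψ => (partialD i)^[β i] ψ) φ

/-- `g` is the weak derivative `∂^β f` on `Ω`. -/
def IsWeakD {Ω : Set (Vec n)} {F : Type*} [NormedAddCommGroup F] [NormedSpace ℝ F]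
    (β : Fin n → ℕ) (f g : L2 Ω F) : Prop :=
  ∀ φ, IsTest Ω φ →
    ∫ x in Ω, multiD β φ x • f x = (-1 : ℝ) ^ (∑ i, β i) • ∫ x in Ω, φ x • g x

/-- The multi-indices of order at most `m`. -/
def multiIdx (n m : ℕ) : Finset (Fin n → ℕ) :=
  (Fintype.piFinset (fun _ : Fin n => Finset.range (m + 1))).filter (fun β => ∑ i, β i ≤ m)

/-- The norm `‖f‖_m = (∑_{|β| ≤ m} ‖∂^β f‖₀²)^{1/2}` of `H^m(Ω; F)`, with value `∞` if
`f ∉ H^m(Ω; F)`. (Weak derivatives are unique, so the infimum is over at most one value.) -/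
def sobNorm {Ω : Set (Vec n)} {F : Type*} [NormedAddCommGroup F] [NormedSpace ℝ F]
    (m : ℕ) (f : L2 Ω F) : ℝ≥0∞ :=
  ⨅ (D : (Fin n → ℕ) → L2 Ω F) (_ : ∀ β ∈ multiIdx n m, IsWeakD β f (D β)),
    (∑ β ∈ multiIdx n m, ‖D β‖ₑ ^ 2) ^ (1 / 2 : ℝ)

/-- `d` is the weak divergence of the vector field `w`. -/
def IsWeakDivV {Ω : Set (Vec n)} (w : L2 Ω (Vec n)) (d : L2 Ω ℝ) : Prop :=
  ∀ φ, IsTest Ω φ →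
    ∫ x in Ω, ∑ j, partialD j φ x * w x j = - ∫ x in Ω, φ x * d x

/-- `d` is the weak row-wise divergence of the matrix field `τ`. -/
def IsWeakDivM {Ω : Set (Vec n)} (τ : L2 Ω (Mat n)) (d : L2 Ω (Vec n)) : Prop :=
  ∀ φ, IsTest Ω φ → ∀ i,
    ∫ x in Ω, ∑ j, partialD j φ x * τ x (i, j) = - ∫ x in Ω, φ x * d x i

/-- `H(div, Ω)`. -/
def HdivV (Ω : Set (Vec n)) : Set (L2 Ω (Vec n)) := {w | ∃ d, IsWeakDivV w d}

/-- `H(div, Ω; 𝕄)`. -/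
def HdivM (Ω : Set (Vec n)) : Set (L2 Ω (Mat n)) := {τ | ∃ d, IsWeakDivM τ d}

/-- The divergence on `H(div, Ω)` (unspecified outside). -/
def divV {Ω : Set (Vec n)} (w : L2 Ω (Vec n)) : L2 Ω ℝ := Classical.epsilon (IsWeakDivV w)

/-- The row-wise divergence on `H(div, Ω; 𝕄)` (unspecified outside). -/
def divM {Ω : Set (Vec n)} (τ : L2 Ω (Mat n)) : L2 Ω (Vec n) := Classical.epsilon (IsWeakDivM τ)

/-- `L²(Ω; 𝕂)`, the square-integrable fields of skew-symmetric matrices. -/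
def skewL2 (Ω : Set (Vec n)) : Set (L2 Ω (Mat n)) :=
  {η | ∀ᵐ x ∂(volume.restrict Ω), IsSkewMat (η x)}

/-- The norm of `L^q(0, T; H^m(Ω; F))`, `∞` if it is not finite. -/
def LqHm {Ω : Set (Vec n)} {F : Type*} [NormedAddCommGroup F] [NormedSpace ℝ F]
    (T : ℝ) (q : ℝ≥0∞) (m : ℕ) (f : ℝ → L2 Ω F) : ℝ≥0∞ :=
  eLpNorm (fun t => sobNorm m (f t)) q (volume.restrict (Icc 0 T))

/-- The norm `‖f‖_{L^q H^m} + ‖∂f/∂t‖_{L^q H^m}` of `W^{1,q}(0, T; H^m(Ω; F))`, for `q < ∞` and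
`f` continuous in time, with value `∞` if `f` is not in this space. The (a.e. unique) weak time
derivative is the integrable `g` with `f(t) = f(0) + ∫₀ᵗ g`. -/
def W1qHm {Ω : Set (Vec n)} {F : Type*} [NormedAddCommGroup F] [NormedSpace ℝ F]
    (T : ℝ) (q : ℝ≥0∞) (m : ℕ) (f : ℝ → L2 Ω F) : ℝ≥0∞ :=
  ⨅ (g : ℝ → L2 Ω F) (_ : IntegrableOn g (Icc 0 T) volume)
    (_ : ∀ t ∈ Icc 0 T, f t = f 0 + ∫ s in (0 : ℝ)..t, g s),
    LqHm T q m f + LqHm T q m g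

/-- The norm of `L^∞(0, T; L²(Ω; F))`. -/
def LinftyL2 {Ω : Set (Vec n)} {F : Type*} [NormedAddCommGroup F]
    (T : ℝ) (f : ℝ → L2 Ω F) : ℝ≥0∞ :=
  eLpNorm f ⊤ (volume.restrict (Icc 0 T))

end Sobolev

/-- The coefficients of Biot's model, all of them functions of `x ∈ Ω`. -/
structure BiotCoeff {n : ℕ} (Ω : Set (Vec n)) where
  /-- the elastic stiffness tensor `𝒞` (only its action on symmetric matrices matters) -/
  C : Vec n → (Mat n →L[ℝ] Mat n)
  /-- the extension `𝒜` of `𝒜ˢ = 𝒞⁻¹` to all matrices -/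
  A : Vec n → (Mat n →L[ℝ] Mat n)
  /-- the constant by which `𝒜` multiplies skew-symmetric matrices -/
  cK : ℝ
  /-- the hydraulic conductivity tensor and its inverse -/
  κ : Vec n → (Vec n →L[ℝ] Vec n)
  κinv : Vec n → (Vec n →L[ℝ] Vec n)
  /-- the constrained specific storage coefficient -/
  s₀ : Vec n → ℝ
  /-- the Biot–Willis coefficient -/
  α : Vec n → ℝ
  /-- lower and upper bounds for the coefficients -/
  lo : ℝ
  hi : ℝ
  lo_pos : 0 < lo
  C_meas : AEStronglyMeasurable C (volume.restrict Ω)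
  C_sym : ∀ᵐ x ∂(volume.restrict Ω), ∀ ξ, IsSymMat ξ → IsSymMat (C x ξ)
  C_selfadj : ∀ᵐ x ∂(volume.restrict Ω), ∀ ξ ζ, IsSymMat ξ → IsSymMat ζ →
    inner ℝ (C x ξ) ζ = inner ℝ ξ (C x ζ)
  C_coercive : ∀ᵐ x ∂(volume.restrict Ω), ∀ ξ, IsSymMat ξ → lo * ‖ξ‖ ^ 2 ≤ inner ℝ (C x ξ) ξ
  C_bdd : ∀ᵐ x ∂(volume.restrict Ω), ∀ ξ, IsSymMat ξ → ‖C x ξ‖ ≤ hi * ‖ξ‖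
  A_meas : AEStronglyMeasurable A (volume.restrict Ω)
  A_sym : ∀ᵐ x ∂(volume.restrict Ω), ∀ ξ, IsSymMat ξ → IsSymMat (A x ξ) ∧ C x (A x ξ) = ξ
  cK_pos : 0 < cK
  A_skew : ∀ᵐ x ∂(volume.restrict Ω), ∀ η, IsSkewMat η → A x η = cK • η
  κ_meas : AEStronglyMeasurable κ (volume.restrict Ω)
  κ_selfadj : ∀ᵐ x ∂(volume.restrict Ω), ∀ v w, inner ℝ (κ x v) w = inner ℝ v (κ x w)
  κ_coercive : ∀ᵐ x ∂(volume.restrict Ω), ∀ v, lo * ‖v‖ ^ 2 ≤ inner ℝ (κ x v) v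
  κ_bdd : ∀ᵐ x ∂(volume.restrict Ω), ∀ v, ‖κ x v‖ ≤ hi * ‖v‖
  κinv_meas : AEStronglyMeasurable κinv (volume.restrict Ω)
  κ_κinv : ∀ᵐ x ∂(volume.restrict Ω), ∀ v, κ x (κinv x v) = v
  s₀_meas : AEStronglyMeasurable s₀ (volume.restrict Ω)
  s₀_nonneg : ∀ᵐ x ∂(volume.restrict Ω), 0 ≤ s₀ x
  s₀_bdd : ∀ᵐ x ∂(volume.restrict Ω), s₀ x ≤ hi
  α_meas : AEStronglyMeasurable α (volume.restrict Ω)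
  α_pos : ∀ᵐ x ∂(volume.restrict Ω), 0 < α x
  α_bdd : ∀ᵐ x ∂(volume.restrict Ω), α x ≤ hi

namespace BiotCoeff

variable {n : ℕ} {Ω : Set (Vec n)} (k : BiotCoeff Ω)

/-- The form `(𝒜 ξ, ζ)` for matrix fields. -/
def formA (ξ ζ : Vec n → Mat n) : ℝ := ∫ x in Ω, inner ℝ (k.A x (ξ x)) (ζ x)

/-- The norm `‖ξ‖_𝒜 = (𝒜 ξ, ξ)^{1/2}`. -/
def normA (ξ : Vec n → Mat n) : ℝ := Real.sqrt (k.formA ξ ξ)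

/-- The form `(κ⁻¹ z, w)`. -/
def formK (z w : L2 Ω (Vec n)) : ℝ := ∫ x in Ω, inner ℝ (k.κinv x (z x)) (w x)

/-- The form `(s₀ p, q)`. -/
def formS (p q : L2 Ω ℝ) : ℝ := ∫ x in Ω, k.s₀ x * p x * q x

/-- The matrix field `α q 𝐈`. -/
def alphaI (q : L2 Ω ℝ) : Vec n → Mat n := fun x => (k.α x * q x) • idMat n

/-- The matrix field `τ + α q 𝐈`. -/
def total (τ : L2 Ω (Mat n)) (q : L2 Ω ℝ) : Vec n → Mat n := fun x => τ x + k.alphaI q x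

end BiotCoeff

/-- `(σ, u, γ, z, p)` is a solution on `[0, T]` of the weak form of Biot's model with body force
`f` and source `g`; here `(σ, p) ∈ C¹(J; H(div, Ω; 𝕄) × L²(Ω))` and
`(u, γ, z) ∈ C⁰(J; L²(Ω; 𝕍) × L²(Ω; 𝕂) × H(div, Ω))`, `J = [0, T]`. -/
structure IsBiotSolution {n : ℕ} {Ω : Set (Vec n)} (k : BiotCoeff Ω) (T : ℝ)
    (f : ℝ → L2 Ω (Vec n)) (g : ℝ → L2 Ω ℝ)
    (σ : ℝ → L2 Ω (Mat n)) (u : ℝ → L2 Ω (Vec n)) (γ : ℝ → L2 Ω (Mat n))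
    (z : ℝ → L2 Ω (Vec n)) (p : ℝ → L2 Ω ℝ) : Prop where
  σ_mem : ∀ t ∈ Icc 0 T, σ t ∈ HdivM Ω
  σ_C1 : ContDiffOn ℝ 1 σ (Icc 0 T)
  divσ_C1 : ContDiffOn ℝ 1 (fun t => divM (σ t)) (Icc 0 T)
  p_C1 : ContDiffOn ℝ 1 p (Icc 0 T)
  u_C0 : ContinuousOn u (Icc 0 T)
  γ_mem : ∀ t ∈ Icc 0 T, γ t ∈ skewL2 Ω
  γ_C0 : ContinuousOn γ (Icc 0 T)
  z_mem : ∀ t ∈ Icc 0 T, z t ∈ HdivV Ω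
  z_C0 : ContinuousOn z (Icc 0 T)
  divz_C0 : ContinuousOn (fun t => divV (z t)) (Icc 0 T)
  eq1 : ∀ t ∈ Icc 0 T, ∀ τ ∈ HdivM Ω,
    k.formA (k.total (σ t) (p t)) τ + inner ℝ (u t) (divM τ) + inner ℝ (γ t) τ = 0
  eq2 : ∀ t ∈ Icc 0 T, ∀ v : L2 Ω (Vec n), ∀ η ∈ skewL2 Ω,
    inner ℝ (divM (σ t)) v + inner ℝ (σ t) η = - inner ℝ (f t) v
  eq3 : ∀ t ∈ Icc 0 T, ∀ w ∈ HdivV Ω,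
    k.formK (z t) w + inner ℝ (p t) (divV w) = 0
  eq4 : ∀ t ∈ Icc 0 T, ∀ q : L2 Ω ℝ,
    k.formS (derivWithin p (Icc 0 T) t) q
      + k.formA (k.total (derivWithin σ (Icc 0 T) t) (derivWithin p (Icc 0 T) t)) (k.alphaI q)
      - inner ℝ (divV (z t)) q = inner ℝ (g t) q

/-- A stable weakly symmetric mixed elasticity element `(Σ_h, V_h, Γ_h)` together with a stable
mixed Poisson element `(W_h, Q_h)`, on a mesh of size `h`; `r` is the order of the method, `r'` the
order of approximation of `V_h`, and `c` bounds all the stability and approximation constants. -/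
structure MixedPair {n : ℕ} (Ω : Set (Vec n)) (r r' : ℕ) (c h : ℝ) where
  Sig : Submodule ℝ (L2 Ω (Mat n))
  V : Submodule ℝ (L2 Ω (Vec n))
  Gam : Submodule ℝ (L2 Ω (Mat n))
  W : Submodule ℝ (L2 Ω (Vec n))
  Q : Submodule ℝ (L2 Ω ℝ)
  finSig : FiniteDimensional ℝ Sig
  finV : FiniteDimensional ℝ V
  finGam : FiniteDimensional ℝ Gam
  finW : FiniteDimensional ℝ W
  finQ : FiniteDimensional ℝ Q
  Sig_le : (Sig : Set (L2 Ω (Mat n))) ⊆ HdivM Ω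
  Gam_le : (Gam : Set (L2 Ω (Mat n))) ⊆ skewL2 Ω
  W_le : (W : Set (L2 Ω (Vec n))) ⊆ HdivV Ω
  /-- orders of approximation of `V_h`, `Γ_h`, `Q_h` (those of `Σ_h`, `W_h` follow from the bounds
  for `Π_h^Σ`, `Π_h^W` below) -/
  orderV : ∀ m, 1 ≤ m → m ≤ r' → ∀ v : L2 Ω (Vec n),
    ∃ v' ∈ V, ‖v - v'‖ₑ ≤ ENNReal.ofReal (c * h ^ m) * sobNorm m v
  orderGam : ∀ m, 1 ≤ m → m ≤ r → ∀ η ∈ skewL2 Ω,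
    ∃ η' ∈ Gam, ‖η - η'‖ₑ ≤ ENNReal.ofReal (c * h ^ m) * sobNorm m η
  orderQ : ∀ m, 1 ≤ m → m ≤ r → ∀ q : L2 Ω ℝ,
    ∃ q' ∈ Q, ‖q - q'‖ₑ ≤ ENNReal.ofReal (c * h ^ m) * sobNorm m q
  /-- compatibility: `div Σ_h = V_h` and `div W_h = Q_h` -/
  div_Sig : divM '' (Sig : Set (L2 Ω (Mat n))) = V
  div_W : divV '' (W : Set (L2 Ω (Vec n))) = Q
  /-- the interpolations `Π_h^Σ`, `Π_h^W`, linear maps on `H¹` with values in `Σ_h`, `W_h`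
  (written as linear maps on `L²`; only their values on `H¹` are specified) -/
  PiSig : L2 Ω (Mat n) →ₗ[ℝ] L2 Ω (Mat n)
  PiW : L2 Ω (Vec n) →ₗ[ℝ] L2 Ω (Vec n)
  PiSig_mem : ∀ τ, sobNorm 1 τ < ⊤ → PiSig τ ∈ Sig
  PiSig_div : ∀ τ, sobNorm 1 τ < ⊤ → divM (PiSig τ) = V.starProjection (divM τ)
  PiSig_err : ∀ m, 1 ≤ m → m ≤ r → ∀ τ,
    ‖τ - PiSig τ‖ₑ ≤ ENNReal.ofReal (c * h ^ m) * sobNorm m τ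
  PiW_mem : ∀ w, sobNorm 1 w < ⊤ → PiW w ∈ W
  PiW_div : ∀ w, sobNorm 1 w < ⊤ → divV (PiW w) = Q.starProjection (divV w)
  PiW_err : ∀ m, 1 ≤ m → m ≤ r → ∀ w,
    ‖w - PiW w‖ₑ ≤ ENNReal.ofReal (c * h ^ m) * sobNorm m w
  /-- stability of the mixed Poisson element -/
  stabW : ∀ q ∈ Q, ∃ w ∈ W, divV w = q ∧ Real.sqrt (‖w‖ ^ 2 + ‖divV w‖ ^ 2) ≤ c * ‖q‖
  /-- stability of the mixed elasticity element -/
  stabSig : ∀ v ∈ V, ∀ η ∈ Gam, ∃ τ ∈ Sig, divM τ = v ∧ (∀ η' ∈ Gam, inner ℝ τ η' = inner ℝ η η') ∧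
    Real.sqrt (‖τ‖ ^ 2 + ‖divM τ‖ ^ 2) ≤ c * (‖v‖ + ‖η‖)

namespace MixedPair

attribute [instance] finSig finV finGam finW finQ

variable {n : ℕ} {Ω : Set (Vec n)} {r r' : ℕ} {c h : ℝ} (S : MixedPair Ω r r' c h)

/-- `s ∈ Σ_h` is, with some `(ũ, γ̃) ∈ V_h × Γ_h`, a solution of the discrete weakly symmetric
elasticity problem with data given by `σ`. -/
def IsEllipticProj (σ s : L2 Ω (Mat n)) : Prop :=
  s ∈ S.Sig ∧ ∃ u ∈ S.V, ∃ γ ∈ S.Gam,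
    (∀ τ ∈ S.Sig, inner ℝ s τ + inner ℝ u (divM τ) + inner ℝ γ τ = inner ℝ σ τ) ∧
    (∀ v ∈ S.V, inner ℝ (divM s) v = inner ℝ (divM σ) v) ∧
    (∀ η ∈ S.Gam, inner ℝ s η = inner ℝ σ η)

/-- The weakly symmetric elliptic projection `I_h^Σ : H(div, Ω; 𝕄) → Σ_h`. -/
def ISig (σ : L2 Ω (Mat n)) : L2 Ω (Mat n) := Classical.epsilon (S.IsEllipticProj σ)

/-- The `L²` projection `P_h^V` into `V_h`. -/
def PV : L2 Ω (Vec n) →L[ℝ] L2 Ω (Vec n) := S.V.starProjection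

/-- The `L²` projection `P_h^Γ` into `Γ_h`. -/
def PGam : L2 Ω (Mat n) →L[ℝ] L2 Ω (Mat n) := S.Gam.starProjection

/-- The `L²` projection `P_h^Q` into `Q_h`. -/
def PQ : L2 Ω ℝ →L[ℝ] L2 Ω ℝ := S.Q.starProjection

/-- `(σ, u, γ, z, p)` is a solution on `[0, T]` of the semidiscrete scheme, with
`(σ, p) ∈ C¹(J; Σ_h × Q_h)` and `(u, γ, z) ∈ C⁰(J; V_h × Γ_h × W_h)`. -/
structure IsSemidiscrete (k : BiotCoeff Ω) (T : ℝ)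
    (f : ℝ → L2 Ω (Vec n)) (g : ℝ → L2 Ω ℝ)
    (σ : ℝ → L2 Ω (Mat n)) (u : ℝ → L2 Ω (Vec n)) (γ : ℝ → L2 Ω (Mat n))
    (z : ℝ → L2 Ω (Vec n)) (p : ℝ → L2 Ω ℝ) : Prop where
  σ_mem : ∀ t ∈ Icc 0 T, σ t ∈ S.Sig
  σ_C1 : ContDiffOn ℝ 1 σ (Icc 0 T)
  p_mem : ∀ t ∈ Icc 0 T, p t ∈ S.Q
  p_C1 : ContDiffOn ℝ 1 p (Icc 0 T)
  u_mem : ∀ t ∈ Icc 0 T, u t ∈ S.V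
  u_C0 : ContinuousOn u (Icc 0 T)
  γ_mem : ∀ t ∈ Icc 0 T, γ t ∈ S.Gam
  γ_C0 : ContinuousOn γ (Icc 0 T)
  z_mem : ∀ t ∈ Icc 0 T, z t ∈ S.W
  z_C0 : ContinuousOn z (Icc 0 T)
  eq1 : ∀ t ∈ Icc 0 T, ∀ τ ∈ S.Sig,
    k.formA (k.total (σ t) (p t)) τ + inner ℝ (u t) (divM τ) + inner ℝ (γ t) τ = 0
  eq2 : ∀ t ∈ Icc 0 T, ∀ v ∈ S.V, ∀ η ∈ S.Gam,
    inner ℝ (divM (σ t)) v + inner ℝ (σ t) η = - inner ℝ (f t) v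
  eq3 : ∀ t ∈ Icc 0 T, ∀ w ∈ S.W,
    k.formK (z t) w + inner ℝ (p t) (divV w) = 0
  eq4 : ∀ t ∈ Icc 0 T, ∀ q ∈ S.Q,
    k.formS (derivWithin p (Icc 0 T) t) q
      + k.formA (k.total (derivWithin σ (Icc 0 T) t) (derivWithin p (Icc 0 T) t)) (k.alphaI q)
      - inner ℝ (divV (z t)) q = inner ℝ (g t) q

end MixedPair

end

/-! Subtract the discrete equations from the exact ones. The interpolants are chosen so that the
terms that could lose an order drop out. The defect `P_h^V u - u` is orthogonal to `div Σ_h = V_h`,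
so the order of `V_h` does not limit the rate. The weakly symmetric elliptic projection makes e_σ
divergence free and orthogonal to `Γ_h` (`es_mem_kernel`), so e_u and e_γ disappear when the stress
equation is tested with e_σ or its time derivative. This projection is itself of optimal order, by
comparison with `Π_h^Σ` (`norm_sub_ISig_le`).

Two energy arguments carry the proof. Write E = e_σ + α e_p I. For the first, differentiate the
stress equation in time and test it with e_σ, Darcy's law with e_z and the mass balance with e_p.
The coupling terms cancel, and y = (𝒜E, E) + (s₀ e_p, e_p) satisfies y' ≤ 2a√y + b, where a measures
the interpolation errors of the time derivatives of σ, p, γ and b the squared one of z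
(`energy_ineq`). Since s₀ may vanish, y controls E but neither e_σ nor e_p alone. The rotation
defect does no harm: it is skew, hence orthogonal to α e_p I, and so pairs with E. For the second,
differentiate Darcy's law as well and test with the time derivatives of e_σ and e_p and with e_z;
now y = (κ⁻¹ e_z, e_z) (`energy_ineq_deriv`). Evaluating at the maximum of y closes both
(`sqrt_le_of_deriv_le`), without an exponential factor.

The other errors follow from stability: (S3) bounds e_p by e_z (`norm_ep_le`), then e_σ = E - α e_p
I, and (S4) bounds e_u and e_γ by E (`norm_eu_add_norm_eg_le`).

The analytic difficulty is regularity in time. The functions γ and z have only weak time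
derivatives, so energy identities are needed for absolutely continuous functions
(`IsTimeDeriv.quadratic`). The discrete flux is only assumed continuous, but it is a bounded linear
image of the C¹ function p_h (`exists_flux_map`). Finally `Π_h^W` is bounded on H^m and not on L²,
so integrals in time have to be lifted to H^m (`exists_integrable_lift`). -/

/-! ### The space H^m inside L²: completeness, measurability of its norm, integrals. -/

section Sobolev

variable {n : ℕ} {Ω : Set (Vec n)} {F : Type*} [NormedAddCommGroup F] [NormedSpace ℝ F]

theorem IsTest.partialD {φ : Vec n → ℝ} (hφ : IsTest Ω φ) (i : Fin n) :
    IsTest Ω (partialD i φ) := by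
  obtain ⟨h1, h2, h3⟩ := hφ
  have hsub : tsupport (_root_.partialD i φ) ⊆ tsupport φ :=
    (closure_mono (fun x hx => by
      simp only [Function.mem_support] at hx ⊢
      intro h0
      apply hx
      unfold _root_.partialD
      rw [h0]; rfl)).trans (tsupport_fderiv_subset ℝ (f := φ))
  refine ⟨?_, ?_, hsub.trans h3⟩
  · exact (h1.fderiv_right (m := ∞) (by norm_cast)).clm_apply contDiff_const
  · exact h2.of_isClosed_subset (isClosed_tsupport _) hsub

theorem IsTest.multiD {φ : Vec n → ℝ} (hφ : IsTest Ω φ) (β : Fin n → ℕ) :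
    IsTest Ω (multiD β φ) := by
  unfold _root_.multiD
  induction List.finRange n with
  | nil => exact hφ
  | cons i l ih =>
    rw [List.foldr_cons]
    generalize List.foldr (fun i ψ => (_root_.partialD i)^[β i] ψ) φ l = ψ at ih
    induction β i with
    | zero => exact ih
    | succ k ihk =>
      rw [Function.iterate_succ_apply']
      exact ihk.partialD i

theorem multiD_zero (φ : Vec n → ℝ) : multiD 0 φ = φ := by
  unfold multiD
  induction List.finRange n with
  | nil => rfl
  | cons i l ih => rw [List.foldr_cons, ih]; rfl

theorem IsTest.memLp {φ : Vec n → ℝ} (hφ : IsTest Ω φ) :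
    MemLp φ 2 (volume.restrict Ω) :=
  (hφ.1.continuous.memLp_of_hasCompactSupport hφ.2.1).restrict _

/-- Integration against a test function, as a continuous linear map on `L²`. -/
noncomputable def testInt (Ω : Set (Vec n)) (F : Type*) [NormedAddCommGroup F] [NormedSpace ℝ F]
    [CompleteSpace F] (φ : Vec n → ℝ) (hφ : IsTest Ω φ) : L2 Ω F →L[ℝ] F :=
  (ContinuousLinearMap.lsmul ℝ ℝ : ℝ →L[ℝ] F →L[ℝ] F).lpPairing (volume.restrict Ω) 2 2
    hφ.memLp.toLp

theorem testInt_apply [CompleteSpace F] {φ : Vec n → ℝ} (hφ : IsTest Ω φ) (f : L2 Ω F) :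
    testInt Ω F φ hφ f = ∫ x in Ω, φ x • f x := by
  unfold testInt
  rw [ContinuousLinearMap.lpPairing_eq_integral]
  refine integral_congr_ae ?_
  filter_upwards [hφ.memLp.coeFn_toLp] with x hx
  simp [hx]

/-- The fundamental lemma of the calculus of variations. All uniqueness statements for weak
derivatives and weak divergences rest on it. -/
theorem eq_of_testInt_eq [CompleteSpace F] (hΩ : IsOpen Ω) {f g : L2 Ω F}
    (h : ∀ φ (hφ : IsTest Ω φ), testInt Ω F φ hφ f = testInt Ω F φ hφ g) : f = g := by
  rw [← sub_eq_zero]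
  have hae : ∀ᵐ x, x ∈ Ω → (f - g : L2 Ω F) x = 0 := by
    refine hΩ.ae_eq_zero_of_integral_contDiff_smul_eq_zero ?_ ?_
    · have h1 : LocallyIntegrable (fun x => (f - g : L2 Ω F) x) (volume.restrict Ω) :=
        (Lp.memLp (f - g)).locallyIntegrable (by norm_num)
      exact locallyIntegrableOn_of_locallyIntegrable_restrict h1
    · intro φ h1 h2 h3
      have hφ : IsTest Ω φ := ⟨h1, h2, h3⟩
      have := sub_eq_zero.2 (h φ hφ)
      rw [← map_sub, testInt_apply] at this
      rw [← this]
      symm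
      refine setIntegral_eq_integral_of_forall_compl_eq_zero fun x hx => ?_
      have : φ x = 0 := by
        by_contra h0
        exact hx (h3 (subset_tsupport _ h0))
      simp [this]
  rw [Lp.eq_zero_iff_ae_eq_zero]
  exact (ae_restrict_iff' hΩ.measurableSet).2 hae

theorem isWeakD_iff [CompleteSpace F] {β : Fin n → ℕ} {f g : L2 Ω F} :
    IsWeakD β f g ↔ ∀ φ (hφ : IsTest Ω φ), testInt Ω F _ (hφ.multiD β) f =
      (-1 : ℝ) ^ (∑ i, β i) • testInt Ω F φ hφ g := by
  simp only [IsWeakD, testInt_apply]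

theorem IsWeakD.unique [CompleteSpace F] (hΩ : IsOpen Ω) {β : Fin n → ℕ} {f g g' : L2 Ω F}
    (h : IsWeakD β f g) (h' : IsWeakD β f g') : g = g' := by
  rw [isWeakD_iff] at h h'
  refine eq_of_testInt_eq hΩ fun φ hφ => ?_
  have := (h φ hφ).symm.trans (h' φ hφ)
  exact smul_right_injective F (pow_ne_zero _ (by norm_num : (-1 : ℝ) ≠ 0)) this

theorem isWeakD_zero [CompleteSpace F] (f : L2 Ω F) : IsWeakD 0 f f := by
  intro φ _
  simp [multiD_zero]

theorem sobNorm_mono {k m : ℕ} (hkm : k ≤ m) (f : L2 Ω F) : sobNorm k f ≤ sobNorm m f := by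
  have hsub : multiIdx n k ⊆ multiIdx n m := by
    intro β hβ
    simp only [multiIdx, Finset.mem_filter, Fintype.mem_piFinset, Finset.mem_range] at hβ ⊢
    exact ⟨fun i => lt_of_lt_of_le (hβ.1 i) (by omega), hβ.2.trans hkm⟩
  unfold sobNorm
  refine le_iInf₂ fun D hD => iInf₂_le_of_le D (fun β hβ => hD β (hsub hβ)) ?_
  gcongr

theorem zero_mem_multiIdx (n m : ℕ) : (0 : Fin n → ℕ) ∈ multiIdx n m := by
  simp [multiIdx]

/-- The tuples of weak derivatives of the functions in `H^m(Ω; F)`. -/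
def sobGraph (Ω : Set (Vec n)) (F : Type*) [NormedAddCommGroup F] [NormedSpace ℝ F]
    [CompleteSpace F] (m : ℕ) : Submodule ℝ (PiLp 2 (fun _ : multiIdx n m => L2 Ω F)) where
  carrier := {D | ∀ β, IsWeakD β.1 (D ⟨0, zero_mem_multiIdx n m⟩) (D β)}
  add_mem' := by
    intro D D' h h' β
    have h := h β
    have h' := h' β
    rw [isWeakD_iff] at *
    intro φ hφ
    simp [h φ hφ, h' φ hφ]
  zero_mem' := by
    intro β
    rw [isWeakD_iff]
    intro φ hφ
    simp
  smul_mem' := by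
    intro c D h β
    have h := h β
    rw [isWeakD_iff] at *
    intro φ hφ
    simp only [PiLp.smul_apply, map_smul, h φ hφ]
    rw [smul_comm]

variable [CompleteSpace F] {m : ℕ}

theorem mem_sobGraph {D : PiLp 2 (fun _ : multiIdx n m => L2 Ω F)} :
    D ∈ sobGraph Ω F m ↔ ∀ β, IsWeakD β.1 (D ⟨0, zero_mem_multiIdx n m⟩) (D β) := Iff.rfl

/-- Each defining identity equates two continuous linear maps on L² tuples, so H^m is complete.
Completeness is what Bochner integration in H^m and the Lusin–Souslin theorem require. -/
theorem isClosed_sobGraph : IsClosed (sobGraph Ω F m : Set (PiLp 2 fun _ : multiIdx n m => L2 Ω F)) := by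
  have : (sobGraph Ω F m : Set (PiLp 2 fun _ : multiIdx n m => L2 Ω F)) =
      ⋂ (β : multiIdx n m) (φ : Vec n → ℝ) (hφ : IsTest Ω φ),
        {D | testInt Ω F _ (hφ.multiD β.1) (D ⟨0, zero_mem_multiIdx n m⟩) =
      (-1 : ℝ) ^ (∑ i, β.1 i) • testInt Ω F φ hφ (D β)} := by
    ext D
    simp only [SetLike.mem_coe, mem_sobGraph, isWeakD_iff, mem_iInter, mem_ofPred_eq]
  rw [this]
  refine isClosed_iInter fun β => isClosed_iInter fun φ => isClosed_iInter fun hφ =>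
    isClosed_eq (by fun_prop) (by fun_prop)

/-- The embedding of `H^m(Ω; F)` into `L²(Ω; F)`. -/
noncomputable def sobEmb (Ω : Set (Vec n)) (F : Type*) [NormedAddCommGroup F] [NormedSpace ℝ F]
    [CompleteSpace F] (m : ℕ) : sobGraph Ω F m →L[ℝ] L2 Ω F :=
  (PiLp.proj 2 (fun _ : multiIdx n m => L2 Ω F) ⟨0, zero_mem_multiIdx n m⟩).comp
    (sobGraph Ω F m).subtypeL

theorem sobEmb_injective (hΩ : IsOpen Ω) : Function.Injective (sobEmb Ω F m) := by
  rintro ⟨D, hD⟩ ⟨D', hD'⟩ h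
  have h0 : D ⟨0, zero_mem_multiIdx n m⟩ = D' ⟨0, zero_mem_multiIdx n m⟩ := h
  ext β : 2
  have h1 := hD' β
  rw [← h0] at h1
  exact (hD β).unique hΩ h1

theorem sobNorm_sobEmb (hΩ : IsOpen Ω) (D : sobGraph Ω F m) :
    sobNorm m (sobEmb Ω F m D) = ‖D‖ₑ := by
  have hn : ‖D‖ₑ = (∑ β : multiIdx n m, ‖D.1 β‖ₑ ^ 2) ^ (1 / 2 : ℝ) := by
    have h1 : ‖D‖ₑ = ‖D.1‖ₑ := rfl
    rw [h1, ← ofReal_norm, PiLp.norm_eq_of_L2, Real.sqrt_eq_rpow,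
      ← ENNReal.ofReal_rpow_of_nonneg (by positivity) (by norm_num),
      ENNReal.ofReal_sum_of_nonneg (fun _ _ => by positivity)]
    simp_rw [ENNReal.ofReal_pow (norm_nonneg _), ofReal_norm]
  rw [hn]
  apply le_antisymm
  · classical
    unfold sobNorm
    refine iInf₂_le_of_le (fun β => if h : β ∈ multiIdx n m then D.1 ⟨β, h⟩ else 0) ?_ ?_
    · intro β hβ
      simp only [hβ, dite_true]
      exact D.2 ⟨β, hβ⟩
    · rw [← Finset.sum_coe_sort (multiIdx n m)]
      simp
  · refine le_iInf₂ fun D' hD' => ?_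
    rw [← Finset.sum_coe_sort (multiIdx n m)]
    refine le_of_eq ?_
    congr 1
    refine Finset.sum_congr rfl fun β _ => ?_
    rw [(D.2 β).unique hΩ (hD' β.1 β.2)]

theorem exists_sobEmb_eq (hΩ : IsOpen Ω) {f : L2 Ω F} (hf : sobNorm m f < ⊤) :
    ∃ D, sobEmb Ω F m D = f := by
  unfold sobNorm at hf
  simp only [iInf_lt_iff] at hf
  obtain ⟨D, hD, -⟩ := hf
  have h0 : D 0 = f := (hD 0 (zero_mem_multiIdx n m)).unique hΩ (isWeakD_zero f)
  refine ⟨⟨WithLp.toLp 2 (fun β => D β.1), ?_⟩, h0⟩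
  intro β
  have := hD β.1 β.2
  rw [← h0] at this
  exact this

instance : CompleteSpace (sobGraph Ω F m) := isClosed_sobGraph.completeSpace_coe

/-- In this form, an extension by ∞ along an injection, measurability of the norm reduces to that of
the embedding. -/
theorem sobNorm_eq_extend (hΩ : IsOpen Ω) :
    (sobNorm m : L2 Ω F → ℝ≥0∞) =
      Function.extend (sobEmb Ω F m) (fun D => ‖D‖ₑ) (fun _ => ⊤) := by
  funext f
  by_cases h : ∃ D, sobEmb Ω F m D = f
  · obtain ⟨D, rfl⟩ := h
    rw [(sobEmb_injective hΩ).extend_apply, sobNorm_sobEmb hΩ]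
  · rw [Function.extend_apply' _ _ _ h]
    by_contra h0
    exact h (exists_sobEmb_eq hΩ (lt_top_iff_ne_top.2 h0))

theorem sobNorm_add_le (hΩ : IsOpen Ω) (f g : L2 Ω F) :
    sobNorm m (f + g) ≤ sobNorm m f + sobNorm m g := by
  by_cases hf : sobNorm m f < ⊤
  · by_cases hg : sobNorm m g < ⊤
    · obtain ⟨D, rfl⟩ := exists_sobEmb_eq hΩ hf
      obtain ⟨D', rfl⟩ := exists_sobEmb_eq hΩ hg
      rw [← map_add, sobNorm_sobEmb hΩ, sobNorm_sobEmb hΩ, sobNorm_sobEmb hΩ]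
      exact enorm_add_le _ _
    · rw [not_lt_top_iff.1 hg]; simp
  · rw [not_lt_top_iff.1 hf]; simp

variable [SecondCountableTopology F]

/-- The Lusin–Souslin theorem: a continuous injection of a Polish space maps Borel sets to Borel
sets. -/
theorem measurableEmbedding_sobEmb (hΩ : IsOpen Ω) [MeasurableSpace (L2 Ω F)] [BorelSpace (L2 Ω F)]
    [MeasurableSpace (sobGraph Ω F m)] [BorelSpace (sobGraph Ω F m)] :
    MeasurableEmbedding (sobEmb Ω F m) := by
  have : Fact ((2 : ℝ≥0∞) ≠ ⊤) := ⟨by norm_num⟩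
  have : SecondCountableTopology (PiLp 2 fun _ : multiIdx n m => L2 Ω F) :=
    (PiLp.homeomorph 2 (fun _ : multiIdx n m => L2 Ω F)).secondCountableTopology
  exact (sobEmb Ω F m).continuous.measurableEmbedding (sobEmb_injective hΩ)

theorem measurable_sobNorm (hΩ : IsOpen Ω) [MeasurableSpace (L2 Ω F)] [BorelSpace (L2 Ω F)] :
    Measurable (sobNorm m : L2 Ω F → ℝ≥0∞) := by
  let : MeasurableSpace (sobGraph Ω F m) := borel _
  have : BorelSpace (sobGraph Ω F m) := ⟨rfl⟩
  rw [sobNorm_eq_extend hΩ]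
  exact (measurableEmbedding_sobEmb hΩ).measurable_extend measurable_enorm measurable_const

theorem aemeasurable_sobNorm (hΩ : IsOpen Ω) {X : Type*} [MeasurableSpace X] {μ : Measure X}
    {g : X → L2 Ω F} (hg : AEStronglyMeasurable g μ) : AEMeasurable (fun s => sobNorm m (g s)) μ := by
  let : MeasurableSpace (L2 Ω F) := borel _
  have : BorelSpace (L2 Ω F) := ⟨rfl⟩
  exact (measurable_sobNorm hΩ).comp_aemeasurable hg.aemeasurable

/-- Upgrades an L²-valued function to an H^m-valued Bochner integrable one. Measurability of the
lift is the point; it comes from the measurable inverse of the embedding. -/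
theorem exists_integrable_lift (hΩ : IsOpen Ω) {X : Type*} [MeasurableSpace X] {μ : Measure X}
    {g : X → L2 Ω F} (hg : AEStronglyMeasurable g μ) (hfin : ∫⁻ s, sobNorm m (g s) ∂μ < ⊤) :
    ∃ D : X → sobGraph Ω F m, Integrable D μ ∧ ∀ᵐ s ∂μ, sobEmb Ω F m (D s) = g s := by
  let : MeasurableSpace (L2 Ω F) := borel _
  have : BorelSpace (L2 Ω F) := ⟨rfl⟩
  let : MeasurableSpace (sobGraph Ω F m) := borel _
  have : BorelSpace (sobGraph Ω F m) := ⟨rfl⟩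
  have : Fact ((2 : ℝ≥0∞) ≠ ⊤) := ⟨by norm_num⟩
  have : SecondCountableTopology (PiLp 2 fun _ : multiIdx n m => L2 Ω F) :=
    (PiLp.homeomorph 2 (fun _ : multiIdx n m => L2 Ω F)).secondCountableTopology
  -- The inverse of the embedding, set to 0 off its range, is Borel measurable.
  have hR : Measurable (Function.extend (sobEmb Ω F m) id (fun _ => 0)) :=
    (measurableEmbedding_sobEmb hΩ).measurable_extend measurable_id measurable_const
  have hlift : ∀ᵐ s ∂μ, sobEmb Ω F m (Function.extend (sobEmb Ω F m) id (fun _ => 0) (g s)) = g s := by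
    filter_upwards [ae_lt_top' (aemeasurable_sobNorm hΩ hg) hfin.ne] with s hs
    obtain ⟨D, hD⟩ := exists_sobEmb_eq hΩ hs
    rw [← hD, (sobEmb_injective hΩ).extend_apply]
    rfl
  refine ⟨fun s => Function.extend (sobEmb Ω F m) id (fun _ => 0) (g s), ⟨?_, ?_⟩, hlift⟩
  · exact (hR.comp_aemeasurable hg.aemeasurable).aestronglyMeasurable
  · rw [hasFiniteIntegral_iff_enorm]
    refine lt_of_le_of_lt (lintegral_mono_ae ?_) hfin
    filter_upwards [hlift] with s hs
    rw [← sobNorm_sobEmb hΩ, hs]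

/-- Minkowski's integral inequality for the Sobolev norm. -/
theorem sobNorm_integral_le (hΩ : IsOpen Ω) {X : Type*} [MeasurableSpace X] {μ : Measure X}
    {g : X → L2 Ω F} (hg : AEStronglyMeasurable g μ) :
    sobNorm m (∫ s, g s ∂μ) ≤ ∫⁻ s, sobNorm m (g s) ∂μ := by
  by_cases hfin : ∫⁻ s, sobNorm m (g s) ∂μ < ⊤
  · obtain ⟨D, hD, hDg⟩ := exists_integrable_lift hΩ hg hfin
    rw [← integral_congr_ae hDg, (sobEmb Ω F m).integral_comp_comm hD, sobNorm_sobEmb hΩ]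
    refine (enorm_integral_le_lintegral_enorm _).trans (lintegral_mono_ae ?_)
    filter_upwards [hDg] with s hs
    rw [← hs, sobNorm_sobEmb hΩ]
  · rw [not_lt_top_iff.1 hfin]
    exact le_top

/-- Meant for maps such as `Π_h^W`, which need not be continuous on L². Composed with the embedding,
`B` becomes continuous on H^m, and there it commutes with the integral. -/
theorem integral_comp_of_le_sobNorm (hΩ : IsOpen Ω) {Y : Type*} [NormedAddCommGroup Y]
    [NormedSpace ℝ Y] [CompleteSpace Y] (B : L2 Ω F →ₗ[ℝ] Y) {C : ℝ} (hC : 0 ≤ C)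
    (hB : ∀ f, ‖B f‖ₑ ≤ ENNReal.ofReal C * sobNorm m f)
    {X : Type*} [MeasurableSpace X] {μ : Measure X}
    {g : X → L2 Ω F} (hg : AEStronglyMeasurable g μ) (hfin : ∫⁻ s, sobNorm m (g s) ∂μ < ⊤) :
    Integrable (fun s => B (g s)) μ ∧ ∫ s, B (g s) ∂μ = B (∫ s, g s ∂μ) := by
  obtain ⟨D, hD, hDg⟩ := exists_integrable_lift hΩ hg hfin
  let L : sobGraph Ω F m →L[ℝ] Y := (B ∘ₗ (sobEmb Ω F m).toLinearMap).mkContinuous C fun D => by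
    have := hB (sobEmb Ω F m D)
    rw [sobNorm_sobEmb hΩ, ← ofReal_norm, ← ofReal_norm, ← ENNReal.ofReal_mul hC,
      ENNReal.ofReal_le_ofReal_iff (by positivity)] at this
    exact this
  have hL : (fun s => L (D s)) =ᵐ[μ] fun s => B (g s) := by
    filter_upwards [hDg] with s hs
    rw [← hs]; rfl
  refine ⟨(L.integrable_comp hD).congr hL, ?_⟩
  rw [← integral_congr_ae hL, L.integral_comp_comm hD, ← integral_congr_ae hDg,
    (sobEmb Ω F m).integral_comp_comm hD]
  rfl

end Sobolev

/-! ### Weak time derivatives, the energy identity and the Grönwall type bound. -/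

section TimeDerivative

open Filter Topology

/-- `g` is the integrable weak derivative on `[0, T]` of the continuous function `f`. -/
structure IsTimeDeriv {Y : Type*} [NormedAddCommGroup Y] [NormedSpace ℝ Y] (T : ℝ) (f g : ℝ → Y) :
    Prop where
  integrable : IntegrableOn g (Icc 0 T) volume
  eq_integral : ∀ t ∈ Icc 0 T, f t = f 0 + ∫ s in (0 : ℝ)..t, g s

namespace IsTimeDeriv

variable {Y : Type*} [NormedAddCommGroup Y] [NormedSpace ℝ Y] {T : ℝ} {f g : ℝ → Y}

theorem intervalIntegrable (h : IsTimeDeriv T f g) {s t : ℝ} (hs : s ∈ Icc 0 T) (ht : t ∈ Icc 0 T) :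
    IntervalIntegrable g volume s t := by
  rw [intervalIntegrable_iff]
  exact h.integrable.mono_set ((uIoc_subset_uIcc).trans (uIcc_subset_Icc hs ht))

theorem sub_eq (h : IsTimeDeriv T f g) {s t : ℝ} (hs : s ∈ Icc 0 T) (ht : t ∈ Icc 0 T) :
    f t = f s + ∫ x in s..t, g x := by
  have h0 : (0 : ℝ) ∈ Icc 0 T := ⟨le_rfl, hs.1.trans hs.2⟩
  rw [h.eq_integral t ht, h.eq_integral s hs, add_assoc,
    intervalIntegral.integral_add_adjacent_intervals (h.intervalIntegrable h0 hs)
      (h.intervalIntegrable hs ht)]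

theorem continuousOn (h : IsTimeDeriv T f g) : ContinuousOn f (Icc 0 T) := by
  refine ContinuousOn.congr ?_ h.eq_integral
  refine continuousOn_const.add ?_
  by_cases hT : 0 ≤ T
  · have := intervalIntegral.continuousOn_primitive_interval (a := 0) (b := T) (f := g)
      (μ := volume) (by rw [uIcc_of_le hT]; exact h.integrable)
    rwa [uIcc_of_le hT] at this
  · rw [Icc_eq_empty hT]; exact continuousOn_empty _

theorem aestronglyMeasurable (h : IsTimeDeriv T f g) :
    AEStronglyMeasurable f (volume.restrict (Icc 0 T)) :=
  h.continuousOn.aestronglyMeasurable_of_isCompact isCompact_Icc measurableSet_Icc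

theorem clm_comp {Z : Type*} [NormedAddCommGroup Z] [NormedSpace ℝ Z] [CompleteSpace Y]
    [CompleteSpace Z] (h : IsTimeDeriv T f g) (L : Y →L[ℝ] Z) :
    IsTimeDeriv T (fun t => L (f t)) (fun t => L (g t)) where
  integrable := L.integrable_comp h.integrable
  eq_integral t ht := by
    rw [h.eq_integral t ht, map_add, L.intervalIntegral_comp_comm
      (h.intervalIntegrable ⟨le_rfl, ht.1.trans ht.2⟩ ht)]

theorem add {f' g' : ℝ → Y} (h : IsTimeDeriv T f g) (h' : IsTimeDeriv T f' g') :
    IsTimeDeriv T (fun t => f t + f' t) (fun t => g t + g' t) where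
  integrable := h.integrable.add h'.integrable
  eq_integral t ht := by
    have h0 : (0 : ℝ) ∈ Icc 0 T := ⟨le_rfl, ht.1.trans ht.2⟩
    rw [h.eq_integral t ht, h'.eq_integral t ht, intervalIntegral.integral_add
      (h.intervalIntegrable h0 ht) (h'.intervalIntegrable h0 ht)]
    abel

theorem neg (h : IsTimeDeriv T f g) :
    IsTimeDeriv T (fun t => - f t) (fun t => - g t) where
  integrable := h.integrable.neg
  eq_integral t ht := by
    rw [h.eq_integral t ht, intervalIntegral.integral_neg, neg_add]

theorem sub {f' g' : ℝ → Y} (h : IsTimeDeriv T f g) (h' : IsTimeDeriv T f' g') :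
    IsTimeDeriv T (fun t => f t - f' t) (fun t => g t - g' t) := by
  simpa only [sub_eq_add_neg] using h.add h'.neg

/-- Lebesgue differentiation. The conclusion records interior points because there an identity valid
on all of `Icc 0 T` holds in a neighbourhood and may be differentiated. -/
theorem ae_hasDerivAt [CompleteSpace Y] (hT : 0 < T) (h : IsTimeDeriv T f g) :
    ∀ᵐ t ∂(volume.restrict (Icc 0 T)), t ∈ Ioo 0 T ∧ HasDerivAt f (g t) t := by
  have h0 : (0 : ℝ) ∈ Icc 0 T := ⟨le_rfl, hT.le⟩
  have h1 := (h.intervalIntegrable h0 (right_mem_Icc.2 hT.le)).ae_hasDerivAt_integral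
  rw [ae_restrict_iff' measurableSet_Icc]
  have h2 : ∀ᵐ x : ℝ, x ≠ 0 := by simp [ae_iff, measure_singleton]
  have h3 : ∀ᵐ x : ℝ, x ≠ T := by simp [ae_iff, measure_singleton]
  filter_upwards [h1, h2, h3] with t h1 h2 h3 ht
  have ht' : t ∈ Ioo 0 T := ⟨lt_of_le_of_ne ht.1 h2.symm, lt_of_le_of_ne ht.2 h3⟩
  refine ⟨ht', ?_⟩
  have h4 := (h1 (by rwa [uIcc_of_le hT.le]) 0 (by simp)).const_add (f 0)
  refine h4.congr_of_eventuallyEq ?_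
  filter_upwards [Icc_mem_nhds ht'.1 ht'.2] with s hs using h.eq_integral s hs

theorem ae_unique [CompleteSpace Y] (hT : 0 < T) {g' : ℝ → Y} (h : IsTimeDeriv T f g)
    (h' : IsTimeDeriv T f g') : g =ᵐ[volume.restrict (Icc 0 T)] g' := by
  filter_upwards [h.ae_hasDerivAt hT, h'.ae_hasDerivAt hT] with t h1 h2
  exact h1.2.unique h2.2

theorem of_contDiffOn [CompleteSpace Y] (hT : 0 < T) (h : ContDiffOn ℝ 1 f (Icc 0 T)) :
    IsTimeDeriv T f (derivWithin f (Icc 0 T)) := by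
  have hc : ContinuousOn (derivWithin f (Icc 0 T)) (Icc 0 T) :=
    h.continuousOn_derivWithin (uniqueDiffOn_Icc hT) le_rfl
  refine ⟨hc.integrableOn_compact isCompact_Icc, fun t ht => ?_⟩
  have hsub : Icc 0 t ⊆ Icc 0 T := Icc_subset_Icc_right ht.2
  have := intervalIntegral.integral_eq_sub_of_hasDerivAt_of_le (f := f)
    (f' := derivWithin f (Icc 0 T)) ht.1 (h.continuousOn.mono hsub)
    (fun x hx => ((h.differentiableOn one_ne_zero x ⟨hx.1.le, hx.2.le.trans ht.2⟩).hasDerivWithinAt.hasDerivAt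
      (Icc_mem_nhds hx.1 (hx.2.trans_le ht.2))))
    ((hc.mono hsub).intervalIntegrable_of_Icc ht.1)
  rw [this]; abel

/-- The energy identity for absolutely continuous functions with values in a Hilbert space. -/
theorem quadratic {H : Type*} [NormedAddCommGroup H] [InnerProductSpace ℝ H] [CompleteSpace H]
    (hT : 0 < T) {f g : ℝ → H} (h : IsTimeDeriv T f g) (B : H →L[ℝ] H)
    (hB : ∀ x y, inner ℝ (B x) y = inner ℝ x (B y)) :
    IsTimeDeriv T (fun t => inner ℝ (B (f t)) (f t)) (fun t => 2 * inner ℝ (B (g t)) (f t)) := by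
  have h0 : (0 : ℝ) ∈ Icc 0 T := ⟨le_rfl, hT.le⟩
  have hTT : T ∈ Icc 0 T := right_mem_Icc.2 hT.le
  obtain ⟨M, hM⟩ := isCompact_Icc.exists_bound_of_continuousOn h.continuousOn
  have hM0 : 0 ≤ M := (norm_nonneg _).trans (hM 0 h0)
  have hN := (h.intervalIntegrable h0 hTT).norm.absolutelyContinuousOnInterval_intervalIntegral
    (c := 0) (by simp)
  -- The increments of the quadratic form are dominated by those of the primitive of `‖g‖`, which is
  -- absolutely continuous.
  have hAC : AbsolutelyContinuousOnInterval (fun t => inner ℝ (B (f t)) (f t)) 0 T := by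
    have hlip : ∀ s ∈ Icc 0 T, ∀ t ∈ Icc 0 T,
        dist (inner ℝ (B (f s)) (f s)) (inner ℝ (B (f t)) (f t)) ≤
          (2 * ‖B‖ * M) * dist (∫ x in (0 : ℝ)..s, ‖g x‖) (∫ x in (0 : ℝ)..t, ‖g x‖) := by
      intro s hs t ht
      -- Difference of squares for the symmetric form of `B`.
      have e1 : inner ℝ (B (f s)) (f s) - inner ℝ (B (f t)) (f t) =
          inner ℝ (B (f s + f t)) (f s - f t) := by
        have := hB (f s) (f t)
        rw [real_inner_comm] at this
        simp only [map_add, inner_add_left, inner_sub_right, hB (f s) (f t),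
          real_inner_comm (B (f t)) (f s)]
        ring
      have e2 : ‖f s - f t‖ ≤ dist (∫ x in (0 : ℝ)..s, ‖g x‖) (∫ x in (0 : ℝ)..t, ‖g x‖) := by
        rw [h.sub_eq ht hs, add_sub_cancel_left, Real.dist_eq,
          intervalIntegral.integral_interval_sub_left (h.intervalIntegrable h0 hs).norm
            (h.intervalIntegrable h0 ht).norm]
        exact intervalIntegral.norm_integral_le_abs_integral_norm
      rw [Real.dist_eq, e1]
      calc |inner ℝ (B (f s + f t)) (f s - f t)| ≤ ‖B (f s + f t)‖ * ‖f s - f t‖ :=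
            abs_real_inner_le_norm _ _
        _ ≤ (‖B‖ * (M + M)) * ‖f s - f t‖ := by
            gcongr
            refine (B.le_opNorm _).trans ?_
            gcongr
            exact (norm_add_le _ _).trans (add_le_add (hM s hs) (hM t ht))
        _ ≤ _ := by
            rw [show ‖B‖ * (M + M) = 2 * ‖B‖ * M by ring]
            gcongr
    rw [absolutelyContinuousOnInterval_iff] at hN ⊢
    intro ε hε
    -- The `+ 1` covers the case in which the Lipschitz factor vanishes.
    obtain ⟨δ, hδ, H⟩ := hN (ε / (2 * ‖B‖ * M + 1)) (by positivity)
    refine ⟨δ, hδ, fun E hE hlt => ?_⟩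
    have h1 := H E hE hlt
    have hE' := hE.1
    rw [uIcc_of_le hT.le] at hE'
    calc ∑ i ∈ Finset.range E.1, _ ≤ ∑ i ∈ Finset.range E.1, (2 * ‖B‖ * M) *
          dist (∫ x in (0 : ℝ)..(E.2 i).1, ‖g x‖) (∫ x in (0 : ℝ)..(E.2 i).2, ‖g x‖) :=
          Finset.sum_le_sum fun i hi => hlip _ (hE' i hi).1 _ (hE' i hi).2
      _ = (2 * ‖B‖ * M) * _ := by rw [← Finset.mul_sum]
      _ ≤ (2 * ‖B‖ * M) * (ε / (2 * ‖B‖ * M + 1)) := by gcongr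
      _ < ε := by
          rw [mul_div_assoc', div_lt_iff₀ (by positivity)]
          nlinarith
  have hder : ∀ᵐ t, t ∈ Icc 0 T →
      deriv (fun t => inner ℝ (B (f t)) (f t)) t = 2 * inner ℝ (B (g t)) (f t) := by
    have := h.ae_hasDerivAt hT
    rw [ae_restrict_iff' measurableSet_Icc] at this
    filter_upwards [this] with t ht htm
    have hd := (ht htm).2
    have h2 := ((B.hasFDerivAt.comp_hasDerivAt t hd).inner ℝ hd).deriv
    simp only [Function.comp_def] at h2
    rw [h2, hB, real_inner_comm]
    ring
  constructor
  · have := hAC.intervalIntegrable_deriv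
    rw [intervalIntegrable_iff_integrableOn_Icc_of_le hT.le] at this
    refine this.congr_fun_ae ?_
    exact (ae_restrict_iff' measurableSet_Icc).2 hder
  · intro t ht
    have hsub : uIcc 0 t ⊆ uIcc 0 T := by
      rw [uIcc_of_le hT.le, uIcc_of_le ht.1]; exact Icc_subset_Icc_right ht.2
    have h1 := (hAC.mono hsub).integral_deriv_eq_sub
    rw [← intervalIntegral.integral_congr_ae (f := deriv (fun t => inner ℝ (B (f t)) (f t)))
      (g := fun t => 2 * inner ℝ (B (g t)) (f t)), h1]
    · ring
    · filter_upwards [hder] with s hs hs'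
      rw [uIoc_of_le ht.1] at hs'
      exact hs ⟨hs'.1.le, hs'.2.trans ht.2⟩

end IsTimeDeriv

/-- A Grönwall type bound: if `y' ≤ 2 a √y + b`, then `√y ≤ √y(0) + 2 ∫ a + √(∫ b)`. -/
theorem sqrt_le_of_deriv_le {T : ℝ} (hT : 0 < T) {y y' a : ℝ → ℝ} {b : ℝ → ℝ≥0∞}
    (hy0 : ∀ t ∈ Icc 0 T, 0 ≤ y t) (hy : IsTimeDeriv T y y')
    (ha : AEMeasurable a (volume.restrict (Icc 0 T))) (ha0 : ∀ t, 0 ≤ a t)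
    (hle : ∀ᵐ t ∂(volume.restrict (Icc 0 T)),
      ENNReal.ofReal (y' t) ≤ ENNReal.ofReal (2 * a t * √(y t)) + b t)
    {α β : ℝ} (hα0 : 0 ≤ α) (hβ0 : 0 ≤ β)
    (hα : ∫⁻ t in Icc 0 T, ENNReal.ofReal (a t) ≤ ENNReal.ofReal α)
    (hβ : ∫⁻ t in Icc 0 T, b t ≤ ENNReal.ofReal (β ^ 2)) :
    ∀ t ∈ Icc 0 T, √(y t) ≤ √(y 0) + 2 * α + β := by
  have h0 : (0 : ℝ) ∈ Icc 0 T := ⟨le_rfl, hT.le⟩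
  -- Integrating only up to a maximum point of `y` lets `√(y t)` be replaced by its maximum `M`,
  -- which leaves a quadratic inequality for `M`.
  obtain ⟨t₀, ht₀, hmax⟩ := isCompact_Icc.exists_isMaxOn ⟨0, h0⟩ hy.continuousOn
  have hmax' : ∀ t ∈ Icc 0 T, y t ≤ y t₀ := fun t ht => hmax ht
  set M := √(y t₀) with hM
  have hM0 : 0 ≤ M := Real.sqrt_nonneg _
  have hint : ∫ s in (0 : ℝ)..t₀, y' s ≤ 2 * M * α + β ^ 2 := by
    rw [intervalIntegral.integral_of_le ht₀.1]
    have hsub : Ioc 0 t₀ ⊆ Icc 0 T := fun s hs => ⟨hs.1.le, hs.2.trans ht₀.2⟩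
    have h1 : ENNReal.ofReal (∫ s in Ioc 0 t₀, y' s) ≤ ENNReal.ofReal (2 * M * α + β ^ 2) := by
      calc ENNReal.ofReal (∫ s in Ioc 0 t₀, y' s)
          ≤ ∫⁻ s in Ioc 0 t₀, ENNReal.ofReal (y' s) := by
            -- Only the positive part of `y'` is kept; the negative part only lowers the integral.
            rw [ENNReal.ofReal_le_iff_le_toReal]
            · rw [integral_eq_lintegral_pos_part_sub_lintegral_neg_part (hy.integrable.mono_set hsub)]
              simp
            · refine ne_top_of_le_ne_top (hy.integrable.mono_set hsub).2.ne
                (lintegral_mono fun s => ?_)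
              rw [← ofReal_norm]
              exact ENNReal.ofReal_le_ofReal (le_abs_self _)
        _ ≤ ∫⁻ s in Icc 0 T, ENNReal.ofReal (y' s) := lintegral_mono_set hsub
        _ ≤ ∫⁻ s in Icc 0 T, (ENNReal.ofReal (2 * M) * ENNReal.ofReal (a s) + b s) := by
            refine lintegral_mono_ae ?_
            filter_upwards [hle, ae_restrict_mem measurableSet_Icc] with s hs hsm
            refine hs.trans (add_le_add ?_ le_rfl)
            rw [← ENNReal.ofReal_mul (by positivity)]
            apply ENNReal.ofReal_le_ofReal
            have := Real.sqrt_le_sqrt (hmax' s hsm)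
            have ha := ha0 s
            calc 2 * a s * √(y s) ≤ 2 * a s * M := by gcongr
              _ = 2 * M * a s := by ring
        _ = ENNReal.ofReal (2 * M) * (∫⁻ s in Icc 0 T, ENNReal.ofReal (a s)) +
              ∫⁻ s in Icc 0 T, b s := by
            rw [lintegral_add_left' (ha.ennreal_ofReal.const_mul _),
              lintegral_const_mul'' _ ha.ennreal_ofReal]
        _ ≤ ENNReal.ofReal (2 * M) * ENNReal.ofReal α + ENNReal.ofReal (β ^ 2) := by gcongr
        _ = _ := by
            rw [← ENNReal.ofReal_mul (by positivity), ← ENNReal.ofReal_add (by positivity)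
              (by positivity)]
    rwa [ENNReal.ofReal_le_ofReal_iff (by positivity)] at h1
  have hMle : M ^ 2 ≤ √(y 0) ^ 2 + 2 * M * α + β ^ 2 := by
    have h1 : M ^ 2 = y t₀ := Real.sq_sqrt (hy0 _ ht₀)
    rw [h1, Real.sq_sqrt (hy0 _ h0), hy.eq_integral t₀ ht₀]
    linarith
  -- If it failed, then `M (M - 2α) > (√(y 0) + 2α + β)(√(y 0) + β) ≥ √(y 0)² + β²`, against `hMle`.
  have hfin : M ≤ √(y 0) + 2 * α + β := by
    have hs := Real.sqrt_nonneg (y 0)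
    by_contra! hcon
    nlinarith [mul_nonneg hs hα0, mul_nonneg hs hβ0, mul_nonneg hα0 hβ0]
  intro t ht
  exact (Real.sqrt_le_sqrt (hmax' t ht)).trans hfin

end TimeDerivative

/-! ### The norms of L^q(H^m) and W^{1,q}(H^m) and their embeddings. -/

section SobolevTime

variable {n : ℕ} {Ω : Set (Vec n)} {F : Type*} [NormedAddCommGroup F] [NormedSpace ℝ F] {m : ℕ}
  {T : ℝ} {f g : ℝ → L2 Ω F}

theorem LqHm_congr {q : ℝ≥0∞} {f' : ℝ → L2 Ω F} (h : f =ᵐ[volume.restrict (Icc 0 T)] f') :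
    LqHm T q m f = LqHm T q m f' :=
  eLpNorm_congr_ae (h.fun_comp (sobNorm m))

theorem LqHm_one : LqHm T 1 m f = ∫⁻ t in Icc 0 T, sobNorm m (f t) := by
  simp [LqHm, eLpNorm_one_eq_lintegral_enorm]

theorem LqHm_two_sq : LqHm T 2 m f ^ 2 = ∫⁻ t in Icc 0 T, sobNorm m (f t) ^ 2 := by
  have h := eLpNorm_eq_lintegral_rpow_enorm_toReal (p := 2) (by norm_num) (by norm_num)
    (f := fun t => sobNorm m (f t)) (μ := volume.restrict (Icc 0 T))
  rw [LqHm, h, ← ENNReal.rpow_natCast, ← ENNReal.rpow_mul]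
  simp

theorem W1qHm_le {q : ℝ≥0∞} (h : IsTimeDeriv T f g) :
    W1qHm T q m f ≤ LqHm T q m f + LqHm T q m g :=
  iInf_le_of_le g (iInf₂_le_of_le h.1 h.2 le_rfl)

variable [CompleteSpace F]

/-- All admissible time derivatives agree almost everywhere, so the infimum runs over a single
value. -/
theorem exists_W1qHm_eq (hT : 0 < T) {q : ℝ≥0∞} (h : W1qHm T q m f < ⊤) :
    ∃ g, IsTimeDeriv T f g ∧ W1qHm T q m f = LqHm T q m f + LqHm T q m g := by
  have h' := h
  unfold W1qHm at h'
  simp only [iInf_lt_iff] at h'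
  obtain ⟨g, h1, h2, -⟩ := h'
  have hg : IsTimeDeriv T f g := ⟨h1, h2⟩
  refine ⟨g, hg, le_antisymm (iInf_le_of_le g (iInf₂_le_of_le h1 h2 le_rfl)) ?_⟩
  refine le_iInf fun g' => le_iInf₂ fun h1' h2' => ?_
  rw [LqHm_congr (hg.ae_unique hT ⟨h1', h2'⟩)]

variable [SecondCountableTopology F]

theorem LqHm_one_le (hΩ : IsOpen Ω) (hT : 0 < T)
    (hf : AEStronglyMeasurable f (volume.restrict (Icc 0 T))) :
    LqHm T 1 m f ≤ ENNReal.ofReal √T * LqHm T 2 m f := by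
  have h := eLpNorm_le_eLpNorm_mul_rpow_measure_univ (p := 1) (q := 2) (by norm_num)
    ((aemeasurable_sobNorm (m := m) hΩ hf).aestronglyMeasurable)
  refine h.trans (le_of_eq ?_)
  rw [mul_comm, LqHm, Measure.restrict_apply_univ, Real.volume_Icc, sub_zero,
    ENNReal.ofReal_rpow_of_pos hT, Real.sqrt_eq_rpow]
  norm_num

theorem W1qHm_one_le (hΩ : IsOpen Ω) (hT : 0 < T) :
    W1qHm T 1 m f ≤ ENNReal.ofReal √T * W1qHm T 2 m f := by
  by_cases hfin : W1qHm T 2 m f < ⊤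
  · obtain ⟨g, hg, he⟩ := exists_W1qHm_eq hT hfin
    rw [he, mul_add]
    exact (W1qHm_le hg).trans (add_le_add (LqHm_one_le hΩ hT hg.aestronglyMeasurable)
      (LqHm_one_le hΩ hT hg.integrable.aestronglyMeasurable))
  · rw [not_lt_top_iff.1 hfin, ENNReal.mul_top]
    · exact le_top
    · simpa using hT

/-- The embedding of W^{1,1} into L^∞ in time. Average over `s` the inequality `‖f t‖ ≤ ‖f s‖ + ∫
‖g‖`; this gives the factor `1 / T` for `f` and `1` for `g`. -/
theorem sobNorm_le_W1qHm (hΩ : IsOpen Ω) (hT : 0 < T) {t : ℝ} (ht : t ∈ Icc 0 T) :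
    sobNorm m (f t) ≤ ENNReal.ofReal (1 + 1 / T) * W1qHm T 1 m f := by
  by_cases hfin : W1qHm T 1 m f < ⊤
  · obtain ⟨g, hg, he⟩ := exists_W1qHm_eq hT hfin
    have hpt : ∀ s ∈ Icc 0 T, sobNorm m (f t) ≤ sobNorm m (f s) + LqHm T 1 m g := by
      intro s hs
      rw [hg.sub_eq hs ht]
      refine (sobNorm_add_le hΩ _ _).trans (add_le_add le_rfl ?_)
      have hsub : uIoc s t ⊆ Icc 0 T := uIoc_subset_uIcc.trans (uIcc_subset_Icc hs ht)
      -- Needed when `t < s`, where the interval integral carries a minus sign.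
      have hneg : ∀ x : L2 Ω F, sobNorm m (-x) ≤ sobNorm m x := by
        intro x
        by_cases hx : sobNorm m x < ⊤
        · obtain ⟨D, rfl⟩ := exists_sobEmb_eq hΩ hx
          rw [← map_neg, sobNorm_sobEmb hΩ, sobNorm_sobEmb hΩ, enorm_neg]
        · rw [not_lt_top_iff.1 hx]; exact le_top
      have hle : sobNorm m (∫ x in uIoc s t, g x) ≤ LqHm T 1 m g := by
        refine (sobNorm_integral_le hΩ (hg.integrable.mono_set hsub).aestronglyMeasurable).trans ?_
        rw [LqHm_one]
        exact lintegral_mono_set hsub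
      rw [intervalIntegral.intervalIntegral_eq_integral_uIoc]
      split_ifs
      · rwa [one_smul]
      · rw [neg_one_smul]
        exact (hneg _).trans hle
    have hvol : volume (Icc 0 T) = ENNReal.ofReal T := by simp
    have hmul : ENNReal.ofReal T * sobNorm m (f t) ≤
        LqHm T 1 m f + ENNReal.ofReal T * LqHm T 1 m g := by
      have h1 : ∫⁻ _ in Icc 0 T, sobNorm m (f t) ≤
          ∫⁻ s in Icc 0 T, (sobNorm m (f s) + LqHm T 1 m g) :=
        setLIntegral_mono' measurableSet_Icc hpt
      rw [lintegral_add_right _ measurable_const, setLIntegral_const,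
        setLIntegral_const, hvol, mul_comm, mul_comm (LqHm T 1 m g)] at h1
      rwa [LqHm_one (f := f)]
    have hT' : ENNReal.ofReal (1 / T) * ENNReal.ofReal T = 1 := by
      rw [← ENNReal.ofReal_mul (by positivity), one_div_mul_cancel hT.ne']; simp
    calc sobNorm m (f t) = ENNReal.ofReal (1 / T) * (ENNReal.ofReal T * sobNorm m (f t)) := by
          rw [← mul_assoc, hT', one_mul]
      _ ≤ ENNReal.ofReal (1 / T) * (LqHm T 1 m f + ENNReal.ofReal T * LqHm T 1 m g) := by gcongr
      _ = ENNReal.ofReal (1 / T) * LqHm T 1 m f + LqHm T 1 m g := by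
          rw [mul_add, ← mul_assoc, hT', one_mul]
      _ ≤ ENNReal.ofReal (1 + 1 / T) * W1qHm T 1 m f := by
          rw [he, mul_add, ENNReal.ofReal_add (by positivity) (by positivity)]
          refine add_le_add ?_ ?_
          · gcongr; exact le_add_self
          · rw [ENNReal.ofReal_one]
            exact le_mul_of_one_le_left' le_self_add
  · rw [not_lt_top_iff.1 hfin, ENNReal.mul_top]
    · exact le_top
    · simp only [ne_eq, ENNReal.ofReal_eq_zero, not_le]; positivity

theorem LqHm_two_le (hΩ : IsOpen Ω) (hT : 0 < T) :
    LqHm T 2 m f ≤ ENNReal.ofReal (√T * (1 + 1 / T)) * W1qHm T 1 m f := by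
  have h1 : LqHm T 2 m f ^ 2 ≤ (ENNReal.ofReal (√T * (1 + 1 / T)) * W1qHm T 1 m f) ^ 2 := by
    rw [LqHm_two_sq]
    calc ∫⁻ t in Icc 0 T, sobNorm m (f t) ^ 2
        ≤ ∫⁻ t in Icc 0 T, (ENNReal.ofReal (1 + 1 / T) * W1qHm T 1 m f) ^ 2 := by
          refine setLIntegral_mono' measurableSet_Icc fun t ht => ?_
          gcongr
          exact sobNorm_le_W1qHm hΩ hT ht
      _ = _ := by
          rw [setLIntegral_const, Real.volume_Icc, sub_zero,
            ENNReal.ofReal_mul (Real.sqrt_nonneg _), mul_assoc, mul_pow (ENNReal.ofReal √T),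
            ← ENNReal.ofReal_pow (Real.sqrt_nonneg _), Real.sq_sqrt hT.le, mul_comm]
  exact (ENNReal.pow_le_pow_left_iff two_ne_zero).1 h1

/-- Replaces `IsTimeDeriv.clm_comp` for maps bounded only on H^m; it will be applied to `Π_h^W -
id`. -/
theorem IsTimeDeriv.comp_of_le_sobNorm (hΩ : IsOpen Ω) {Y : Type*} [NormedAddCommGroup Y]
    [NormedSpace ℝ Y] [CompleteSpace Y] (B : L2 Ω F →ₗ[ℝ] Y) {C : ℝ} (hC : 0 ≤ C)
    (hB : ∀ f, ‖B f‖ₑ ≤ ENNReal.ofReal C * sobNorm m f) (h : IsTimeDeriv T f g)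
    (hfin : LqHm T 1 m g < ⊤) : IsTimeDeriv T (fun t => B (f t)) (fun t => B (g t)) := by
  rw [LqHm_one] at hfin
  refine ⟨(integral_comp_of_le_sobNorm hΩ B hC hB h.integrable.aestronglyMeasurable hfin).1,
    fun t ht => ?_⟩
  have hsub : Ioc 0 t ⊆ Icc 0 T := fun s hs => ⟨hs.1.le, hs.2.trans ht.2⟩
  rw [h.eq_integral t ht, map_add, intervalIntegral.integral_of_le ht.1,
    intervalIntegral.integral_of_le ht.1, (integral_comp_of_le_sobNorm hΩ B hC hB
      (h.integrable.mono_set hsub).aestronglyMeasurable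
      (lt_of_le_of_lt (lintegral_mono_set hsub) hfin)).2]

end SobolevTime

/-! ### The weak divergence and skew-symmetric fields as closed linear conditions. -/

section Divergence

variable {n : ℕ} {Ω : Set (Vec n)}

theorem IsTest.integrable_smul {φ : Vec n → ℝ} (hφ : IsTest Ω φ) {F : Type*}
    [NormedAddCommGroup F] [NormedSpace ℝ F] (f : L2 Ω F) :
    Integrable (fun x => φ x • f x) (volume.restrict Ω) :=
  memLp_one_iff_integrable.1 ((Lp.memLp f).smul (r := 1) hφ.memLp)

theorem testInt_coord {φ : Vec n → ℝ} (hφ : IsTest Ω φ) {ι : Type*} [Fintype ι]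
    (f : L2 Ω (EuclideanSpace ℝ ι)) (i : ι) :
    EuclideanSpace.proj (𝕜 := ℝ) i (testInt Ω _ φ hφ f) = ∫ x in Ω, φ x * f x i := by
  rw [testInt_apply, ← ContinuousLinearMap.integral_comp_comm _ (hφ.integrable_smul f)]
  rfl

theorem IsTest.integrable_mul_coord {φ : Vec n → ℝ} (hφ : IsTest Ω φ) {ι : Type*} [Fintype ι]
    (f : L2 Ω (EuclideanSpace ℝ ι)) (i : ι) :
    Integrable (fun x => φ x * f x i) (volume.restrict Ω) :=
  (EuclideanSpace.proj (𝕜 := ℝ) i).integrable_comp (hφ.integrable_smul f)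

/-- `w ↦ ∫ ∇φ ⬝ w`. -/
noncomputable def divTestV {φ : Vec n → ℝ} (hφ : IsTest Ω φ) : L2 Ω (Vec n) →L[ℝ] ℝ :=
  ∑ j, (EuclideanSpace.proj (𝕜 := ℝ) j).comp (testInt Ω (Vec n) _ (hφ.partialD j))

/-- `τ ↦ ∫ ∇φ ⬝ τ_i`, `τ_i` being the row with number `i`. -/
noncomputable def divTestM {φ : Vec n → ℝ} (hφ : IsTest Ω φ) (i : Fin n) : L2 Ω (Mat n) →L[ℝ] ℝ :=
  ∑ j, (EuclideanSpace.proj (𝕜 := ℝ) (i, j)).comp (testInt Ω (Mat n) _ (hφ.partialD j))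

theorem isWeakDivV_iff {w : L2 Ω (Vec n)} {d : L2 Ω ℝ} :
    IsWeakDivV w d ↔ ∀ φ (hφ : IsTest Ω φ), divTestV hφ w = - testInt Ω ℝ φ hφ d := by
  refine forall₂_congr fun φ hφ => ?_
  rw [testInt_apply, integral_finsetSum _ fun j _ => (hφ.partialD j).integrable_mul_coord w j]
  simp only [divTestV, sum_apply, ContinuousLinearMap.comp_apply,
    testInt_coord, smul_eq_mul]

theorem isWeakDivM_iff {τ : L2 Ω (Mat n)} {d : L2 Ω (Vec n)} :
    IsWeakDivM τ d ↔ ∀ φ (hφ : IsTest Ω φ) i,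
      divTestM hφ i τ = - EuclideanSpace.proj (𝕜 := ℝ) i (testInt Ω (Vec n) φ hφ d) := by
  refine forall₃_congr fun φ hφ i => ?_
  rw [testInt_coord, integral_finsetSum _ fun j _ => (hφ.partialD j).integrable_mul_coord τ (i, j)]
  simp only [divTestM, sum_apply, ContinuousLinearMap.comp_apply,
    testInt_coord]

theorem IsWeakDivV.unique (hΩ : IsOpen Ω) {w : L2 Ω (Vec n)} {d d' : L2 Ω ℝ}
    (h : IsWeakDivV w d) (h' : IsWeakDivV w d') : d = d' := by
  rw [isWeakDivV_iff] at h h'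
  exact eq_of_testInt_eq hΩ fun φ hφ => neg_injective ((h φ hφ).symm.trans (h' φ hφ))

theorem IsWeakDivM.unique (hΩ : IsOpen Ω) {τ : L2 Ω (Mat n)} {d d' : L2 Ω (Vec n)}
    (h : IsWeakDivM τ d) (h' : IsWeakDivM τ d') : d = d' := by
  rw [isWeakDivM_iff] at h h'
  refine eq_of_testInt_eq hΩ fun φ hφ => ?_
  ext i
  exact neg_injective ((h φ hφ i).symm.trans (h' φ hφ i))

theorem IsWeakDivV.divV_eq (hΩ : IsOpen Ω) {w : L2 Ω (Vec n)} {d : L2 Ω ℝ}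
    (h : IsWeakDivV w d) : divV w = d :=
  (Classical.epsilon_spec ⟨d, h⟩ : IsWeakDivV w (divV w)).unique hΩ h

theorem IsWeakDivM.divM_eq (hΩ : IsOpen Ω) {τ : L2 Ω (Mat n)} {d : L2 Ω (Vec n)}
    (h : IsWeakDivM τ d) : divM τ = d :=
  (Classical.epsilon_spec ⟨d, h⟩ : IsWeakDivM τ (divM τ)).unique hΩ h

theorem isWeakDivV_divV {w : L2 Ω (Vec n)} (h : w ∈ HdivV Ω) : IsWeakDivV w (divV w) :=
  Classical.epsilon_spec h

theorem isWeakDivM_divM {τ : L2 Ω (Mat n)} (h : τ ∈ HdivM Ω) : IsWeakDivM τ (divM τ) :=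
  Classical.epsilon_spec h

theorem divV_add (hΩ : IsOpen Ω) {w w' : L2 Ω (Vec n)} (h : w ∈ HdivV Ω) (h' : w' ∈ HdivV Ω) :
    divV (w + w') = divV w + divV w' := by
  refine IsWeakDivV.divV_eq hΩ (isWeakDivV_iff.2 fun φ hφ => ?_)
  rw [map_add, map_add, isWeakDivV_iff.1 (isWeakDivV_divV h) φ hφ,
    isWeakDivV_iff.1 (isWeakDivV_divV h') φ hφ, neg_add]

theorem divV_smul (hΩ : IsOpen Ω) {w : L2 Ω (Vec n)} (c : ℝ) (h : w ∈ HdivV Ω) :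
    divV (c • w) = c • divV w := by
  refine IsWeakDivV.divV_eq hΩ (isWeakDivV_iff.2 fun φ hφ => ?_)
  rw [map_smul, map_smul, isWeakDivV_iff.1 (isWeakDivV_divV h) φ hφ, smul_neg]

theorem divM_add (hΩ : IsOpen Ω) {τ τ' : L2 Ω (Mat n)} (h : τ ∈ HdivM Ω) (h' : τ' ∈ HdivM Ω) :
    divM (τ + τ') = divM τ + divM τ' := by
  refine IsWeakDivM.divM_eq hΩ (isWeakDivM_iff.2 fun φ hφ i => ?_)
  rw [map_add, map_add, map_add, isWeakDivM_iff.1 (isWeakDivM_divM h) φ hφ,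
    isWeakDivM_iff.1 (isWeakDivM_divM h') φ hφ, neg_add]

theorem divM_smul (hΩ : IsOpen Ω) {τ : L2 Ω (Mat n)} (c : ℝ) (h : τ ∈ HdivM Ω) :
    divM (c • τ) = c • divM τ := by
  refine IsWeakDivM.divM_eq hΩ (isWeakDivM_iff.2 fun φ hφ i => ?_)
  rw [map_smul, map_smul, map_smul, isWeakDivM_iff.1 (isWeakDivM_divM h) φ hφ, smul_neg]

/-- The weak divergence commutes with differentiation in time. -/
theorem IsWeakDivM.of_hasDerivAt {τ : ℝ → L2 Ω (Mat n)} {τ' : L2 Ω (Mat n)} {d' : L2 Ω (Vec n)}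
    {t : ℝ} (h : ∀ᶠ s in nhds t, τ s ∈ HdivM Ω) (hτ : HasDerivAt τ τ' t)
    (hd : HasDerivAt (fun s => divM (τ s)) d' t) : IsWeakDivM τ' d' := by
  refine isWeakDivM_iff.2 fun φ hφ i => ?_
  have h1 := (divTestM hφ i).hasFDerivAt.comp_hasDerivAt t hτ
  have h2 := (-((EuclideanSpace.proj (𝕜 := ℝ) i).comp
    (testInt Ω (Vec n) φ hφ))).hasFDerivAt.comp_hasDerivAt t hd
  -- The defining identity equates two bounded functionals of `τ s` and its divergence, so its two
  -- sides have the same derivative.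
  refine h1.unique (h2.congr_of_eventuallyEq ?_)
  filter_upwards [h] with s hs
  exact isWeakDivM_iff.1 (isWeakDivM_divM hs) φ hφ i

/-- Transposition. -/
noncomputable def transposeL (n : ℕ) : Mat n ≃ₗᵢ[ℝ] Mat n :=
  LinearIsometryEquiv.piLpCongrLeft 2 ℝ ℝ (Equiv.prodComm (Fin n) (Fin n))

theorem transposeL_apply (ξ : Mat n) (i j : Fin n) : transposeL n ξ (i, j) = ξ (j, i) := by
  simp [transposeL, LinearIsometryEquiv.piLpCongrLeft_apply, Equiv.piCongrLeft'_apply]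

theorem isSkewMat_iff {ξ : Mat n} : IsSkewMat ξ ↔ ξ + transposeL n ξ = 0 := by
  constructor
  · intro h
    ext ⟨i, j⟩
    simp [transposeL_apply, h i j]
  · intro h i j
    have := congrArg (fun ζ : Mat n => ζ (i, j)) h
    simp only [PiLp.add_apply, transposeL_apply, PiLp.zero_apply] at this
    linarith

theorem isSymMat_iff {ξ : Mat n} : IsSymMat ξ ↔ transposeL n ξ = ξ := by
  constructor
  · intro h
    ext ⟨i, j⟩
    simp [transposeL_apply, h i j]
  · intro h i j
    have := congrArg (fun ζ : Mat n => ζ (j, i)) h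
    simpa only [transposeL_apply] using this

/-- Transposition is an isometry that fixes `ξ` and negates `η`. -/
theorem inner_skew_sym {η ξ : Mat n} (hη : IsSkewMat η) (hξ : IsSymMat ξ) : inner ℝ η ξ = 0 := by
  have h1 := isSymMat_iff.1 hξ
  have h2 := isSkewMat_iff.1 hη
  have h3 := (transposeL n).inner_map_map η ξ
  rw [h1, eq_neg_of_add_eq_zero_right h2, inner_neg_left] at h3
  linarith

theorem isSymMat_idMat : IsSymMat (idMat n) := by
  intro i j
  simp [idMat, eq_comm]

/-- `η ↦ η + ηᵀ` for matrix fields. -/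
noncomputable def symmetrizeL2 (Ω : Set (Vec n)) : L2 Ω (Mat n) →L[ℝ] L2 Ω (Mat n) :=
  (ContinuousLinearMap.id ℝ (Mat n) +
    ((transposeL n).toContinuousLinearEquiv : Mat n →L[ℝ] Mat n)).compLpL 2 (volume.restrict Ω)

/-- Skew fields form the kernel of a bounded operator; hence the property passes to time
derivatives. -/
theorem mem_skewL2_iff {η : L2 Ω (Mat n)} : η ∈ skewL2 Ω ↔ symmetrizeL2 Ω η = 0 := by
  rw [Lp.eq_zero_iff_ae_eq_zero]
  refine ⟨fun h => ?_, fun h => ?_⟩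
  · filter_upwards [h, (ContinuousLinearMap.id ℝ (Mat n) +
      ((transposeL n).toContinuousLinearEquiv : Mat n →L[ℝ] Mat n)).coeFn_compLpL η] with x hx h1
    rw [symmetrizeL2, h1]
    exact isSkewMat_iff.1 hx
  · filter_upwards [h, (ContinuousLinearMap.id ℝ (Mat n) +
      ((transposeL n).toContinuousLinearEquiv : Mat n →L[ℝ] Mat n)).coeFn_compLpL η] with x hx h1
    rw [symmetrizeL2, h1] at hx
    exact isSkewMat_iff.2 hx

theorem mem_skewL2_of_hasDerivAt {η : ℝ → L2 Ω (Mat n)} {η' : L2 Ω (Mat n)} {t : ℝ}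
    (h : ∀ᶠ s in nhds t, η s ∈ skewL2 Ω) (hη : HasDerivAt η η' t) : η' ∈ skewL2 Ω := by
  rw [mem_skewL2_iff]
  refine ((symmetrizeL2 Ω).hasFDerivAt.comp_hasDerivAt t hη).unique
    ((hasDerivAt_const t 0).congr_of_eventuallyEq ?_)
  filter_upwards [h] with s hs
  exact mem_skewL2_iff.1 hs

theorem sub_mem_skewL2 {η ζ : L2 Ω (Mat n)} (h : η ∈ skewL2 Ω) (h' : ζ ∈ skewL2 Ω) :
    η - ζ ∈ skewL2 Ω := by
  rw [mem_skewL2_iff] at *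
  rw [map_sub, h, h', sub_zero]

end Divergence

/-! ### The coefficients as bounded, symmetric operators on L². -/

section Coefficients

variable {n : ℕ} {Ω : Set (Vec n)}

section mulOp

variable {E G : Type*} [NormedAddCommGroup E] [InnerProductSpace ℝ E]
  [NormedAddCommGroup G] [InnerProductSpace ℝ G]

/-- Multiplication by a bounded operator-valued function. -/
noncomputable def mulOp (a : Vec n → E →L[ℝ] G) (ha : MemLp a ⊤ (volume.restrict Ω)) :
    L2 Ω E →L[ℝ] L2 Ω G :=
  (ContinuousLinearMap.id ℝ (E →L[ℝ] G)).holderL (volume.restrict Ω) ⊤ 2 2 ha.toLp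

theorem mulOp_ae (a : Vec n → E →L[ℝ] G) (ha : MemLp a ⊤ (volume.restrict Ω)) (f : L2 Ω E) :
    mulOp a ha f =ᵐ[volume.restrict Ω] fun x => a x (f x) := by
  filter_upwards [(ContinuousLinearMap.id ℝ (E →L[ℝ] G)).coeFn_holder (r := 2) ha.toLp f,
    ha.coeFn_toLp] with x h1 h2
  change (ContinuousLinearMap.holder 2 (ContinuousLinearMap.id ℝ (E →L[ℝ] G)) ha.toLp f :
    L2 Ω G) x = _
  rw [h1, h2]
  rfl

theorem inner_mulOp (a : Vec n → E →L[ℝ] G) (ha : MemLp a ⊤ (volume.restrict Ω)) (f : L2 Ω E)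
    (g : L2 Ω G) : inner ℝ (mulOp a ha f) g = ∫ x in Ω, inner ℝ (a x (f x)) (g x) := by
  rw [L2.inner_def]
  refine integral_congr_ae ?_
  filter_upwards [mulOp_ae a ha f] with x hx
  rw [hx]

theorem mulOp_symm (a : Vec n → E →L[ℝ] E) (ha : MemLp a ⊤ (volume.restrict Ω))
    (h : ∀ᵐ x ∂(volume.restrict Ω), ∀ v w, inner ℝ (a x v) w = inner ℝ v (a x w)) (f g : L2 Ω E) :
    inner ℝ (mulOp a ha f) g = inner ℝ f (mulOp a ha g) := by
  rw [real_inner_comm _ f, inner_mulOp, inner_mulOp]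
  refine integral_congr_ae ?_
  filter_upwards [h] with x hx
  rw [hx, real_inner_comm]

theorem le_inner_mulOp (a : Vec n → E →L[ℝ] E) (ha : MemLp a ⊤ (volume.restrict Ω)) {c : ℝ}
    (h : ∀ᵐ x ∂(volume.restrict Ω), ∀ v, c * ‖v‖ ^ 2 ≤ inner ℝ (a x v) v) (f : L2 Ω E) :
    c * ‖f‖ ^ 2 ≤ inner ℝ (mulOp a ha f) f := by
  have h1 : c * ‖f‖ ^ 2 = ∫ x in Ω, inner ℝ (c • f x) (f x) := by
    rw [← real_inner_self_eq_norm_sq, L2.inner_def, ← integral_const_mul]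
    simp only [real_inner_smul_left]
  have h2 : Integrable (fun x => inner ℝ (c • f x) (f x)) (volume.restrict Ω) := by
    simp only [real_inner_smul_left]
    exact (L2.integrable_inner (𝕜 := ℝ) f f).const_mul c
  have h3 : Integrable (fun x => inner ℝ (mulOp a ha f x) (f x)) (volume.restrict Ω) :=
    L2.integrable_inner (𝕜 := ℝ) _ _
  rw [h1, L2.inner_def]
  refine integral_mono_ae h2 h3 ?_
  filter_upwards [h, mulOp_ae a ha f] with x hx h4
  rw [h4, real_inner_smul_left, real_inner_self_eq_norm_sq]
  exact hx _

end mulOp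

namespace BiotCoeff

variable (k : BiotCoeff Ω)

/-- Split into symmetric and skew parts, which 𝒜 keeps orthogonal. On symmetric `ξ`, coercivity of
`C` at `A ξ` gives `lo ‖A ξ‖² ≤ (A ξ, ξ)`. This yields the upper bound, and with `‖ξ‖ ≤ (|hi| + 1)
‖A ξ‖` the lower one. The form `|hi| + 1` is a positive bound whatever the sign of `hi`. -/
theorem A_pointwise : ∀ᵐ x ∂(volume.restrict Ω),
    (∀ ξ ζ, inner ℝ (k.A x ξ) ζ = inner ℝ ξ (k.A x ζ)) ∧
    (∀ ξ, ‖k.A x ξ‖ ≤ (1 / k.lo + k.cK) * ‖ξ‖) ∧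
    (∀ ξ, min (k.lo / (|k.hi| + 1) ^ 2) k.cK * ‖ξ‖ ^ 2 ≤ inner ℝ (k.A x ξ) ξ) := by
  filter_upwards [k.C_selfadj, k.C_coercive, k.C_bdd, k.A_sym, k.A_skew]
    with x hself hcoer hbdd hA hK
  have hlo := k.lo_pos
  have hcK := k.cK_pos
  have hdec : ∀ ξ : Mat n, ∃ s η, IsSymMat s ∧ IsSkewMat η ∧ ξ = s + η := by
    intro ξ
    refine ⟨(1 / 2 : ℝ) • (ξ + transposeL n ξ), (1 / 2 : ℝ) • (ξ - transposeL n ξ), ?_, ?_, ?_⟩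
    · intro i j; simp [transposeL_apply, add_comm]
    · intro i j
      simp only [PiLp.smul_apply, PiLp.sub_apply, transposeL_apply, smul_eq_mul]
      ring
    · rw [← smul_add]
      module
  have hortho : ∀ {s η : Mat n}, IsSymMat s → IsSkewMat η → inner ℝ s η = 0 := fun hs hη => by
    rw [real_inner_comm]; exact inner_skew_sym hη hs
  have hform : ∀ {s η s' η' : Mat n}, IsSymMat s → IsSkewMat η → IsSymMat s' → IsSkewMat η' →
      inner ℝ (k.A x (s + η)) (s' + η') = inner ℝ (k.A x s) s' + k.cK * inner ℝ η η' := by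
    intro s η s' η' hs hη hs' hη'
    rw [map_add, hK η hη, inner_add_left, inner_add_right, inner_add_right, real_inner_smul_left,
      real_inner_smul_left, inner_skew_sym hη hs', hortho (hA s hs).1 hη']
    ring
  have hsym : ∀ {s s' : Mat n}, IsSymMat s → IsSymMat s' →
      inner ℝ (k.A x s) s' = inner ℝ s (k.A x s') := by
    intro s s' hs hs'
    conv_lhs => rw [← (hA s' hs').2]
    rw [← hself _ _ (hA s hs).1 (hA s' hs').1, (hA s hs).2]
  have hnorm : ∀ {s η : Mat n}, IsSymMat s → IsSkewMat η → ‖s + η‖ ^ 2 = ‖s‖ ^ 2 + ‖η‖ ^ 2 := by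
    intro s η hs hη
    rw [norm_add_sq_real, hortho hs hη]; ring
  have hlow : ∀ {s : Mat n}, IsSymMat s → k.lo * ‖k.A x s‖ ^ 2 ≤ inner ℝ (k.A x s) s := by
    intro s hs
    have := hcoer _ (hA s hs).1
    rwa [(hA s hs).2, real_inner_comm] at this
  refine ⟨fun ξ ζ => ?_, fun ξ => ?_, fun ξ => ?_⟩
  · obtain ⟨s, η, hs, hη, rfl⟩ := hdec ξ
    obtain ⟨s', η', hs', hη', rfl⟩ := hdec ζ
    rw [hform hs hη hs' hη', real_inner_comm (k.A x _), hform hs' hη' hs hη, hsym hs hs',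
      real_inner_comm s, real_inner_comm η]
  · obtain ⟨s, η, hs, hη, rfl⟩ := hdec ξ
    have h1 : ‖k.A x s‖ ≤ 1 / k.lo * ‖s‖ := by
      have h2 := (hlow hs).trans (real_inner_le_norm _ _)
      rw [one_div, ← div_eq_inv_mul, le_div_iff₀ hlo]
      by_contra! h3
      have h4 : 0 < ‖k.A x s‖ := by
        by_contra! h5
        have : ‖k.A x s‖ = 0 := le_antisymm h5 (norm_nonneg _)
        rw [this, zero_mul] at h3
        exact absurd h3 (not_lt.2 (norm_nonneg _))
      nlinarith
    have h2 : ‖s‖ ≤ ‖s + η‖ := by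
      refine le_of_sq_le_sq ?_ (norm_nonneg _)
      rw [hnorm hs hη]; nlinarith [sq_nonneg ‖η‖]
    have h3 : ‖η‖ ≤ ‖s + η‖ := by
      refine le_of_sq_le_sq ?_ (norm_nonneg _)
      rw [hnorm hs hη]; nlinarith [sq_nonneg ‖s‖]
    calc ‖k.A x (s + η)‖ ≤ ‖k.A x s‖ + ‖k.cK • η‖ := by
          rw [map_add, hK η hη]; exact norm_add_le _ _
      _ ≤ 1 / k.lo * ‖s + η‖ + k.cK * ‖s + η‖ := by
          rw [norm_smul, Real.norm_of_nonneg hcK.le]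
          gcongr
          exact h1.trans (by gcongr)
      _ = _ := by ring
  · obtain ⟨s, η, hs, hη, rfl⟩ := hdec ξ
    rw [hform hs hη hs hη, hnorm hs hη, real_inner_self_eq_norm_sq, mul_add]
    have h1 : ‖s‖ ≤ (|k.hi| + 1) * ‖k.A x s‖ := by
      have := hbdd _ (hA s hs).1
      rw [(hA s hs).2] at this
      refine this.trans ?_
      gcongr
      linarith [le_abs_self k.hi]
    have h2 : k.lo / (|k.hi| + 1) ^ 2 * ‖s‖ ^ 2 ≤ inner ℝ (k.A x s) s := by
      refine le_trans ?_ (hlow hs)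
      rw [div_mul_eq_mul_div, div_le_iff₀ (by positivity), mul_assoc, ← mul_pow,
        mul_comm ‖k.A x s‖]
      gcongr
    refine add_le_add (le_trans ?_ h2) ?_
    · gcongr; exact min_le_left _ _
    · gcongr; exact min_le_right _ _

theorem κinv_pointwise : ∀ᵐ x ∂(volume.restrict Ω),
    (∀ v w, inner ℝ (k.κinv x v) w = inner ℝ v (k.κinv x w)) ∧
    (∀ v, ‖k.κinv x v‖ ≤ 1 / k.lo * ‖v‖) ∧
    (∀ v, k.lo / (|k.hi| + 1) ^ 2 * ‖v‖ ^ 2 ≤ inner ℝ (k.κinv x v) v) := by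
  filter_upwards [k.κ_selfadj, k.κ_coercive, k.κ_bdd, k.κ_κinv] with x hself hcoer hbdd hinv
  have hlo := k.lo_pos
  have hlow : ∀ v, k.lo * ‖k.κinv x v‖ ^ 2 ≤ inner ℝ (k.κinv x v) v := by
    intro v
    have := hcoer (k.κinv x v)
    rwa [hinv, real_inner_comm] at this
  refine ⟨fun v w => ?_, fun v => ?_, fun v => ?_⟩
  · conv_lhs => rw [← hinv w]
    rw [← hself, hinv]
  · have h2 := (hlow v).trans (real_inner_le_norm _ _)
    rw [one_div, ← div_eq_inv_mul, le_div_iff₀ hlo]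
    by_contra! h3
    have h4 : 0 < ‖k.κinv x v‖ := by
      by_contra! h5
      have : ‖k.κinv x v‖ = 0 := le_antisymm h5 (norm_nonneg _)
      rw [this, zero_mul] at h3
      exact absurd h3 (not_lt.2 (norm_nonneg _))
    nlinarith
  · have h1 : ‖v‖ ≤ (|k.hi| + 1) * ‖k.κinv x v‖ := by
      have := hbdd (k.κinv x v)
      rw [hinv] at this
      refine this.trans ?_
      gcongr
      linarith [le_abs_self k.hi]
    refine le_trans ?_ (hlow v)
    rw [div_mul_eq_mul_div, div_le_iff₀ (by positivity), mul_assoc, ← mul_pow,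
      mul_comm ‖k.κinv x v‖]
    gcongr

theorem memLp_A : MemLp k.A ⊤ (volume.restrict Ω) := by
  refine memLp_top_of_bound k.A_meas (1 / k.lo + k.cK) ?_
  have := k.lo_pos
  have := k.cK_pos
  filter_upwards [k.A_pointwise] with x hx
  exact ContinuousLinearMap.opNorm_le_bound _ (by positivity) hx.2.1

theorem memLp_κinv : MemLp k.κinv ⊤ (volume.restrict Ω) := by
  refine memLp_top_of_bound k.κinv_meas (1 / k.lo) ?_
  have := k.lo_pos
  filter_upwards [k.κinv_pointwise] with x hx
  exact ContinuousLinearMap.opNorm_le_bound _ (by positivity) hx.2.1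

theorem memLp_smul_const {E : Type*} [NormedAddCommGroup E] [NormedSpace ℝ E] {a : Vec n → ℝ}
    (ha : AEStronglyMeasurable a (volume.restrict Ω)) (h0 : ∀ᵐ x ∂(volume.restrict Ω), 0 ≤ a x)
    {c : ℝ} (hc : ∀ᵐ x ∂(volume.restrict Ω), a x ≤ c) (v : E) :
    MemLp (fun x => a x • v) ⊤ (volume.restrict Ω) := by
  refine memLp_top_of_bound (ha.smul_const v) (c * ‖v‖) ?_
  filter_upwards [h0, hc] with x h1 h2
  rw [norm_smul, Real.norm_of_nonneg h1]
  gcongr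

/-- The operator `𝒜` on matrix fields. -/
noncomputable def opA : L2 Ω (Mat n) →L[ℝ] L2 Ω (Mat n) := mulOp k.A k.memLp_A

/-- The operator `κ⁻¹` on vector fields. -/
noncomputable def opK : L2 Ω (Vec n) →L[ℝ] L2 Ω (Vec n) := mulOp k.κinv k.memLp_κinv

/-- Multiplication by `s₀`. -/
noncomputable def opS : L2 Ω ℝ →L[ℝ] L2 Ω ℝ :=
  mulOp (fun x => k.s₀ x • ContinuousLinearMap.id ℝ ℝ)
    (memLp_smul_const k.s₀_meas k.s₀_nonneg k.s₀_bdd _)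

/-- The operator `q ↦ α q 𝐈`. -/
noncomputable def opI : L2 Ω ℝ →L[ℝ] L2 Ω (Mat n) :=
  mulOp (fun x => k.α x • (ContinuousLinearMap.id ℝ ℝ).smulRight (idMat n))
    (memLp_smul_const k.α_meas (k.α_pos.mono fun _ h => h.le) k.α_bdd _)

theorem opI_ae (q : L2 Ω ℝ) : k.alphaI q =ᵐ[volume.restrict Ω] k.opI q := by
  filter_upwards [mulOp_ae _ (memLp_smul_const k.α_meas (k.α_pos.mono fun _ h => h.le) k.α_bdd
    ((ContinuousLinearMap.id ℝ ℝ).smulRight (idMat n))) q] with x hx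
  rw [opI, hx]
  simp [alphaI, mul_smul]

theorem total_ae (τ : L2 Ω (Mat n)) (q : L2 Ω ℝ) :
    k.total τ q =ᵐ[volume.restrict Ω] (τ + k.opI q : L2 Ω (Mat n)) := by
  filter_upwards [k.opI_ae q, Lp.coeFn_add τ (k.opI q)] with x h1 h2
  rw [h2, total, h1]; rfl

theorem formA_eq {ξ ζ : Vec n → Mat n} {X Z : L2 Ω (Mat n)} (hξ : ξ =ᵐ[volume.restrict Ω] X)
    (hζ : ζ =ᵐ[volume.restrict Ω] Z) : k.formA ξ ζ = inner ℝ (k.opA X) Z := by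
  rw [opA, inner_mulOp]
  refine integral_congr_ae ?_
  filter_upwards [hξ, hζ] with x h1 h2
  rw [h1, h2]

theorem formK_eq (z w : L2 Ω (Vec n)) : k.formK z w = inner ℝ (k.opK z) w := by
  rw [opK, inner_mulOp, formK]

theorem formS_eq (p q : L2 Ω ℝ) : k.formS p q = inner ℝ (k.opS p) q := by
  rw [opS, inner_mulOp, formS]
  refine integral_congr_ae (Filter.Eventually.of_forall fun x => ?_)
  simp only [smul_apply, ContinuousLinearMap.id_apply, smul_eq_mul, RCLike.inner_apply,
    conj_trivial]
  ring

theorem opA_symm (ξ ζ : L2 Ω (Mat n)) : inner ℝ (k.opA ξ) ζ = inner ℝ ξ (k.opA ζ) :=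
  mulOp_symm _ _ (k.A_pointwise.mono fun _ h => h.1) _ _

theorem opK_symm (z w : L2 Ω (Vec n)) : inner ℝ (k.opK z) w = inner ℝ z (k.opK w) :=
  mulOp_symm _ _ (k.κinv_pointwise.mono fun _ h => h.1) _ _

theorem opS_symm (p q : L2 Ω ℝ) : inner ℝ (k.opS p) q = inner ℝ p (k.opS q) :=
  mulOp_symm _ _ (Filter.Eventually.of_forall fun x v w => by
    simp only [smul_apply, ContinuousLinearMap.id_apply, real_inner_smul_left,
      real_inner_smul_right]) _ _

theorem exists_opA_coercive : ∃ a > 0, ∀ ξ : L2 Ω (Mat n), a * ‖ξ‖ ^ 2 ≤ inner ℝ (k.opA ξ) ξ :=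
  ⟨_, lt_min (div_pos k.lo_pos (by positivity)) k.cK_pos, fun ξ =>
    le_inner_mulOp _ _ (k.A_pointwise.mono fun _ h => h.2.2) ξ⟩

theorem exists_opK_coercive : ∃ a > 0, ∀ z : L2 Ω (Vec n), a * ‖z‖ ^ 2 ≤ inner ℝ (k.opK z) z :=
  ⟨_, div_pos k.lo_pos (by positivity), fun ξ =>
    le_inner_mulOp _ _ (k.κinv_pointwise.mono fun _ h => h.2.2) ξ⟩

theorem opS_nonneg (p : L2 Ω ℝ) : 0 ≤ inner ℝ (k.opS p) p := by
  have := le_inner_mulOp (fun x => k.s₀ x • ContinuousLinearMap.id ℝ ℝ)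
    (memLp_smul_const k.s₀_meas k.s₀_nonneg k.s₀_bdd _) (c := 0) (k.s₀_nonneg.mono fun x hx v => by
      simp only [smul_apply, ContinuousLinearMap.id_apply,
        real_inner_smul_left, zero_mul]
      exact mul_nonneg hx real_inner_self_nonneg) p
  rwa [zero_mul] at this

/-- The field α q I is symmetric. Hence the rotation defect can be tested with the total stress
error, which the energy controls even if s₀ vanishes. -/
theorem inner_skew_opI {η : L2 Ω (Mat n)} (hη : η ∈ skewL2 Ω) (q : L2 Ω ℝ) :
    inner ℝ η (k.opI q) = 0 := by
  rw [L2.inner_def]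
  refine integral_eq_zero_of_ae ?_
  filter_upwards [k.opI_ae q, hη] with x h1 h2
  rw [← h1, alphaI, real_inner_smul_right, inner_skew_sym h2 isSymMat_idMat, mul_zero]
  rfl

end BiotCoeff

end Coefficients

/-! ### Orthogonal projections and finite dimensional variational problems. -/

section Projection

theorem Submodule.norm_sub_starProjection_le {H : Type*} [NormedAddCommGroup H]
    [InnerProductSpace ℝ H] (M : Submodule ℝ H) [M.HasOrthogonalProjection] (x : H) {y : H}
    (hy : y ∈ M) : ‖x - M.starProjection x‖ ≤ ‖x - y‖ := by
  rw [M.starProjection_minimal]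
  exact ciInf_le ⟨0, by rintro _ ⟨z, rfl⟩; exact norm_nonneg _⟩ (⟨y, hy⟩ : M)

theorem Submodule.inner_starProjection_of_mem {H : Type*} [NormedAddCommGroup H]
    [InnerProductSpace ℝ H] (M : Submodule ℝ H) [M.HasOrthogonalProjection] (x : H) {y : H}
    (hy : y ∈ M) : inner ℝ (M.starProjection x) y = inner ℝ x y := by
  rw [M.inner_starProjection_left_eq_right, M.starProjection_eq_self_iff.2 hy]

/-- Membership is the equation of being fixed by a continuous projection, and that equation can be
differentiated. -/
theorem Submodule.mem_of_hasDerivAt {H : Type*} [NormedAddCommGroup H]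
    [InnerProductSpace ℝ H] (M : Submodule ℝ H) [M.HasOrthogonalProjection] {f : ℝ → H} {f' : H}
    {t : ℝ} (h : ∀ᶠ s in nhds t, f s ∈ M) (hf : HasDerivAt f f' t) : f' ∈ M := by
  rw [← M.starProjection_eq_self_iff]
  refine (M.starProjection.hasFDerivAt.comp_hasDerivAt t hf).unique (hf.congr_of_eventuallyEq ?_)
  filter_upwards [h] with s hs
  exact M.starProjection_eq_self_iff.2 hs

/-- The solution operator of a saddle point problem in finite dimensional subspaces. -/
theorem exists_saddle_operator {X Y : Type*} [NormedAddCommGroup X] [InnerProductSpace ℝ X]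
    [CompleteSpace X] [NormedAddCommGroup Y] [InnerProductSpace ℝ Y] [CompleteSpace Y]
    (M : Submodule ℝ X) (V : Submodule ℝ Y) (G : Submodule ℝ X) [FiniteDimensional ℝ M]
    [FiniteDimensional ℝ V] [FiniteDimensional ℝ G] (D : M →ₗ[ℝ] Y) (hD : ∀ τ, D τ ∈ V)
    (hstab : ∀ v ∈ V, ∀ η ∈ G, ∃ τ : M, D τ = v ∧ ∀ η' ∈ G, inner ℝ (τ : X) η' = inner ℝ η η') :
    ∃ (L : X →L[ℝ] X) (L' : Y →L[ℝ] X), ∀ σ d, ∃ s : M, (s : X) = L σ + L' d ∧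
      ∃ u ∈ V, ∃ γ ∈ G,
        (∀ τ : M, inner ℝ (s : X) (τ : X) + inner ℝ u (D τ) + inner ℝ γ (τ : X) = inner ℝ σ (τ : X)) ∧
        (∀ v ∈ V, inner ℝ (D s) v = inner ℝ d v) ∧ ∀ η ∈ G, inner ℝ (s : X) η = inner ℝ σ η := by
  -- `B` is the constraint operator; stability says that it is onto, so it has a linear right
  -- inverse `R`.
  let B : M →ₗ[ℝ] V × G :=
    ((V.orthogonalProjectionOnto : Y →L[ℝ] V).toLinearMap ∘ₗ D).prod
      ((G.orthogonalProjectionOnto : X →L[ℝ] G).toLinearMap ∘ₗ M.subtype)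
  have hB1 : ∀ τ : M, ((B τ).1 : Y) = D τ := fun τ => V.starProjection_eq_self_iff.2 (hD τ)
  have hB2 : ∀ τ : M, ((B τ).2 : X) = G.starProjection τ.1 := fun τ => rfl
  have hsurj : Function.Surjective B := by
    rintro ⟨v, η⟩
    obtain ⟨τ, h2, h3⟩ := hstab v v.2 η η.2
    refine ⟨τ, Prod.ext (Subtype.ext ((hB1 _).trans h2)) (Subtype.ext ?_)⟩
    rw [hB2]
    refine Submodule.eq_starProjection_of_mem_of_inner_eq_zero η.2 fun η' hη' => ?_
    rw [inner_sub_left, h3 η' hη', sub_self]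
  obtain ⟨R, hR⟩ := B.exists_rightInverse_of_surjective (LinearMap.range_eq_top.2 hsurj)
  have hR' : ∀ x, B (R x) = x := fun x => LinearMap.congr_fun hR x
  let Z : Submodule ℝ X := (LinearMap.ker B).map M.subtype
  let Rc : V × G →L[ℝ] X := M.subtypeL.comp R.toContinuousLinearMap
  let P : X →L[ℝ] X := Z.starProjection
  let R1 : Y →L[ℝ] X :=
    Rc.comp ((ContinuousLinearMap.inl ℝ V G).comp V.orthogonalProjectionOnto)
  let R2 : X →L[ℝ] X :=
    Rc.comp ((ContinuousLinearMap.inr ℝ V G).comp G.orthogonalProjectionOnto)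
  -- The solution is `R x + P (σ - R x)`: a particular field meeting the constraints, corrected by
  -- the best approximation of the remainder in `ker B`. Here `R x = R1 d + R2 σ`.
  refine ⟨R2 + P.comp (ContinuousLinearMap.id ℝ _ - R2), R1 - P.comp R1, fun σ d => ?_⟩
  set x : V × G := (V.orthogonalProjectionOnto d, G.orthogonalProjectionOnto σ) with hx
  have hsum : R1 d + R2 σ = (R x : X) := by
    change ((R _ : M) : X) + ((R _ : M) : X) = _
    rw [← Submodule.coe_add, ← map_add]
    simp [hx]
  obtain ⟨ρ, hρ, hρP⟩ : P (σ - (R x : X)) ∈ Z := Submodule.starProjection_apply_mem _ _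
  have hρB : B ρ = 0 := hρ
  have hρP' : (ρ : X) = P (σ - (R x : X)) := hρP
  have hort : ∀ τ : M, B τ = 0 → inner ℝ (σ - ((R x + ρ : M) : X)) (τ : X) = 0 := by
    intro τ hτ
    rw [Submodule.coe_add, ← sub_sub, hρP']
    exact Submodule.starProjection_inner_eq_zero _ (τ : X) ⟨τ, hτ, rfl⟩
  refine ⟨R x + ρ, ?_, ?_⟩
  · rw [Submodule.coe_add, hρP', ← hsum]
    simp only [add_apply, sub_apply, ContinuousLinearMap.comp_apply, ContinuousLinearMap.id_apply,
      map_sub, map_add]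
    abel
  have hBs : B (R x + ρ) = x := by rw [map_add, hR', hρB, add_zero]
  -- The residual annihilates `ker B`, so it factors through `B`. The Riesz representatives of the
  -- two components of the factor are the multipliers `u` and `γ`.
  let ℓ' : V × G →L[ℝ] ℝ := (innerSL ℝ (σ - ((R x + ρ : M) : X))).comp Rc
  have hℓ : ∀ τ : M, inner ℝ (σ - ((R x + ρ : M) : X)) (τ : X) = ℓ' (B τ) := by
    intro τ
    have h1 : B (τ - R (B τ)) = 0 := by rw [map_sub, hR', sub_self]
    have h2 := hort _ h1
    rw [Submodule.coe_sub, inner_sub_right, sub_eq_zero] at h2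
    exact h2
  let u : V := (InnerProductSpace.toDual ℝ V).symm (ℓ'.comp (ContinuousLinearMap.inl ℝ V G))
  let γ : G := (InnerProductSpace.toDual ℝ G).symm (ℓ'.comp (ContinuousLinearMap.inr ℝ V G))
  refine ⟨u, u.2, γ, γ.2, fun τ => ?_, fun v hv => ?_, fun η hη => ?_⟩
  · have h1 := hℓ τ
    have h2 : ℓ' (B τ) = inner ℝ (u : Y) (D τ) + inner ℝ (γ : X) (τ : X) := by
      have h3 : inner ℝ (u : Y) (D τ) = ℓ' ((B τ).1, 0) := by
        rw [← hB1 τ, ← Submodule.coe_inner]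
        exact InnerProductSpace.toDual_symm_apply
      have h4 : inner ℝ (γ : X) (τ : X) = ℓ' (0, (B τ).2) := by
        rw [real_inner_comm, ← G.inner_starProjection_of_mem _ γ.2, ← hB2 τ,
          ← Submodule.coe_inner, real_inner_comm]
        exact InnerProductSpace.toDual_symm_apply
      rw [h3, h4, ← map_add]
      simp
    rw [h2, inner_sub_left] at h1
    linarith
  · rw [← hB1, hBs]
    exact V.inner_starProjection_of_mem _ hv
  · rw [← G.inner_starProjection_of_mem _ hη, ← hB2, hBs]
    exact G.inner_starProjection_of_mem _ hη

/-- The solution operator of a coercive variational problem in a finite dimensional subspace. -/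
theorem exists_coercive_operator {X Y : Type*} [NormedAddCommGroup X] [InnerProductSpace ℝ X]
    [CompleteSpace X] [NormedAddCommGroup Y] [InnerProductSpace ℝ Y] [CompleteSpace Y]
    (M : Submodule ℝ X) [FiniteDimensional ℝ M] (D : M →ₗ[ℝ] Y) (A : X →L[ℝ] X) {a : ℝ} (ha : 0 < a)
    (hA : ∀ x, a * ‖x‖ ^ 2 ≤ inner ℝ (A x) x) :
    ∃ L : Y →L[ℝ] X, ∀ z : M, ∀ p,
      (∀ w : M, inner ℝ (A z) (w : X) + inner ℝ p (D w) = 0) → (z : X) = L p := by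
  have hzero : ∀ w : M, (∀ v : M, inner ℝ (A w) (v : X) = 0) → w = 0 := by
    intro w h1
    have h2 := hA w
    rw [h1 w] at h2
    have : ‖(w : X)‖ ^ 2 = 0 := le_antisymm (by nlinarith) (by positivity)
    simpa using this
  -- The Galerkin operator of `A` on `M`. Coercivity makes it injective, hence invertible in finite
  -- dimension, and the solution operator is `-N⁻¹ D*`.
  let N : M →ₗ[ℝ] M := ((M.orthogonalProjectionOnto.comp A).comp M.subtypeL).toLinearMap
  have hN : ∀ w v : M, inner ℝ ((N w : M) : X) v = inner ℝ (A w) (v : X) :=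
    fun w v => M.inner_starProjection_of_mem _ v.2
  have hinj : Function.Injective N := by
    rw [injective_iff_map_eq_zero]
    intro w hw
    refine hzero w fun v => ?_
    rw [← hN w v, hw]
    exact inner_zero_left _
  let e := LinearEquiv.ofInjectiveEndo N hinj
  let D' : M →L[ℝ] Y := D.toContinuousLinearMap
  let L : Y →L[ℝ] M := - (e.symm.toLinearMap.toContinuousLinearMap).comp D'.adjoint
  refine ⟨M.subtypeL.comp L, fun z p hp => ?_⟩
  have h1 : ∀ w : M, inner ℝ (A (L p)) (w : X) = - inner ℝ p (D w) := by
    intro w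
    have h2 : L p = - e.symm (D'.adjoint p) := rfl
    rw [← hN, h2, map_neg, Submodule.coe_neg, inner_neg_left]
    have h3 : N (e.symm (D'.adjoint p)) = D'.adjoint p := e.apply_symm_apply _
    rw [h3, ← Submodule.coe_inner, ContinuousLinearMap.adjoint_inner_left]
    rfl
  have h2 : z = L p := by
    rw [← sub_eq_zero]
    refine hzero _ fun w => ?_
    rw [Submodule.coe_sub, map_sub, inner_sub_left, h1]
    linarith [hp w]
  rw [h2]
  rfl

end Projection

/-! ### The elliptic projection and the discrete flux operator. -/

namespace MixedPair

variable {n : ℕ} {Ω : Set (Vec n)} {r r' : ℕ} {c h : ℝ} (S : MixedPair Ω r r' c h)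

theorem divM_mem {τ : L2 Ω (Mat n)} (hτ : τ ∈ S.Sig) : divM τ ∈ S.V := by
  have : divM τ ∈ divM '' (S.Sig : Set (L2 Ω (Mat n))) := ⟨τ, hτ, rfl⟩
  rwa [S.div_Sig] at this

theorem divV_mem {w : L2 Ω (Vec n)} (hw : w ∈ S.W) : divV w ∈ S.Q := by
  have : divV w ∈ divV '' (S.W : Set (L2 Ω (Vec n))) := ⟨w, hw, rfl⟩
  rwa [S.div_W] at this

/-- The divergence on `Σ_h`. -/
noncomputable def divSig (hΩ : IsOpen Ω) : S.Sig →ₗ[ℝ] L2 Ω (Vec n) where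
  toFun τ := divM τ.1
  map_add' τ τ' := divM_add hΩ (S.Sig_le τ.2) (S.Sig_le τ'.2)
  map_smul' a τ := divM_smul hΩ a (S.Sig_le τ.2)

/-- The divergence on `W_h`. -/
noncomputable def divW (hΩ : IsOpen Ω) : S.W →ₗ[ℝ] L2 Ω ℝ where
  toFun τ := divV τ.1
  map_add' τ τ' := divV_add hΩ (S.W_le τ.2) (S.W_le τ'.2)
  map_smul' a τ := divV_smul hΩ a (S.W_le τ.2)

theorem divM_sub (hΩ : IsOpen Ω) {τ τ' : L2 Ω (Mat n)} (hτ : τ ∈ S.Sig) (hτ' : τ' ∈ S.Sig) :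
    divM (τ - τ') = divM τ - divM τ' := by
  rw [sub_eq_add_neg, ← neg_one_smul ℝ τ', divM_add hΩ (S.Sig_le hτ)
    (S.Sig_le (S.Sig.smul_mem _ hτ')), divM_smul hΩ _ (S.Sig_le hτ'), neg_one_smul, sub_eq_add_neg]

theorem divV_sub (hΩ : IsOpen Ω) {w w' : L2 Ω (Vec n)} (hw : w ∈ S.W) (hw' : w' ∈ S.W) :
    divV (w - w') = divV w - divV w' := by
  rw [sub_eq_add_neg, ← neg_one_smul ℝ w', divV_add hΩ (S.W_le hw)
    (S.W_le (S.W.smul_mem _ hw')), divV_smul hΩ _ (S.W_le hw'), neg_one_smul, sub_eq_add_neg]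

/-- The discretely symmetric, divergence free fields in `Σ_h`. -/
noncomputable def kernel (hΩ : IsOpen Ω) : Submodule ℝ (L2 Ω (Mat n)) where
  carrier := {τ | τ ∈ S.Sig ∧ divM τ = 0 ∧ ∀ η ∈ S.Gam, inner ℝ τ η = 0}
  add_mem' := by
    rintro a b ⟨h1, h2, h3⟩ ⟨h1', h2', h3'⟩
    refine ⟨S.Sig.add_mem h1 h1', ?_, fun η hη => ?_⟩
    · rw [divM_add hΩ (S.Sig_le h1) (S.Sig_le h1'), h2, h2', add_zero]
    · rw [inner_add_left, h3 η hη, h3' η hη, add_zero]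
  zero_mem' := ⟨S.Sig.zero_mem, by simpa using divM_smul hΩ 0 (S.Sig_le S.Sig.zero_mem), fun η _ => inner_zero_left _⟩
  smul_mem' := by
    rintro a b ⟨h1, h2, h3⟩
    refine ⟨S.Sig.smul_mem a h1, ?_, fun η hη => ?_⟩
    · rw [divM_smul hΩ a (S.Sig_le h1), h2, smul_zero]
    · rw [real_inner_smul_left, h3 η hη, mul_zero]

instance (hΩ : IsOpen Ω) : FiniteDimensional ℝ (S.kernel hΩ) :=
  Submodule.finiteDimensional_of_le (S₂ := S.Sig) fun _ h => h.1

theorem IsEllipticProj.divM_eq {S : MixedPair Ω r r' c h} {σ s : L2 Ω (Mat n)}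
    (hs : S.IsEllipticProj σ s) : divM s = S.PV (divM σ) := by
  obtain ⟨h1, u, -, γ, -, -, h2, -⟩ := hs
  refine (Submodule.eq_starProjection_of_mem_of_inner_eq_zero (S.divM_mem h1) fun v hv => ?_).symm
  rw [inner_sub_left, h2 v hv, sub_self]

/-- Galerkin orthogonality: on the kernel both multiplier terms vanish. -/
theorem IsEllipticProj.inner_eq_zero (hΩ : IsOpen Ω) {S : MixedPair Ω r r' c h}
    {σ s τ : L2 Ω (Mat n)} (hs : S.IsEllipticProj σ s) (hτ : τ ∈ S.kernel hΩ) :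
    inner ℝ (s - σ) τ = 0 := by
  obtain ⟨h1, u, -, γ, hγ, h2, -, -⟩ := hs
  obtain ⟨h3, h4, h5⟩ := hτ
  have := h2 τ h3
  rw [h4, inner_zero_right, real_inner_comm τ γ, h5 γ hγ] at this
  rw [inner_sub_left, ← this]
  ring

theorem IsEllipticProj.unique (hΩ : IsOpen Ω) {S : MixedPair Ω r r' c h}
    {σ s s' : L2 Ω (Mat n)} (hs : S.IsEllipticProj σ s) (hs' : S.IsEllipticProj σ s') : s = s' := by
  have hk : s - s' ∈ S.kernel hΩ := by
    refine ⟨S.Sig.sub_mem hs.1 hs'.1, ?_, fun η hη => ?_⟩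
    · rw [S.divM_sub hΩ hs.1 hs'.1, hs.divM_eq, hs'.divM_eq, sub_self]
    · obtain ⟨h1, u, -, γ, -, -, -, h2⟩ := hs
      obtain ⟨h1', u', -, γ', -, -, -, h2'⟩ := hs'
      rw [inner_sub_left, h2 η hη, h2' η hη, sub_self]
  have h1 := hs.inner_eq_zero hΩ hk
  have h2 := hs'.inner_eq_zero hΩ hk
  rw [← sub_eq_zero, ← inner_self_eq_zero (𝕜 := ℝ)]
  conv_lhs => lhs; rw [← sub_sub_sub_cancel_right s s' σ]
  rw [inner_sub_left, h1, h2, sub_zero]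

/-- The elliptic projection is a bounded operator on `H(div)`. -/
theorem exists_isEllipticProj (hΩ : IsOpen Ω) :
    ∃ (L : L2 Ω (Mat n) →L[ℝ] L2 Ω (Mat n)) (L' : L2 Ω (Vec n) →L[ℝ] L2 Ω (Mat n)),
      ∀ σ d, IsWeakDivM σ d → S.IsEllipticProj σ (L σ + L' d) := by
  obtain ⟨L, L', hL⟩ := exists_saddle_operator S.Sig S.V S.Gam (S.divSig hΩ)
    (fun τ => S.divM_mem τ.2) (fun v hv η hη => by
      obtain ⟨τ, h1, h2, h3, -⟩ := S.stabSig v hv η hη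
      exact ⟨⟨τ, h1⟩, h2, h3⟩)
  refine ⟨L, L', fun σ d hd => ?_⟩
  obtain ⟨s, hs, u, hu, γ, hγ, h1, h2, h3⟩ := hL σ d
  rw [← hs]
  refine ⟨s.2, u, hu, γ, hγ, fun τ hτ => h1 ⟨τ, hτ⟩, fun v hv => ?_, h3⟩
  rw [hd.divM_eq hΩ]
  exact h2 v hv

theorem isEllipticProj_ISig (hΩ : IsOpen Ω) {σ : L2 Ω (Mat n)} (hσ : σ ∈ HdivM Ω) :
    S.IsEllipticProj σ (S.ISig σ) := by
  obtain ⟨L, L', hL⟩ := S.exists_isEllipticProj hΩ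
  obtain ⟨d, hd⟩ := hσ
  exact Classical.epsilon_spec ⟨_, hL σ d hd⟩

theorem exists_ISig_eq (hΩ : IsOpen Ω) :
    ∃ (L : L2 Ω (Mat n) →L[ℝ] L2 Ω (Mat n)) (L' : L2 Ω (Vec n) →L[ℝ] L2 Ω (Mat n)),
      ∀ σ d, IsWeakDivM σ d → S.ISig σ = L σ + L' d := by
  obtain ⟨L, L', hL⟩ := S.exists_isEllipticProj hΩ
  exact ⟨L, L', fun σ d hd => (S.isEllipticProj_ISig hΩ ⟨d, hd⟩).unique hΩ (hL σ d hd)⟩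

theorem inner_ISig (hΩ : IsOpen Ω) {σ η : L2 Ω (Mat n)} (hσ : σ ∈ HdivM Ω) (hη : η ∈ S.Gam) :
    inner ℝ (S.ISig σ) η = inner ℝ σ η := by
  obtain ⟨-, u, -, γ, -, -, -, h2⟩ := S.isEllipticProj_ISig hΩ hσ
  exact h2 η hη

/-- The difference `δ` of the two interpolants is divergence free but only approximately symmetric:
its projection to `Γ_h` equals that of `Π_h^Σ σ - σ`. Subtract a divergence free `τ` from (S4) with
the same projection, of norm at most `c e`; then `δ - τ` lies in the kernel and Galerkin
orthogonality applies. The constant is the sum `1 + (1 + c) + c`. -/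
theorem norm_sub_ISig_le (hΩ : IsOpen Ω) (hc : 0 < c) {σ : L2 Ω (Mat n)} (hσ : σ ∈ HdivM Ω)
    (hσ1 : sobNorm 1 σ < ⊤) : ‖σ - S.ISig σ‖ ≤ (2 + 2 * c) * ‖σ - S.PiSig σ‖ := by
  have hI := S.isEllipticProj_ISig hΩ hσ
  set e := ‖σ - S.PiSig σ‖ with he
  set δ := S.PiSig σ - S.ISig σ with hδ
  have hmem := S.PiSig_mem σ hσ1
  have hδmem : δ ∈ S.Sig := S.Sig.sub_mem hmem hI.1
  have hδdiv : divM δ = 0 := by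
    rw [S.divM_sub hΩ hmem hI.1, S.PiSig_div σ hσ1, hI.divM_eq, PV, sub_self]
  have hP : ‖S.Gam.starProjection δ‖ ≤ e := by
    have hG : S.Gam.starProjection δ ∈ S.Gam := Submodule.starProjection_apply_mem _ _
    have h1 : ‖S.Gam.starProjection δ‖ ^ 2 ≤ e * ‖S.Gam.starProjection δ‖ := by
      rw [← real_inner_self_eq_norm_sq, S.Gam.inner_starProjection_of_mem _ hG, hδ, inner_sub_left,
        S.inner_ISig hΩ hσ hG, ← inner_sub_left, he, norm_sub_rev]
      exact real_inner_le_norm _ _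
    by_contra! h2
    nlinarith [norm_nonneg (σ - S.PiSig σ)]
  obtain ⟨τ, h1, h2, h3, h4⟩ := S.stabSig 0 S.V.zero_mem (S.Gam.starProjection δ)
    (Submodule.starProjection_apply_mem _ _)
  have hτ : ‖τ‖ ≤ c * e := by
    rw [h2, norm_zero, zero_add, zero_pow two_ne_zero, add_zero,
      Real.sqrt_sq (norm_nonneg _)] at h4
    exact h4.trans (by gcongr)
  have hk : δ - τ ∈ S.kernel hΩ := by
    refine ⟨S.Sig.sub_mem hδmem h1, ?_, fun η hη => ?_⟩
    · rw [S.divM_sub hΩ hδmem h1, h2, hδdiv, sub_self]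
    · rw [inner_sub_left, h3 η hη, S.Gam.inner_starProjection_of_mem _ hη, sub_self]
  have hδτ : ‖δ - τ‖ ≤ e + c * e := by
    have h5 := hI.inner_eq_zero hΩ hk
    -- Orthogonality allows the elliptic projection in `δ` to be replaced by `σ`, which leaves the
    -- error of `Π_h^Σ` and `τ`.
    have h6 : ‖δ - τ‖ ^ 2 ≤ (e + c * e) * ‖δ - τ‖ := by
      have h7 : inner ℝ (δ - τ) (δ - τ) = inner ℝ (S.PiSig σ - σ - τ) (δ - τ) := by
        have : δ - τ = (S.PiSig σ - σ - τ) - (S.ISig σ - σ) := by rw [hδ]; abel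
        conv_lhs => lhs; rw [this]
        rw [inner_sub_left, h5, sub_zero]
      rw [← real_inner_self_eq_norm_sq, h7]
      refine (real_inner_le_norm _ _).trans ?_
      gcongr
      refine (norm_sub_le _ _).trans ?_
      rw [norm_sub_rev]
      gcongr
    by_contra! h7
    have : 0 ≤ e := norm_nonneg _
    have : 0 ≤ c * e := by positivity
    nlinarith
  have hfin : σ - S.ISig σ = (σ - S.PiSig σ) + (δ - τ) + τ := by rw [hδ]; abel
  rw [hfin]
  refine (norm_add₃_le).trans ?_
  linarith

theorem enorm_sub_ISig_le (hΩ : IsOpen Ω) (hc : 0 < c) (hh : 0 < h) {m : ℕ} (hm : 1 ≤ m)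
    (hmr : m ≤ r) {σ : L2 Ω (Mat n)} (hσ : σ ∈ HdivM Ω) :
    ‖S.ISig σ - σ‖ₑ ≤ ENNReal.ofReal ((2 + 2 * c) * c * h ^ m) * sobNorm m σ := by
  by_cases hfin : sobNorm m σ < ⊤
  · have h1 := S.norm_sub_ISig_le hΩ hc hσ ((sobNorm_mono hm σ).trans_lt hfin)
    calc ‖S.ISig σ - σ‖ₑ = ENNReal.ofReal ‖σ - S.ISig σ‖ := by rw [norm_sub_rev, ofReal_norm]
      _ ≤ ENNReal.ofReal ((2 + 2 * c) * ‖σ - S.PiSig σ‖) := ENNReal.ofReal_le_ofReal h1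
      _ = ENNReal.ofReal (2 + 2 * c) * ‖σ - S.PiSig σ‖ₑ := by
          rw [ENNReal.ofReal_mul (by positivity), ofReal_norm]
      _ ≤ ENNReal.ofReal (2 + 2 * c) * (ENNReal.ofReal (c * h ^ m) * sobNorm m σ) := by
          gcongr
          exact S.PiSig_err m hm hmr σ
      _ = _ := by
          rw [← mul_assoc, ← ENNReal.ofReal_mul (by positivity), mul_assoc]
  · rw [not_lt_top_iff.1 hfin, ENNReal.mul_top]
    · exact le_top
    · simp only [ne_eq, ENNReal.ofReal_eq_zero, not_le]; positivity

theorem enorm_PQ_sub_le {m : ℕ} (hm : 1 ≤ m) (hmr : m ≤ r) (q : L2 Ω ℝ) :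
    ‖S.PQ q - q‖ₑ ≤ ENNReal.ofReal (c * h ^ m) * sobNorm m q := by
  obtain ⟨q', h1, h2⟩ := S.orderQ m hm hmr q
  refine le_trans ?_ h2
  rw [← ofReal_norm, ← ofReal_norm, norm_sub_rev]
  exact ENNReal.ofReal_le_ofReal (S.Q.norm_sub_starProjection_le q h1)

theorem enorm_PGam_sub_le {m : ℕ} (hm : 1 ≤ m) (hmr : m ≤ r) {η : L2 Ω (Mat n)}
    (hη : η ∈ skewL2 Ω) : ‖S.PGam η - η‖ₑ ≤ ENNReal.ofReal (c * h ^ m) * sobNorm m η := by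
  obtain ⟨q', h1, h2⟩ := S.orderGam m hm hmr η hη
  refine le_trans ?_ h2
  rw [← ofReal_norm, ← ofReal_norm, norm_sub_rev]
  exact ENNReal.ofReal_le_ofReal (S.Gam.norm_sub_starProjection_le η h1)

/-- The discrete flux is a bounded linear function of the discrete pressure. -/
theorem exists_flux_map (hΩ : IsOpen Ω) (k : BiotCoeff Ω) :
    ∃ L : L2 Ω ℝ →L[ℝ] L2 Ω (Vec n), ∀ z ∈ S.W, ∀ p,
      (∀ w ∈ S.W, inner ℝ (k.opK z) w + inner ℝ p (divV w) = 0) → z = L p := by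
  obtain ⟨a, ha, hcoer⟩ := k.exists_opK_coercive
  obtain ⟨L, hL⟩ := exists_coercive_operator S.W (S.divW hΩ) k.opK ha hcoer
  exact ⟨L, fun z hz p hp => hL ⟨z, hz⟩ p fun w => hp w w.2⟩

end MixedPair

/-! ### Abstract energy inequalities at a fixed time. -/

section Energy

variable {H : Type*} [NormedAddCommGroup H] [InnerProductSpace ℝ H]

/-- Young's inequality for a nonnegative symmetric form. -/
theorem two_mul_inner_le (B : H →L[ℝ] H) (hs : ∀ x y, inner ℝ (B x) y = inner ℝ x (B y))
    (hp : ∀ x, 0 ≤ inner ℝ (B x) x) {c : ℝ} (hc : 0 < c) (x y : H) :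
    2 * inner ℝ (B x) y ≤ c⁻¹ * (‖B‖ * ‖x‖ ^ 2) + c * inner ℝ (B y) y := by
  have h1 := hp (x - c • y)
  simp only [map_sub, map_smul, inner_sub_left, inner_sub_right, real_inner_smul_left,
    real_inner_smul_right] at h1
  rw [hs y x, real_inner_comm y] at h1
  have h2 : inner ℝ (B x) x ≤ ‖B‖ * ‖x‖ ^ 2 := by
    refine (real_inner_le_norm _ _).trans ?_
    rw [sq, ← mul_assoc]
    gcongr
    exact B.le_opNorm x
  have h3 : 2 * inner ℝ (B x) y ≤ c⁻¹ * inner ℝ (B x) x + c * inner ℝ (B y) y := by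
    have h4 : c⁻¹ * (2 * (c * inner ℝ (B x) y)) ≤
        c⁻¹ * (inner ℝ (B x) x + c * (c * inner ℝ (B y) y)) := by
      have := inv_pos.2 hc
      gcongr
      rw [real_inner_comm (B x) y] at h1
      linarith
    have h5 : c⁻¹ * (2 * (c * inner ℝ (B x) y)) = 2 * inner ℝ (B x) y := by
      field_simp
    have h6 : c⁻¹ * (inner ℝ (B x) x + c * (c * inner ℝ (B y) y)) =
        c⁻¹ * inner ℝ (B x) x + c * inner ℝ (B y) y := by
      field_simp
    linarith
  refine h3.trans ?_
  have := inv_pos.2 hc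
  gcongr

/-- The Cauchy–Schwarz inequality for a nonnegative symmetric form. -/
theorem inner_le_sqrt_mul (B : H →L[ℝ] H) (hs : ∀ x y, inner ℝ (B x) y = inner ℝ x (B y))
    (hp : ∀ x, 0 ≤ inner ℝ (B x) x) (x y : H) :
    inner ℝ (B x) y ≤ √‖B‖ * ‖x‖ * √(inner ℝ (B y) y) := by
  have hN : 0 ≤ √‖B‖ * ‖x‖ := by positivity
  have hsq : (√‖B‖ * ‖x‖) ^ 2 = ‖B‖ * ‖x‖ ^ 2 := by
    rw [mul_pow, Real.sq_sqrt (norm_nonneg _)]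
  have hY := Real.sq_sqrt (hp y)
  have hY0 := Real.sqrt_nonneg (inner ℝ (B y) y)
  refine le_of_forall_pos_le_add fun ε hε => ?_
  set N := √‖B‖ * ‖x‖
  set Y := √(inner ℝ (B y) y)
  -- The optimal weight `N / Y` in Young's inequality may degenerate, so both terms are shifted by a
  -- small `δ`.
  obtain ⟨δ, hδ, hδε⟩ : ∃ δ > 0, δ * (N + Y + δ) ≤ ε := by
    refine ⟨min 1 (ε / (N + Y + 1)), by positivity, ?_⟩
    calc min 1 (ε / (N + Y + 1)) * (N + Y + min 1 (ε / (N + Y + 1)))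
        ≤ (ε / (N + Y + 1)) * (N + Y + 1) := by
          gcongr
          · exact min_le_right _ _
          · exact min_le_left _ _
      _ = ε := by field_simp
  have h1 := two_mul_inner_le B hs hp (c := (N + δ) / (Y + δ)) (by positivity) x y
  rw [← hsq, ← hY, inv_div] at h1
  have h2 : (Y + δ) / (N + δ) * N ^ 2 ≤ (Y + δ) * (N + δ) := by
    rw [div_mul_eq_mul_div, div_le_iff₀ (by positivity), mul_assoc]
    gcongr
    nlinarith
  have h3 : (N + δ) / (Y + δ) * Y ^ 2 ≤ (Y + δ) * (N + δ) := by
    rw [div_mul_eq_mul_div, div_le_iff₀ (by positivity)]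
    have : Y ^ 2 ≤ (Y + δ) * (Y + δ) := by nlinarith
    calc (N + δ) * Y ^ 2 ≤ (N + δ) * ((Y + δ) * (Y + δ)) := by gcongr
      _ = _ := by ring
  nlinarith

theorem norm_le_sqrt_inner_div (B : H →L[ℝ] H) {a : ℝ} (ha : 0 < a)
    (hB : ∀ x, a * ‖x‖ ^ 2 ≤ inner ℝ (B x) x) (x : H) :
    ‖x‖ ≤ √(inner ℝ (B x) x) / √a := by
  rw [← Real.sqrt_div' _ ha.le]
  refine Real.le_sqrt_of_sq_le ?_
  rw [le_div_iff₀ ha, mul_comm]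
  exact hB x

theorem sqrt_inner_le (B : H →L[ℝ] H) (x : H) : √(inner ℝ (B x) x) ≤ √‖B‖ * ‖x‖ := by
  conv_rhs => rw [← Real.sqrt_sq (norm_nonneg x)]
  rw [← Real.sqrt_mul (norm_nonneg _)]
  refine Real.sqrt_le_sqrt ?_
  rw [sq, ← mul_assoc]
  exact (real_inner_le_norm _ _).trans (by gcongr; exact B.le_opNorm x)

variable {V Q : Type*} [NormedAddCommGroup V] [InnerProductSpace ℝ V]
  [NormedAddCommGroup Q] [InnerProductSpace ℝ Q]

/-- The energy inequality for the error equations at a fixed time, tested with the errors. -/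
theorem energy_ineq {A : H →L[ℝ] H} {K : V →L[ℝ] V} {S : Q →L[ℝ] Q} {I : Q →L[ℝ] H}
    (hAs : ∀ x y, inner ℝ (A x) y = inner ℝ x (A y)) {a : ℝ} (ha : 0 < a)
    (hA : ∀ x, a * ‖x‖ ^ 2 ≤ inner ℝ (A x) x)
    (hKs : ∀ x y, inner ℝ (K x) y = inner ℝ x (K y)) (hK : ∀ x, 0 ≤ inner ℝ (K x) x)
    (hSs : ∀ x y, inner ℝ (S x) y = inner ℝ x (S y)) (hS : ∀ x, 0 ≤ inner ℝ (S x) x)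
    {e e' ξ ν : H} {p p' π d : Q} {z ζ : V}
    (h1 : inner ℝ (A e') e = inner ℝ (A ξ) e + inner ℝ ν e)
    (hν : inner ℝ ν (I p) = 0)
    (h3 : inner ℝ (K z) z + inner ℝ p d = inner ℝ (K ζ) z)
    (h4 : inner ℝ (S p') p + inner ℝ (A e') (I p) - inner ℝ d p =
      inner ℝ (S π) p + inner ℝ (A ξ) (I p)) :
    2 * inner ℝ (A e') (e + I p) + 2 * inner ℝ (S p') p ≤
      2 * ((√‖A‖ + 1 / √a + √‖S‖) * (‖ξ‖ + ‖ν‖ + ‖π‖)) *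
        √(inner ℝ (A (e + I p)) (e + I p) + inner ℝ (S p) p) + ‖K‖ * ‖ζ‖ ^ 2 := by
  have hA0 : ∀ x, 0 ≤ inner ℝ (A x) x := fun x => le_trans (by positivity) (hA x)
  set E := e + I p with hE
  set Y := √(inner ℝ (A E) E + inner ℝ (S p) p) with hY
  have hYA : √(inner ℝ (A E) E) ≤ Y := Real.sqrt_le_sqrt (by linarith [hS p])
  have hYS : √(inner ℝ (S p) p) ≤ Y := Real.sqrt_le_sqrt (by linarith [hA0 E])
  -- Sum of the three tested equations: the terms pairing `p` with `d` cancel, and `hν` lets `ν` be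
  -- paired with `E` instead of `e`.
  have key : inner ℝ (A e') E + inner ℝ (S p') p =
      inner ℝ (A ξ) E + inner ℝ ν E + inner ℝ (S π) p + inner ℝ (K ζ) z - inner ℝ (K z) z := by
    rw [hE, inner_add_right, inner_add_right, inner_add_right, hν]
    linarith [real_inner_comm d p]
  have b1 : inner ℝ (A ξ) E ≤ √‖A‖ * ‖ξ‖ * Y :=
    (inner_le_sqrt_mul A hAs hA0 ξ E).trans (by gcongr)
  have b2 : inner ℝ ν E ≤ 1 / √a * ‖ν‖ * Y := by
    refine (real_inner_le_norm _ _).trans ?_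
    calc ‖ν‖ * ‖E‖ ≤ ‖ν‖ * (Y / √a) := by
          gcongr
          exact (norm_le_sqrt_inner_div A ha hA E).trans (by gcongr)
      _ = _ := by ring
  have b3 : inner ℝ (S π) p ≤ √‖S‖ * ‖π‖ * Y :=
    (inner_le_sqrt_mul S hSs hS π p).trans (by gcongr)
  -- Weight 1 leaves one copy of the form at `z`, which the dissipation term absorbs.
  have b4 := two_mul_inner_le K hKs hK one_pos ζ z
  have b5 := hK z
  have hY0 : 0 ≤ Y := Real.sqrt_nonneg _
  have : 0 ≤ √‖A‖ := Real.sqrt_nonneg _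
  have : 0 ≤ √‖S‖ := Real.sqrt_nonneg _
  have : 0 ≤ 1 / √a := by positivity
  have b6 : √‖A‖ * ‖ξ‖ + 1 / √a * ‖ν‖ + √‖S‖ * ‖π‖ ≤
      (√‖A‖ + 1 / √a + √‖S‖) * (‖ξ‖ + ‖ν‖ + ‖π‖) := by
    have := norm_nonneg ξ
    have := norm_nonneg ν
    have := norm_nonneg π
    calc _ ≤ (√‖A‖ + 1 / √a + √‖S‖) * ‖ξ‖ + (√‖A‖ + 1 / √a + √‖S‖) * ‖ν‖ +
          (√‖A‖ + 1 / √a + √‖S‖) * ‖π‖ := by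
          gcongr <;> linarith
      _ = _ := by ring
  have b7 := mul_le_mul_of_nonneg_right b6 hY0
  rw [inv_one, one_mul, one_mul] at b4
  nlinarith

/-- The energy inequality for the error equations at a fixed time, tested with the time
derivatives of the errors. -/
theorem energy_ineq_deriv {A : H →L[ℝ] H} {K : V →L[ℝ] V} {S : Q →L[ℝ] Q} {I : Q →L[ℝ] H}
    (hAs : ∀ x y, inner ℝ (A x) y = inner ℝ x (A y)) {a : ℝ} (ha : 0 < a)
    (hA : ∀ x, a * ‖x‖ ^ 2 ≤ inner ℝ (A x) x)
    (hKs : ∀ x y, inner ℝ (K x) y = inner ℝ x (K y)) (hK : ∀ x, 0 ≤ inner ℝ (K x) x)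
    (hSs : ∀ x y, inner ℝ (S x) y = inner ℝ x (S y)) (hS : ∀ x, 0 ≤ inner ℝ (S x) x)
    {e' ξ ν : H} {p' π d : Q} {z z' ζ' : V}
    (h1 : inner ℝ (A (e' + I p')) e' = inner ℝ (A ξ) e' + inner ℝ ν e')
    (hν : inner ℝ ν (I p') = 0)
    (h3 : inner ℝ (K z') z + inner ℝ p' d = inner ℝ (K ζ') z)
    (h4 : inner ℝ (S p') p' + inner ℝ (A (e' + I p')) (I p') - inner ℝ d p' =
      inner ℝ (S π) p' + inner ℝ (A ξ) (I p')) :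
    2 * inner ℝ (K z') z ≤
      2 * (√‖K‖ * ‖ζ'‖) * √(inner ℝ (K z) z) +
        (‖A‖ * ‖ξ‖ ^ 2 + 1 / a * ‖ν‖ ^ 2 + ‖S‖ * ‖π‖ ^ 2) := by
  have hA0 : ∀ x, 0 ≤ inner ℝ (A x) x := fun x => le_trans (by positivity) (hA x)
  set E := e' + I p' with hE
  -- The left side now has positive terms in `E` and `p'`. They absorb the right side by Young's
  -- inequality: one copy of the form of `A` for `ξ`, one for `ν`.
  have key : inner ℝ (A E) E + inner ℝ (S p') p' + inner ℝ (K z') z =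
      inner ℝ (A ξ) E + inner ℝ ν E + inner ℝ (S π) p' + inner ℝ (K ζ') z := by
    conv_lhs => lhs; lhs; rhs; rw [hE]
    conv_rhs => lhs; lhs; rw [hE]
    rw [inner_add_right, inner_add_right, inner_add_right, hν]
    linarith [real_inner_comm d p']
  have b1 := two_mul_inner_le A hAs hA0 one_pos ξ E
  have b2 : 2 * inner ℝ ν E ≤ 1 / a * ‖ν‖ ^ 2 + inner ℝ (A E) E := by
    refine le_trans ?_ (add_le_add le_rfl (hA E))
    have h5 := real_inner_le_norm ν E
    have h6 : 0 ≤ 1 / a * (‖ν‖ - a * ‖E‖) ^ 2 := by positivity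
    have h7 : 1 / a * (‖ν‖ - a * ‖E‖) ^ 2 = 1 / a * ‖ν‖ ^ 2 - 2 * (‖ν‖ * ‖E‖) + a * ‖E‖ ^ 2 := by
      field_simp
      ring
    linarith
  have b3 := two_mul_inner_le S hSs hS one_pos π p'
  -- Cauchy–Schwarz here, not Young: `ζ'` will only be integrable in time, so it must enter
  -- linearly, with the factor `√y`.
  have b4 := inner_le_sqrt_mul K hKs hK ζ' z
  have b5 := hS p'
  rw [inv_one, one_mul, one_mul] at b1 b3
  nlinarith

end Energy

theorem IsTimeDeriv.congr {Y : Type*} [NormedAddCommGroup Y] [NormedSpace ℝ Y] {T : ℝ}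
    {f g f' g' : ℝ → Y} (h : IsTimeDeriv T f g) (hf : ∀ t ∈ Icc 0 T, f' t = f t)
    (hg : g' =ᵐ[volume.restrict (Icc 0 T)] g) : IsTimeDeriv T f' g' := by
  refine ⟨h.integrable.congr_fun_ae hg.symm, fun t ht => ?_⟩
  rw [hf t ht, hf 0 ⟨le_rfl, ht.1.trans ht.2⟩, h.eq_integral t ht]
  congr 1
  refine intervalIntegral.integral_congr_ae ?_
  have hg' := (ae_restrict_iff' measurableSet_Icc).1 hg
  filter_upwards [hg'] with s hs hs'
  rw [uIoc_of_le ht.1] at hs'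
  exact (hs ⟨hs'.1.le, hs'.2.trans ht.2⟩).symm

/-! ### The errors, their equations and the consequences of stability. -/

/-- An exact and a semidiscrete solution of Biot's model, with close initial values. -/
structure BiotErrorData {n : ℕ} {Ω : Set (Vec n)} (k : BiotCoeff Ω) (T : ℝ) (r r' : ℕ)
    (cS c₀ : ℝ) where
  h : ℝ
  S : MixedPair Ω r r' cS h
  f : ℝ → L2 Ω (Vec n)
  g : ℝ → L2 Ω ℝ
  σ : ℝ → L2 Ω (Mat n)
  u : ℝ → L2 Ω (Vec n)
  γ : ℝ → L2 Ω (Mat n)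
  z : ℝ → L2 Ω (Vec n)
  p : ℝ → L2 Ω ℝ
  σh : ℝ → L2 Ω (Mat n)
  uh : ℝ → L2 Ω (Vec n)
  γh : ℝ → L2 Ω (Mat n)
  zh : ℝ → L2 Ω (Vec n)
  ph : ℝ → L2 Ω ℝ
  m : ℕ
  K : ℝ
  h_pos : 0 < h
  exact_sol : IsBiotSolution k T f g σ u γ z p
  semi : S.IsSemidiscrete k T f g σh uh γh zh ph
  one_le : 1 ≤ m
  le_r : m ≤ r
  K_nonneg : 0 ≤ K
  init : ‖σ 0 - σh 0‖ₑ + ‖p 0 - ph 0‖ₑ ≤ ENNReal.ofReal (h ^ m) *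
    (ENNReal.ofReal K + ENNReal.ofReal c₀ * (sobNorm m (σ 0) + sobNorm m (p 0)))
  init_z : ‖z 0 - zh 0‖ₑ ≤ ENNReal.ofReal (h ^ m) *
    (ENNReal.ofReal K + ENNReal.ofReal c₀ *
      (sobNorm m (σ 0) + sobNorm m (p 0) + sobNorm m (z 0)))

namespace BiotErrorData

variable {n : ℕ} {Ω : Set (Vec n)} {k : BiotCoeff Ω} {T : ℝ} {r r' : ℕ} {cS c₀ : ℝ}
  (d : BiotErrorData k T r r' cS c₀)

/-- The stress error `e_σ`. -/
noncomputable def es (t : ℝ) : L2 Ω (Mat n) := d.S.ISig (d.σ t) - d.σh t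

/-- The pressure error `e_p`. -/
noncomputable def ep (t : ℝ) : L2 Ω ℝ := d.S.PQ (d.p t) - d.ph t

/-- The displacement error `e_u`. -/
noncomputable def eu (t : ℝ) : L2 Ω (Vec n) := d.S.PV (d.u t) - d.uh t

/-- The rotation error `e_γ`. -/
noncomputable def eg (t : ℝ) : L2 Ω (Mat n) := d.S.PGam (d.γ t) - d.γh t

/-- The flux error `e_z`. -/
noncomputable def ez (t : ℝ) : L2 Ω (Vec n) := d.S.PiW (d.z t) - d.zh t

/-- The error `e_σ + α e_p 𝐈` of the total stress. -/
noncomputable def E (t : ℝ) : L2 Ω (Mat n) := d.es t + k.opI (d.ep t)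

/-- The interpolation error of the total stress. -/
noncomputable def Xi (τ : L2 Ω (Mat n)) (q : L2 Ω ℝ) : L2 Ω (Mat n) :=
  d.S.ISig τ - τ + k.opI (d.S.PQ q - q)

/-- The sum of the interpolation errors. -/
noncomputable def intErr (τ : L2 Ω (Mat n)) (q : L2 Ω ℝ) (η : L2 Ω (Mat n)) : ℝ :=
  ‖d.Xi τ q‖ + ‖d.S.PGam η - η‖ + ‖d.S.PQ q - q‖

theorem intErr_nonneg (τ : L2 Ω (Mat n)) (q : L2 Ω ℝ) (η : L2 Ω (Mat n)) :
    0 ≤ d.intErr τ q η := by unfold intErr; positivity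

/-- The constant in the bound for the interpolation errors. -/
noncomputable def intConst (k : BiotCoeff Ω) (cS : ℝ) : ℝ :=
  (2 + 2 * cS) * cS + (‖k.opI‖ + 2) * cS

theorem intConst_nonneg (k : BiotCoeff Ω) (hcS : 0 < cS) : 0 ≤ intConst k cS := by
  unfold intConst; positivity

theorem ofReal_intErr_le (hΩ : IsOpen Ω) (hcS : 0 < cS) {τ η : L2 Ω (Mat n)} (q : L2 Ω ℝ)
    (hτ : τ ∈ HdivM Ω) (hη : η ∈ skewL2 Ω) :
    ENNReal.ofReal (d.intErr τ q η) ≤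
      ENNReal.ofReal (intConst k cS * d.h ^ d.m) *
        (sobNorm d.m τ + sobNorm d.m q + sobNorm d.m η) := by
  have hh := d.h_pos
  have h1 := d.S.enorm_sub_ISig_le hΩ hcS hh d.one_le d.le_r hτ
  have h2 := d.S.enorm_PQ_sub_le d.one_le d.le_r q
  have h3 := d.S.enorm_PGam_sub_le d.one_le d.le_r hη
  have e1 : d.intErr τ q η ≤ ‖d.S.ISig τ - τ‖ + (‖k.opI‖ + 1) * ‖d.S.PQ q - q‖ +
      ‖d.S.PGam η - η‖ := by
    unfold intErr Xi
    have := norm_add_le (d.S.ISig τ - τ) (k.opI (d.S.PQ q - q))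
    have := k.opI.le_opNorm (d.S.PQ q - q)
    linarith
  have hc₁ : intConst k cS = (2 + 2 * cS) * cS + (‖k.opI‖ + 2) * cS := rfl
  set c₁ := intConst k cS
  have hI := norm_nonneg k.opI
  calc ENNReal.ofReal (d.intErr τ q η)
      ≤ ENNReal.ofReal (‖d.S.ISig τ - τ‖ + (‖k.opI‖ + 1) * ‖d.S.PQ q - q‖ +
        ‖d.S.PGam η - η‖) := ENNReal.ofReal_le_ofReal e1
    _ = ‖d.S.ISig τ - τ‖ₑ + ENNReal.ofReal (‖k.opI‖ + 1) * ‖d.S.PQ q - q‖ₑ +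
        ‖d.S.PGam η - η‖ₑ := by
        rw [ENNReal.ofReal_add (by positivity) (by positivity),
          ENNReal.ofReal_add (by positivity) (by positivity), ENNReal.ofReal_mul (by positivity)]
        simp only [ofReal_norm]
    _ ≤ ENNReal.ofReal (c₁ * d.h ^ d.m) * sobNorm d.m τ +
        ENNReal.ofReal (c₁ * d.h ^ d.m) * sobNorm d.m q +
        ENNReal.ofReal (c₁ * d.h ^ d.m) * sobNorm d.m η := by
        refine add_le_add (add_le_add ?_ ?_) ?_
        · refine h1.trans ?_
          gcongr
          rw [hc₁]
          exact le_add_of_nonneg_right (by positivity)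
        · refine (mul_le_mul_right h2 _).trans ?_
          rw [← mul_assoc, ← ENNReal.ofReal_mul (by positivity), ← mul_assoc]
          gcongr
          rw [hc₁]
          have : 0 ≤ (2 + 2 * cS) * cS := by positivity
          nlinarith
        · refine h3.trans ?_
          gcongr
          rw [hc₁]
          have : 0 ≤ (2 + 2 * cS) * cS := by positivity
          have : 0 ≤ ‖k.opI‖ * cS := by positivity
          nlinarith
    _ = _ := by rw [mul_add, mul_add]

theorem exact_eq1 {t : ℝ} (ht : t ∈ Icc 0 T) {τ : L2 Ω (Mat n)} (hτ : τ ∈ HdivM Ω) :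
    inner ℝ (k.opA (d.σ t + k.opI (d.p t))) τ + inner ℝ (d.u t) (divM τ) +
      inner ℝ (d.γ t) τ = 0 := by
  rw [← k.formA_eq (k.total_ae _ _) (ae_eq_refl _)]
  exact d.exact_sol.eq1 t ht τ hτ

theorem semi_eq1 {t : ℝ} (ht : t ∈ Icc 0 T) {τ : L2 Ω (Mat n)} (hτ : τ ∈ d.S.Sig) :
    inner ℝ (k.opA (d.σh t + k.opI (d.ph t))) τ + inner ℝ (d.uh t) (divM τ) +
      inner ℝ (d.γh t) τ = 0 := by
  rw [← k.formA_eq (k.total_ae _ _) (ae_eq_refl _)]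
  exact d.semi.eq1 t ht τ hτ

/-- The error equation for the constitutive law of the stress. -/
theorem err_eq1 {t : ℝ} (ht : t ∈ Icc 0 T) {τ : L2 Ω (Mat n)} (hτ : τ ∈ d.S.Sig) :
    inner ℝ (k.opA (d.E t)) τ + inner ℝ (d.eu t) (divM τ) + inner ℝ (d.eg t) τ =
      inner ℝ (k.opA (d.Xi (d.σ t) (d.p t))) τ +
        inner ℝ (d.S.PGam (d.γ t) - d.γ t) τ := by
  have h1 := d.exact_eq1 ht (d.S.Sig_le hτ)
  have h2 := d.semi_eq1 ht hτ
  -- Since `div τ` lies in `V_h`, the displacement contributes no interpolation error.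
  have h3 : inner ℝ (d.S.PV (d.u t)) (divM τ) = inner ℝ (d.u t) (divM τ) :=
    d.S.V.inner_starProjection_of_mem _ (d.S.divM_mem hτ)
  have h4 : d.E t - d.Xi (d.σ t) (d.p t) =
      (d.σ t + k.opI (d.p t)) - (d.σh t + k.opI (d.ph t)) := by
    simp only [E, Xi, es, ep, map_sub]
    abel
  have h5 := congrArg (fun ξ => inner ℝ (k.opA ξ) τ) h4
  simp only [map_sub, inner_sub_left] at h5
  rw [eu, eg, inner_sub_left, inner_sub_left, inner_sub_left, h3]
  linarith

theorem semi_divM {t : ℝ} (ht : t ∈ Icc 0 T) : divM (d.σh t) = d.S.PV (divM (d.σ t)) := by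
  refine (Submodule.eq_starProjection_of_mem_of_inner_eq_zero
    (d.S.divM_mem (d.semi.σ_mem t ht)) fun v hv => ?_).symm
  have h1 := d.exact_sol.eq2 t ht v 0 (d.S.Gam_le d.S.Gam.zero_mem)
  have h2 := d.semi.eq2 t ht v hv 0 d.S.Gam.zero_mem
  rw [inner_zero_right] at h1 h2
  rw [inner_sub_left]
  linarith

/-- This is what the elliptic projection is for. Both stresses have the same projected divergence
and the same moments against `Γ_h`, so their difference is an admissible test field that sees
neither e_u nor e_γ. -/
theorem es_mem_kernel (hΩ : IsOpen Ω) {t : ℝ} (ht : t ∈ Icc 0 T) : d.es t ∈ d.S.kernel hΩ := by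
  have hI := d.S.isEllipticProj_ISig hΩ (d.exact_sol.σ_mem t ht)
  refine ⟨d.S.Sig.sub_mem hI.1 (d.semi.σ_mem t ht), ?_, fun η hη => ?_⟩
  · rw [es, d.S.divM_sub hΩ hI.1 (d.semi.σ_mem t ht), hI.divM_eq, d.semi_divM ht, sub_self]
  · have h1 := d.exact_sol.eq2 t ht 0 η (d.S.Gam_le hη)
    have h2 := d.semi.eq2 t ht 0 d.S.V.zero_mem η hη
    rw [inner_zero_right, inner_zero_right] at h1 h2
    rw [es, inner_sub_left, d.S.inner_ISig hΩ (d.exact_sol.σ_mem t ht) hη]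
    linarith

/-- The error equation for Darcy's law. -/
theorem err_eq3 {t : ℝ} (ht : t ∈ Icc 0 T) {w : L2 Ω (Vec n)} (hw : w ∈ d.S.W) :
    inner ℝ (k.opK (d.ez t)) w + inner ℝ (d.ep t) (divV w) =
      inner ℝ (k.opK (d.S.PiW (d.z t) - d.z t)) w := by
  have h1 := d.exact_sol.eq3 t ht w (d.S.W_le hw)
  have h2 := d.semi.eq3 t ht w hw
  have h3 : inner ℝ (d.S.PQ (d.p t)) (divV w) = inner ℝ (d.p t) (divV w) :=
    d.S.Q.inner_starProjection_of_mem _ (d.S.divV_mem hw)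
  rw [k.formK_eq] at h1 h2
  simp only [ez, ep, map_sub, inner_sub_left, h3]
  linarith

theorem ep_mem {t : ℝ} (ht : t ∈ Icc 0 T) : d.ep t ∈ d.S.Q :=
  d.S.Q.sub_mem (Submodule.starProjection_apply_mem _ _) (d.semi.p_mem t ht)

theorem eg_mem {t : ℝ} (ht : t ∈ Icc 0 T) : d.eg t ∈ d.S.Gam :=
  d.S.Gam.sub_mem (Submodule.starProjection_apply_mem _ _) (d.semi.γ_mem t ht)

/-- Test the Darcy error equation with a flux whose divergence is e_p, from (S3). This bound does
not degenerate as s₀ tends to 0. -/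
theorem norm_ep_le (hcS : 0 < cS) {t : ℝ} (ht : t ∈ Icc 0 T) :
    ‖d.ep t‖ ≤ ‖k.opK‖ * cS * (‖d.ez t‖ + ‖d.S.PiW (d.z t) - d.z t‖) := by
  obtain ⟨w, hw, hdiv, hle⟩ := d.S.stabW _ (d.ep_mem ht)
  have hw' : ‖w‖ ≤ cS * ‖d.ep t‖ :=
    (Real.le_sqrt_of_sq_le (by nlinarith [sq_nonneg ‖divV w‖])).trans hle
  have h1 := d.err_eq3 ht hw
  rw [hdiv, real_inner_self_eq_norm_sq] at h1
  have h2 : ∀ v : L2 Ω (Vec n), |inner ℝ (k.opK v) w| ≤ ‖k.opK‖ * ‖v‖ * (cS * ‖d.ep t‖) := by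
    intro v
    refine (abs_real_inner_le_norm _ _).trans ?_
    gcongr
    exact k.opK.le_opNorm v
  have h3 := (abs_le.1 (h2 (d.ez t))).1
  have h4 := (abs_le.1 (h2 (d.S.PiW (d.z t) - d.z t))).2
  have h5 : ‖d.ep t‖ ^ 2 ≤
      ‖k.opK‖ * cS * (‖d.ez t‖ + ‖d.S.PiW (d.z t) - d.z t‖) * ‖d.ep t‖ := by
    linarith
  have h6 : 0 ≤ ‖k.opK‖ * cS * (‖d.ez t‖ + ‖d.S.PiW (d.z t) - d.z t‖) := by positivity
  by_contra! h7
  nlinarith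

/-- Test the stress error equation with a field from (S4) whose divergence is e_u and whose
projection to `Γ_h` is e_γ. The factor 2 comes from `(x + y)² ≤ 2 (x² + y²)`. -/
theorem norm_eu_add_norm_eg_le (hcS : 0 < cS) {t : ℝ} (ht : t ∈ Icc 0 T) :
    ‖d.eu t‖ + ‖d.eg t‖ ≤ 2 * cS *
      (‖k.opA‖ * ‖d.E t‖ + (‖k.opA‖ + 1) * d.intErr (d.σ t) (d.p t) (d.γ t)) := by
  have hu : d.eu t ∈ d.S.V :=
    d.S.V.sub_mem (Submodule.starProjection_apply_mem _ _) (d.semi.u_mem t ht)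
  have hg := d.eg_mem ht
  obtain ⟨τ, hτ, hdiv, hgam, hle⟩ := d.S.stabSig _ hu _ hg
  have hτ' : ‖τ‖ ≤ cS * (‖d.eu t‖ + ‖d.eg t‖) :=
    (Real.le_sqrt_of_sq_le (by nlinarith [sq_nonneg ‖divM τ‖])).trans hle
  have h1 := d.err_eq1 ht hτ
  rw [hdiv, real_inner_self_eq_norm_sq, real_inner_comm τ (d.eg t), hgam _ hg,
    real_inner_self_eq_norm_sq] at h1
  have hA : ∀ v : L2 Ω (Mat n), |inner ℝ (k.opA v) τ| ≤ ‖k.opA‖ * ‖v‖ * ‖τ‖ := by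
    intro v
    refine (abs_real_inner_le_norm _ _).trans ?_
    gcongr
    exact k.opA.le_opNorm v
  have h2 := (abs_le.1 (hA (d.E t))).1
  have h3 := (abs_le.1 (hA (d.Xi (d.σ t) (d.p t)))).2
  have h4 := real_inner_le_norm (d.S.PGam (d.γ t) - d.γ t) τ
  set X := ‖k.opA‖ * ‖d.E t‖ + (‖k.opA‖ + 1) * d.intErr (d.σ t) (d.p t) (d.γ t) with hX
  have hX0 : 0 ≤ X := by
    have := d.intErr_nonneg (d.σ t) (d.p t) (d.γ t)
    positivity
  have h5 : ‖k.opA‖ * ‖d.E t‖ + ‖k.opA‖ * ‖d.Xi (d.σ t) (d.p t)‖ +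
      ‖d.S.PGam (d.γ t) - d.γ t‖ ≤ X := by
    rw [hX, intErr]
    have := norm_nonneg k.opA
    have i1 := norm_nonneg (d.Xi (d.σ t) (d.p t))
    have i2 := norm_nonneg (d.S.PGam (d.γ t) - d.γ t)
    have i3 := norm_nonneg (d.S.PQ (d.p t) - d.p t)
    nlinarith [mul_nonneg this i2, mul_nonneg this i3]
  have h6 : ‖d.eu t‖ ^ 2 + ‖d.eg t‖ ^ 2 ≤ X * (cS * (‖d.eu t‖ + ‖d.eg t‖)) := by
    calc ‖d.eu t‖ ^ 2 + ‖d.eg t‖ ^ 2 ≤ (‖k.opA‖ * ‖d.E t‖ + ‖k.opA‖ * ‖d.Xi (d.σ t) (d.p t)‖ +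
          ‖d.S.PGam (d.γ t) - d.γ t‖) * ‖τ‖ := by linarith
      _ ≤ _ := by gcongr
  have h7 : (‖d.eu t‖ + ‖d.eg t‖) ^ 2 ≤ 2 * cS * X * (‖d.eu t‖ + ‖d.eg t‖) := by
    nlinarith [sq_nonneg (‖d.eu t‖ - ‖d.eg t‖)]
  have h8 : 0 ≤ 2 * cS * X := by positivity
  have h9 : 0 ≤ ‖d.eu t‖ + ‖d.eg t‖ := by positivity
  by_contra! h10
  nlinarith

/-- The time derivative of the stress error. -/
noncomputable def es' (σ' : ℝ → L2 Ω (Mat n)) (t : ℝ) : L2 Ω (Mat n) :=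
  d.S.ISig (σ' t) - derivWithin d.σh (Icc 0 T) t

/-- The time derivative of the pressure error. -/
noncomputable def ep' (p' : ℝ → L2 Ω ℝ) (t : ℝ) : L2 Ω ℝ := d.S.PQ (p' t) - derivWithin d.ph (Icc 0 T) t

variable {σ' γ' : ℝ → L2 Ω (Mat n)} {p' : ℝ → L2 Ω ℝ}

theorem ae_mem_HdivM (hT : 0 < T) (hσ : IsTimeDeriv T d.σ σ') :
    ∀ᵐ t ∂(volume.restrict (Icc 0 T)),
      IsWeakDivM (σ' t) (derivWithin (fun s => divM (d.σ s)) (Icc 0 T) t) := by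
  filter_upwards [hσ.ae_hasDerivAt hT,
    (IsTimeDeriv.of_contDiffOn hT d.exact_sol.divσ_C1).ae_hasDerivAt hT] with t h1 h2
  refine IsWeakDivM.of_hasDerivAt ?_ h1.2 h2.2
  filter_upwards [Icc_mem_nhds h1.1.1 h1.1.2] with s hs using d.exact_sol.σ_mem s hs

theorem ae_mem_skewL2 (hT : 0 < T) (hγ : IsTimeDeriv T d.γ γ') :
    ∀ᵐ t ∂(volume.restrict (Icc 0 T)), γ' t ∈ skewL2 Ω := by
  filter_upwards [hγ.ae_hasDerivAt hT] with t h1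
  refine mem_skewL2_of_hasDerivAt ?_ h1.2
  filter_upwards [Icc_mem_nhds h1.1.1 h1.1.2] with s hs using d.exact_sol.γ_mem s hs

/-- The elliptic projection is not bounded in σ alone on L², but it is a bounded function of the
pair σ, div σ. Both are C¹ in time, so it commutes with the time derivative. -/
theorem isTimeDeriv_ISig (hΩ : IsOpen Ω) (hT : 0 < T) (hσ : IsTimeDeriv T d.σ σ') :
    IsTimeDeriv T (fun t => d.S.ISig (d.σ t)) (fun t => d.S.ISig (σ' t)) := by
  obtain ⟨L, L', hL⟩ := d.S.exists_ISig_eq hΩ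
  have hdiv := IsTimeDeriv.of_contDiffOn hT d.exact_sol.divσ_C1
  refine ((hσ.clm_comp L).add (hdiv.clm_comp L')).congr (fun t ht => ?_) ?_
  · exact hL _ _ (isWeakDivM_divM (d.exact_sol.σ_mem t ht))
  · filter_upwards [d.ae_mem_HdivM hT hσ] with t ht
    exact hL _ _ ht

theorem isTimeDeriv_es (hΩ : IsOpen Ω) (hT : 0 < T) (hσ : IsTimeDeriv T d.σ σ') :
    IsTimeDeriv T d.es (d.es' σ') :=
  (d.isTimeDeriv_ISig hΩ hT hσ).sub (IsTimeDeriv.of_contDiffOn hT d.semi.σ_C1)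

theorem isTimeDeriv_ep (hT : 0 < T) (hp : IsTimeDeriv T d.p p') :
    IsTimeDeriv T d.ep (d.ep' p') :=
  (hp.clm_comp d.S.PQ).sub (IsTimeDeriv.of_contDiffOn hT d.semi.p_C1)

theorem isTimeDeriv_E (hΩ : IsOpen Ω) (hT : 0 < T) (hσ : IsTimeDeriv T d.σ σ')
    (hp : IsTimeDeriv T d.p p') :
    IsTimeDeriv T d.E (fun t => d.es' σ' t + k.opI (d.ep' p' t)) :=
  (d.isTimeDeriv_es hΩ hT hσ).add ((d.isTimeDeriv_ep hT hp).clm_comp k.opI)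

theorem isTimeDeriv_Xi (hΩ : IsOpen Ω) (hT : 0 < T) (hσ : IsTimeDeriv T d.σ σ')
    (hp : IsTimeDeriv T d.p p') :
    IsTimeDeriv T (fun t => d.Xi (d.σ t) (d.p t)) (fun t => d.Xi (σ' t) (p' t)) :=
  ((d.isTimeDeriv_ISig hΩ hT hσ).sub hσ).add (((hp.clm_comp d.S.PQ).sub hp).clm_comp k.opI)

theorem ae_mem_kernel (hΩ : IsOpen Ω) (hT : 0 < T) (hσ : IsTimeDeriv T d.σ σ') :
    ∀ᵐ t ∂(volume.restrict (Icc 0 T)), d.es' σ' t ∈ d.S.kernel hΩ := by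
  filter_upwards [(d.isTimeDeriv_es hΩ hT hσ).ae_hasDerivAt hT] with t h1
  refine Submodule.mem_of_hasDerivAt _ ?_ h1.2
  filter_upwards [Icc_mem_nhds h1.1.1 h1.1.2] with s hs using d.es_mem_kernel hΩ hs

theorem ae_ep'_mem (hT : 0 < T) (hp : IsTimeDeriv T d.p p') :
    ∀ᵐ t ∂(volume.restrict (Icc 0 T)), d.ep' p' t ∈ d.S.Q := by
  filter_upwards [(d.isTimeDeriv_ep hT hp).ae_hasDerivAt hT] with t h1
  refine Submodule.mem_of_hasDerivAt _ ?_ h1.2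
  filter_upwards [Icc_mem_nhds h1.1.1 h1.1.2] with s hs using d.ep_mem hs

/-- The time derivative of the error equation for the constitutive law of the stress. -/
theorem ae_err_eq1_deriv (hΩ : IsOpen Ω) (hT : 0 < T) (hσ : IsTimeDeriv T d.σ σ')
    (hp : IsTimeDeriv T d.p p') (hγ : IsTimeDeriv T d.γ γ') :
    ∀ᵐ t ∂(volume.restrict (Icc 0 T)), ∀ τ ∈ d.S.kernel hΩ,
      inner ℝ (k.opA (d.es' σ' t + k.opI (d.ep' p' t))) τ =
        inner ℝ (k.opA (d.Xi (σ' t) (p' t))) τ + inner ℝ (d.S.PGam (γ' t) - γ' t) τ := by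
  filter_upwards [((d.isTimeDeriv_E hΩ hT hσ hp).clm_comp k.opA).ae_hasDerivAt hT,
    ((d.isTimeDeriv_Xi hΩ hT hσ hp).clm_comp k.opA).ae_hasDerivAt hT,
    ((hγ.clm_comp d.S.PGam).sub hγ).ae_hasDerivAt hT] with t h1 h2 h3 τ hτ
  have e1 := h1.2.inner ℝ (hasDerivAt_const t τ)
  have e2 := (h2.2.inner ℝ (hasDerivAt_const t τ)).add (h3.2.inner ℝ (hasDerivAt_const t τ))
  simp only [inner_zero_right, zero_add] at e1 e2
  refine e1.unique (e2.congr_of_eventuallyEq ?_)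
  filter_upwards [Icc_mem_nhds h1.1.1 h1.1.2] with s hs
  have := d.err_eq1 hs hτ.1
  -- The terms with e_u and e_γ vanish before differentiation, so neither needs a time derivative.
  rw [hτ.2.1, inner_zero_right, real_inner_comm τ (d.eg s),
    hτ.2.2 _ (d.eg_mem hs)] at this
  simpa using this

/-- The error equation for the conservation of mass. -/
theorem ae_err_eq4 (hΩ : IsOpen Ω) (hT : 0 < T) (hσ : IsTimeDeriv T d.σ σ')
    (hp : IsTimeDeriv T d.p p') :
    ∀ᵐ t ∂(volume.restrict (Icc 0 T)), sobNorm 1 (d.z t) < ⊤ → ∀ q ∈ d.S.Q,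
      inner ℝ (k.opS (d.ep' p' t)) q +
        inner ℝ (k.opA (d.es' σ' t + k.opI (d.ep' p' t))) (k.opI q) -
        inner ℝ (divV (d.ez t)) q =
      inner ℝ (k.opS (d.S.PQ (p' t) - p' t)) q +
        inner ℝ (k.opA (d.Xi (σ' t) (p' t))) (k.opI q) := by
  filter_upwards [hσ.ae_hasDerivAt hT, hp.ae_hasDerivAt hT] with t h1 h2 hz q hq
  have ht : t ∈ Icc 0 T := ⟨h1.1.1.le, h1.1.2.le⟩
  have hu : UniqueDiffWithinAt ℝ (Icc 0 T) t := uniqueDiffOn_Icc hT t ht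
  have e1 := d.exact_sol.eq4 t ht q
  have e2 := d.semi.eq4 t ht q hq
  rw [h1.2.hasDerivWithinAt.derivWithin hu, h2.2.hasDerivWithinAt.derivWithin hu] at e1
  rw [k.formS_eq, k.formA_eq (k.total_ae _ _) (k.opI_ae _)] at e1 e2
  -- The commuting property of `Π_h^W` removes the interpolation error of `div z`; it requires `z t`
  -- in H¹.
  have e3 : inner ℝ (divV (d.ez t)) q = inner ℝ (divV (d.z t)) q - inner ℝ (divV (d.zh t)) q := by
    rw [ez, d.S.divV_sub hΩ (d.S.PiW_mem _ hz) (d.semi.z_mem t ht), inner_sub_left,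
      d.S.PiW_div _ hz, d.S.Q.inner_starProjection_of_mem _ hq]
  rw [e3]
  simp only [es', ep', Xi, map_sub, map_add, inner_sub_left, inner_add_left] at e1 e2 ⊢
  linarith

end BiotErrorData

/-! ### The energy estimate for the total stress. -/

namespace BiotErrorData

variable {n : ℕ} {Ω : Set (Vec n)} {k : BiotCoeff Ω} {T : ℝ} {r r' : ℕ} {cS c₀ : ℝ}
  (d : BiotErrorData k T r r' cS c₀)

theorem intErr_le (hΩ : IsOpen Ω) (hT : 0 < T) (hcS : 0 < cS) {N : ℝ} (hN : 0 ≤ N)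
    (hW : W1qHm T 1 d.m d.σ + W1qHm T 1 d.m d.p + W1qHm T 1 d.m d.γ ≤ ENNReal.ofReal N)
    {t : ℝ} (ht : t ∈ Icc 0 T) :
    d.intErr (d.σ t) (d.p t) (d.γ t) ≤ intConst k cS * (1 + 1 / T) * (d.h ^ d.m * N) := by
  have hh := d.h_pos
  have hc := intConst_nonneg k hcS
  have h1 := d.ofReal_intErr_le hΩ hcS (d.p t) (d.exact_sol.σ_mem t ht) (d.exact_sol.γ_mem t ht)
  have h2 : sobNorm d.m (d.σ t) + sobNorm d.m (d.p t) + sobNorm d.m (d.γ t) ≤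
      ENNReal.ofReal ((1 + 1 / T) * N) := by
    rw [ENNReal.ofReal_mul (by positivity)]
    refine le_trans ?_ (mul_le_mul_right hW _)
    rw [mul_add, mul_add]
    exact add_le_add (add_le_add (sobNorm_le_W1qHm hΩ hT ht) (sobNorm_le_W1qHm hΩ hT ht))
      (sobNorm_le_W1qHm hΩ hT ht)
  have h3 := h1.trans (mul_le_mul_right h2 _)
  rw [← ENNReal.ofReal_mul (mul_nonneg hc (by positivity)),
    ENNReal.ofReal_le_ofReal_iff (mul_nonneg (mul_nonneg hc (by positivity)) (by positivity))] at h3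
  refine h3.trans (le_of_eq ?_)
  ring

theorem init_le (hΩ : IsOpen Ω) (hT : 0 < T) (hc₀ : 0 ≤ c₀) {N : ℝ} (hN : 0 ≤ N)
    (hW : W1qHm T 1 d.m d.σ + W1qHm T 1 d.m d.p ≤ ENNReal.ofReal N) :
    ‖d.σ 0 - d.σh 0‖ + ‖d.p 0 - d.ph 0‖ ≤ (1 + c₀ * (1 + 1 / T)) * (d.h ^ d.m * (d.K + N)) := by
  have hh := d.h_pos
  have hK := d.K_nonneg
  have h0 : (0 : ℝ) ∈ Icc 0 T := ⟨le_rfl, hT.le⟩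
  have h2 : sobNorm d.m (d.σ 0) + sobNorm d.m (d.p 0) ≤ ENNReal.ofReal ((1 + 1 / T) * N) := by
    rw [ENNReal.ofReal_mul (by positivity)]
    refine le_trans ?_ (mul_le_mul_right hW _)
    rw [mul_add]
    exact add_le_add (sobNorm_le_W1qHm hΩ hT h0) (sobNorm_le_W1qHm hΩ hT h0)
  have h3 : ENNReal.ofReal (‖d.σ 0 - d.σh 0‖ + ‖d.p 0 - d.ph 0‖) ≤
      ENNReal.ofReal (d.h ^ d.m * (d.K + c₀ * ((1 + 1 / T) * N))) := by
    rw [ENNReal.ofReal_add (norm_nonneg _) (norm_nonneg _), ofReal_norm, ofReal_norm,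
      ENNReal.ofReal_mul (by positivity), ENNReal.ofReal_add (by positivity) (by positivity),
      ENNReal.ofReal_mul hc₀]
    exact d.init.trans (by gcongr)
  rw [ENNReal.ofReal_le_ofReal_iff (by positivity)] at h3
  refine h3.trans ?_
  rw [mul_left_comm (1 + c₀ * (1 + 1 / T)) (d.h ^ d.m)]
  refine mul_le_mul_of_nonneg_left ?_ (pow_nonneg hh.le _)
  have : 0 ≤ c₀ * (1 + 1 / T) * d.K := by positivity
  linarith

theorem init_z_le (hΩ : IsOpen Ω) (hT : 0 < T) (hc₀ : 0 ≤ c₀) {N : ℝ} (hN : 0 ≤ N)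
    (hW : W1qHm T 1 d.m d.σ + W1qHm T 1 d.m d.p + W1qHm T 1 d.m d.z ≤ ENNReal.ofReal N) :
    ‖d.z 0 - d.zh 0‖ ≤ (1 + c₀ * (1 + 1 / T)) * (d.h ^ d.m * (d.K + N)) := by
  have hh := d.h_pos
  have hK := d.K_nonneg
  have h0 : (0 : ℝ) ∈ Icc 0 T := ⟨le_rfl, hT.le⟩
  have h2 : sobNorm d.m (d.σ 0) + sobNorm d.m (d.p 0) + sobNorm d.m (d.z 0) ≤
      ENNReal.ofReal ((1 + 1 / T) * N) := by
    rw [ENNReal.ofReal_mul (by positivity)]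
    refine le_trans ?_ (mul_le_mul_right hW _)
    rw [mul_add, mul_add]
    exact add_le_add (add_le_add (sobNorm_le_W1qHm hΩ hT h0) (sobNorm_le_W1qHm hΩ hT h0))
      (sobNorm_le_W1qHm hΩ hT h0)
  have h3 : ENNReal.ofReal ‖d.z 0 - d.zh 0‖ ≤
      ENNReal.ofReal (d.h ^ d.m * (d.K + c₀ * ((1 + 1 / T) * N))) := by
    rw [ofReal_norm,
      ENNReal.ofReal_mul (by positivity), ENNReal.ofReal_add (by positivity) (by positivity),
      ENNReal.ofReal_mul hc₀]
    exact d.init_z.trans (by gcongr)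
  rw [ENNReal.ofReal_le_ofReal_iff (by positivity)] at h3
  refine h3.trans ?_
  rw [mul_left_comm (1 + c₀ * (1 + 1 / T)) (d.h ^ d.m)]
  refine mul_le_mul_of_nonneg_left ?_ (pow_nonneg hh.le _)
  have : 0 ≤ c₀ * (1 + 1 / T) * d.K := by positivity
  linarith

theorem aemeasurable_intErr (hΩ : IsOpen Ω) (hT : 0 < T) {σ' γ' : ℝ → L2 Ω (Mat n)}
    {p' : ℝ → L2 Ω ℝ} (hσ : IsTimeDeriv T d.σ σ') (hp : IsTimeDeriv T d.p p')
    (hγ : IsTimeDeriv T d.γ γ') :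
    AEMeasurable (fun t => d.intErr (σ' t) (p' t) (γ' t)) (volume.restrict (Icc 0 T)) := by
  refine ((AEStronglyMeasurable.norm ?_).add (AEStronglyMeasurable.norm ?_)).add
    (AEStronglyMeasurable.norm ?_) |>.aemeasurable
  · exact (d.isTimeDeriv_Xi hΩ hT hσ hp).integrable.aestronglyMeasurable
  · exact ((hγ.clm_comp d.S.PGam).sub hγ).integrable.aestronglyMeasurable
  · exact ((hp.clm_comp d.S.PQ).sub hp).integrable.aestronglyMeasurable

theorem ae_ofReal_intErr_deriv_le (hΩ : IsOpen Ω) (hT : 0 < T) (hcS : 0 < cS)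
    {σ' γ' : ℝ → L2 Ω (Mat n)} (p' : ℝ → L2 Ω ℝ) (hσ : IsTimeDeriv T d.σ σ')
    (hγ : IsTimeDeriv T d.γ γ') :
    ∀ᵐ t ∂(volume.restrict (Icc 0 T)), ENNReal.ofReal (d.intErr (σ' t) (p' t) (γ' t)) ≤
      ENNReal.ofReal (intConst k cS * d.h ^ d.m) *
        (sobNorm d.m (σ' t) + sobNorm d.m (p' t) + sobNorm d.m (γ' t)) := by
  filter_upwards [d.ae_mem_HdivM hT hσ, d.ae_mem_skewL2 hT hγ] with t h1 h2
  exact d.ofReal_intErr_le hΩ hcS (p' t) ⟨_, h1⟩ h2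

theorem lintegral_intErr_deriv_le (hΩ : IsOpen Ω) (hT : 0 < T) (hcS : 0 < cS)
    {σ' γ' : ℝ → L2 Ω (Mat n)} {p' : ℝ → L2 Ω ℝ} (hσ : IsTimeDeriv T d.σ σ')
    (hp : IsTimeDeriv T d.p p') (hγ : IsTimeDeriv T d.γ γ') :
    ∫⁻ t in Icc 0 T, ENNReal.ofReal (d.intErr (σ' t) (p' t) (γ' t)) ≤
      ENNReal.ofReal (intConst k cS * d.h ^ d.m) *
        (LqHm T 1 d.m σ' + LqHm T 1 d.m p' + LqHm T 1 d.m γ') := by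
  have m1 := aemeasurable_sobNorm (m := d.m) hΩ hσ.integrable.aestronglyMeasurable
  have m2 := aemeasurable_sobNorm (m := d.m) hΩ hp.integrable.aestronglyMeasurable
  refine (lintegral_mono_ae (d.ae_ofReal_intErr_deriv_le hΩ hT hcS p' hσ hγ)).trans ?_
  have h12 : AEMeasurable (fun t => sobNorm d.m (σ' t) + sobNorm d.m (p' t))
    (volume.restrict (Icc 0 T)) := m1.add m2
  rw [lintegral_const_mul' _ _ ENNReal.ofReal_ne_top, lintegral_add_left' h12,
    lintegral_add_left' m1, LqHm_one, LqHm_one, LqHm_one]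

theorem lintegral_intErr_deriv_sq_le (hΩ : IsOpen Ω) (hT : 0 < T) (hcS : 0 < cS)
    {σ' γ' : ℝ → L2 Ω (Mat n)} {p' : ℝ → L2 Ω ℝ} (hσ : IsTimeDeriv T d.σ σ')
    (hp : IsTimeDeriv T d.p p') (hγ : IsTimeDeriv T d.γ γ') :
    ∫⁻ t in Icc 0 T, ENNReal.ofReal (d.intErr (σ' t) (p' t) (γ' t)) ^ 2 ≤
      (ENNReal.ofReal (intConst k cS * d.h ^ d.m) *
        (LqHm T 2 d.m σ' + LqHm T 2 d.m p' + LqHm T 2 d.m γ')) ^ 2 := by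
  have m1 := (aemeasurable_sobNorm (m := d.m) hΩ
    hσ.integrable.aestronglyMeasurable).aestronglyMeasurable
  have m2 := (aemeasurable_sobNorm (m := d.m) hΩ
    hp.integrable.aestronglyMeasurable).aestronglyMeasurable
  have m3 := (aemeasurable_sobNorm (m := d.m) hΩ
    hγ.integrable.aestronglyMeasurable).aestronglyMeasurable
  have h1 : ∫⁻ t in Icc 0 T, (sobNorm d.m (σ' t) + sobNorm d.m (p' t) + sobNorm d.m (γ' t)) ^ 2 ≤
      (LqHm T 2 d.m σ' + LqHm T 2 d.m p' + LqHm T 2 d.m γ') ^ 2 := by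
    have h2 := (eLpNorm_add_le (m1.add m2) m3 (p := 2) (by norm_num)).trans
      (add_le_add (eLpNorm_add_le m1 m2 (p := 2) (by norm_num)) le_rfl)
    refine le_trans (le_of_eq ?_) (pow_le_pow_left' h2 2)
    rw [eLpNorm_eq_lintegral_rpow_enorm_toReal (by norm_num) (by norm_num),
      ← ENNReal.rpow_natCast _ 2, ← ENNReal.rpow_mul]
    simp
  have h3 : ∀ᵐ t ∂(volume.restrict (Icc 0 T)),
      ENNReal.ofReal (d.intErr (σ' t) (p' t) (γ' t)) ^ 2 ≤
      ENNReal.ofReal (intConst k cS * d.h ^ d.m) ^ 2 *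
        (sobNorm d.m (σ' t) + sobNorm d.m (p' t) + sobNorm d.m (γ' t)) ^ 2 := by
    filter_upwards [d.ae_ofReal_intErr_deriv_le hΩ hT hcS p' hσ hγ] with t ht
    rw [← mul_pow]
    gcongr
  refine (lintegral_mono_ae h3).trans ?_
  rw [lintegral_const_mul' _ _ (by finiteness), mul_pow]
  gcongr

/-- Each initial error is an interpolation error at time 0 plus the given initial discrepancy. The
pressure is bounded separately because the initial energy contains its s₀ part. -/
theorem norm_E_zero_le (hΩ : IsOpen Ω) (hT : 0 < T) (hcS : 0 < cS) (hc₀ : 0 ≤ c₀) {N : ℝ}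
    (hN : 0 ≤ N)
    (hW : W1qHm T 1 d.m d.σ + W1qHm T 1 d.m d.p + W1qHm T 1 d.m d.γ ≤ ENNReal.ofReal N) :
    ‖d.E 0‖ ≤ (intConst k cS * (1 + 1 / T) + (1 + ‖k.opI‖) * (1 + c₀ * (1 + 1 / T))) *
      (d.h ^ d.m * (d.K + N)) ∧
    ‖d.ep 0‖ ≤ (intConst k cS * (1 + 1 / T) + (1 + ‖k.opI‖) * (1 + c₀ * (1 + 1 / T))) *
      (d.h ^ d.m * (d.K + N)) := by
  have hh := d.h_pos
  have hK := d.K_nonneg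
  have hint := d.intErr_le hΩ hT hcS hN hW ⟨le_rfl, hT.le⟩
  have hini := d.init_le hΩ hT hc₀ hN (le_self_add.trans hW)
  have hN1 : d.h ^ d.m * N ≤ d.h ^ d.m * (d.K + N) := by gcongr; linarith
  have hc := intConst_nonneg k hcS
  set c₁ := intConst k cS
  set X := d.h ^ d.m * (d.K + N) with hX
  have hX0 : 0 ≤ X := by positivity
  have hint' : d.intErr (d.σ 0) (d.p 0) (d.γ 0) ≤ c₁ * (1 + 1 / T) * X :=
    hint.trans (by gcongr)
  have i1 := norm_nonneg (d.S.PGam (d.γ 0) - d.γ 0)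
  have i2 := norm_nonneg (d.S.PQ (d.p 0) - d.p 0)
  have i3 := norm_nonneg (d.Xi (d.σ 0) (d.p 0))
  have i4 := norm_nonneg (d.σ 0 - d.σh 0)
  have i5 := norm_nonneg (d.p 0 - d.ph 0)
  have e7 : (1 + ‖k.opI‖) * (‖d.σ 0 - d.σh 0‖ + ‖d.p 0 - d.ph 0‖) ≤
      (1 + ‖k.opI‖) * ((1 + c₀ * (1 + 1 / T)) * X) := by gcongr
  have q1 : 0 ≤ ‖k.opI‖ * ‖d.σ 0 - d.σh 0‖ := by positivity
  have q2 : 0 ≤ ‖k.opI‖ * ‖d.p 0 - d.ph 0‖ := by positivity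
  unfold intErr at hint'
  constructor
  · have e1 : d.E 0 = d.Xi (d.σ 0) (d.p 0) + ((d.σ 0 - d.σh 0) + k.opI (d.p 0 - d.ph 0)) := by
      simp only [E, Xi, es, ep, map_sub]
      abel
    have e3 := norm_add_le (d.Xi (d.σ 0) (d.p 0)) ((d.σ 0 - d.σh 0) + k.opI (d.p 0 - d.ph 0))
    have e4 := norm_add_le (d.σ 0 - d.σh 0) (k.opI (d.p 0 - d.ph 0))
    have e5 := k.opI.le_opNorm (d.p 0 - d.ph 0)
    rw [e1]
    linarith
  · have e1 : d.ep 0 = (d.S.PQ (d.p 0) - d.p 0) + (d.p 0 - d.ph 0) := by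
      simp only [ep]
      abel
    have e3 := norm_add_le (d.S.PQ (d.p 0) - d.p 0) (d.p 0 - d.ph 0)
    rw [e1]
    linarith

theorem ofReal_flux_err_le (w : L2 Ω (Vec n)) :
    ENNReal.ofReal (‖k.opK‖ * ‖d.S.PiW w - w‖ ^ 2) ≤
      ENNReal.ofReal (‖k.opK‖ * (cS * d.h ^ d.m) ^ 2) * sobNorm d.m w ^ 2 := by
  have h1 := d.S.PiW_err d.m d.one_le d.le_r w
  rw [ENNReal.ofReal_mul (norm_nonneg _), ENNReal.ofReal_mul (norm_nonneg _), mul_assoc]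
  refine mul_le_mul_right ?_ _
  rw [ENNReal.ofReal_pow (norm_nonneg _), norm_sub_rev, ofReal_norm]
  refine (pow_le_pow_left' h1 2).trans ?_
  rw [mul_pow]
  gcongr
  by_cases hc : 0 ≤ cS * d.h ^ d.m
  · rw [ENNReal.ofReal_pow hc]
  · rw [ENNReal.ofReal_of_nonpos (not_le.1 hc).le]
    simp

/-- The bound for the energy norm of the errors of the total stress and the pressure. -/
theorem sqrt_energy_le (hΩ : IsOpen Ω) (hT : 0 < T) (hcS : 0 < cS) {a : ℝ} (ha : 0 < a)
    (hA : ∀ x, a * ‖x‖ ^ 2 ≤ inner ℝ (k.opA x) x) {N : ℝ} (hN : 0 ≤ N)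
    (hW : W1qHm T 1 d.m d.σ + W1qHm T 1 d.m d.p + W1qHm T 1 d.m d.γ ≤ ENNReal.ofReal N)
    (hz : LqHm T 2 d.m d.z ≤ ENNReal.ofReal N) {t : ℝ} (ht : t ∈ Icc 0 T) :
    √(inner ℝ (k.opA (d.E t)) (d.E t) + inner ℝ (k.opS (d.ep t)) (d.ep t)) ≤
      √(inner ℝ (k.opA (d.E 0)) (d.E 0) + inner ℝ (k.opS (d.ep 0)) (d.ep 0)) +
        2 * ((√‖k.opA‖ + 1 / √a + √‖k.opS‖) * intConst k cS * (d.h ^ d.m * N)) +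
        √‖k.opK‖ * cS * (d.h ^ d.m * N) := by
  have hh := d.h_pos
  obtain ⟨aK, haK, hK'⟩ := k.exists_opK_coercive
  have hA0 : ∀ x, 0 ≤ inner ℝ (k.opA x) x := fun x => le_trans (by positivity) (hA x)
  have hK : ∀ x, 0 ≤ inner ℝ (k.opK x) x := fun x => le_trans (by positivity) (hK' x)
  have hc := intConst_nonneg k hcS
  have hc₂0 : 0 ≤ √‖k.opA‖ + 1 / √a + √‖k.opS‖ := by positivity
  have hfin : W1qHm T 1 d.m d.σ + W1qHm T 1 d.m d.p + W1qHm T 1 d.m d.γ < ⊤ :=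
    hW.trans_lt ENNReal.ofReal_lt_top
  rw [ENNReal.add_lt_top, ENNReal.add_lt_top] at hfin
  obtain ⟨σ', hσ, hσe⟩ := exists_W1qHm_eq hT hfin.1.1
  obtain ⟨p', hp, hpe⟩ := exists_W1qHm_eq hT hfin.1.2
  obtain ⟨γ', hγ, hγe⟩ := exists_W1qHm_eq hT hfin.2
  have hW' : LqHm T 1 d.m σ' + LqHm T 1 d.m p' + LqHm T 1 d.m γ' ≤ ENNReal.ofReal N := by
    refine le_trans ?_ hW
    rw [hσe, hpe, hγe]
    exact add_le_add (add_le_add le_add_self le_add_self) le_add_self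
  have hzm : AEStronglyMeasurable d.z (volume.restrict (Icc 0 T)) :=
    d.exact_sol.z_C0.aestronglyMeasurable_of_isCompact isCompact_Icc measurableSet_Icc
  have hz2 : ∫⁻ t in Icc 0 T, sobNorm d.m (d.z t) ^ 2 ≤ ENNReal.ofReal (N ^ 2) := by
    rw [← LqHm_two_sq, ENNReal.ofReal_pow hN]
    gcongr
  -- An L² bound in time places `z t` in H^m only for almost every `t`; the mass error equation is
  -- used only at those times.
  have hzfin : ∀ᵐ t ∂(volume.restrict (Icc 0 T)), sobNorm d.m (d.z t) < ⊤ := by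
    have := ae_lt_top' ((aemeasurable_sobNorm (m := d.m) hΩ hzm).pow_const 2)
      (hz2.trans_lt ENNReal.ofReal_lt_top).ne
    filter_upwards [this] with t ht
    by_contra h1
    rw [not_lt_top_iff.1 h1] at ht
    simp at ht
  have hy := (((d.isTimeDeriv_E hΩ hT hσ hp).quadratic hT k.opA k.opA_symm).add
    ((d.isTimeDeriv_ep hT hp).quadratic hT k.opS k.opS_symm))
  have hmeas := d.aemeasurable_intErr hΩ hT hσ hp hγ
  refine sqrt_le_of_deriv_le hT
    (a := fun t => (√‖k.opA‖ + 1 / √a + √‖k.opS‖) * d.intErr (σ' t) (p' t) (γ' t))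
    (b := fun t => ENNReal.ofReal (‖k.opK‖ * (cS * d.h ^ d.m) ^ 2) * sobNorm d.m (d.z t) ^ 2)
    (fun t _ => add_nonneg (hA0 _) (k.opS_nonneg _)) hy (hmeas.const_mul _)
    (fun t => mul_nonneg hc₂0 (d.intErr_nonneg _ _ _)) ?_ (by positivity) (by positivity) ?_ ?_ t ht
  · filter_upwards [hzfin, d.ae_err_eq1_deriv hΩ hT hσ hp hγ, d.ae_err_eq4 hΩ hT hσ hp,
      d.ae_mem_skewL2 hT hγ, ae_restrict_mem measurableSet_Icc] with t hzt h1 h4 hsk ht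
    have hz1 : sobNorm 1 (d.z t) < ⊤ := (sobNorm_mono d.one_le _).trans_lt hzt
    have hk := d.es_mem_kernel hΩ ht
    have hez : d.ez t ∈ d.S.W := d.S.W.sub_mem (d.S.PiW_mem _ hz1) (d.semi.z_mem t ht)
    have hν : inner ℝ (d.S.PGam (γ' t) - γ' t) (k.opI (d.ep t)) = 0 :=
      k.inner_skew_opI (sub_mem_skewL2 (d.S.Gam_le (Submodule.starProjection_apply_mem _ _)) hsk) _
    -- Test functions: e_σ in the differentiated stress equation, e_z in Darcy's law, e_p in the
    -- mass balance.
    have hen := energy_ineq k.opA_symm ha hA k.opK_symm hK k.opS_symm k.opS_nonneg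
      (h1 _ hk) hν (d.err_eq3 ht hez) (h4 hz1 _ (d.ep_mem ht))
    refine (ENNReal.ofReal_le_ofReal hen).trans (ENNReal.ofReal_add_le.trans ?_)
    exact add_le_add le_rfl (d.ofReal_flux_err_le _)
  · simp_rw [ENNReal.ofReal_mul hc₂0]
    rw [lintegral_const_mul' _ _ ENNReal.ofReal_ne_top]
    have h1 := (d.lintegral_intErr_deriv_le hΩ hT hcS hσ hp hγ).trans (mul_le_mul_right hW' _)
    refine (mul_le_mul_right h1 _).trans (le_of_eq ?_)
    rw [← ENNReal.ofReal_mul (by positivity), ← ENNReal.ofReal_mul hc₂0]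
    congr 1
    ring
  · rw [lintegral_const_mul' _ _ ENNReal.ofReal_ne_top]
    refine (mul_le_mul_right hz2 _).trans (le_of_eq ?_)
    rw [← ENNReal.ofReal_mul (by positivity)]
    congr 1
    rw [mul_assoc (√‖k.opK‖), mul_pow (√‖k.opK‖), Real.sq_sqrt (norm_nonneg _)]
    ring

/-- The bound for the error of the total stress. -/
theorem exists_norm_E_le (hΩ : IsOpen Ω) (k : BiotCoeff Ω) (hT : 0 < T) (r r' : ℕ) (hcS : 0 < cS)
    (hc₀ : 0 ≤ c₀) :
    ∃ C, 0 ≤ C ∧ ∀ (d : BiotErrorData k T r r' cS c₀) (N : ℝ), 0 ≤ N →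
      W1qHm T 1 d.m d.σ + W1qHm T 1 d.m d.p + W1qHm T 1 d.m d.γ ≤ ENNReal.ofReal N →
      LqHm T 2 d.m d.z ≤ ENNReal.ofReal N →
      ∀ t ∈ Icc 0 T, ‖d.E t‖ ≤ C * (d.h ^ d.m * (d.K + N)) := by
  obtain ⟨a, ha, hA⟩ := k.exists_opA_coercive
  have hA0 : ∀ x, 0 ≤ inner ℝ (k.opA x) x := fun x => le_trans (by positivity) (hA x)
  have hc := intConst_nonneg k hcS
  set c₂ := √‖k.opA‖ + 1 / √a + √‖k.opS‖ with hc₂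
  have hc₂0 : 0 ≤ c₂ := by positivity
  set c₄ := intConst k cS * (1 + 1 / T) + (1 + ‖k.opI‖) * (1 + c₀ * (1 + 1 / T)) with hc₄
  have hc₄0 : 0 ≤ c₄ := by positivity
  refine ⟨((√‖k.opA‖ + √‖k.opS‖) * c₄ + 2 * (c₂ * intConst k cS) + √‖k.opK‖ * cS) / √a,
    by positivity, ?_⟩
  intro d N hN hW hz t ht
  have hh := d.h_pos
  have hKd := d.K_nonneg
  obtain ⟨i1, i2⟩ := d.norm_E_zero_le hΩ hT hcS hc₀ hN hW
  have h3 := d.sqrt_energy_le hΩ hT hcS ha hA hN hW hz ht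
  have hN1 : d.h ^ d.m * N ≤ d.h ^ d.m * (d.K + N) := by gcongr; linarith
  set X := d.h ^ d.m * (d.K + N) with hX
  have h1 := norm_le_sqrt_inner_div k.opA ha hA (d.E t)
  have h2 : √(inner ℝ (k.opA (d.E t)) (d.E t)) ≤
      √(inner ℝ (k.opA (d.E t)) (d.E t) + inner ℝ (k.opS (d.ep t)) (d.ep t)) :=
    Real.sqrt_le_sqrt (le_add_of_nonneg_right (k.opS_nonneg _))
  have h4 : √(inner ℝ (k.opA (d.E 0)) (d.E 0) + inner ℝ (k.opS (d.ep 0)) (d.ep 0)) ≤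
      √‖k.opA‖ * (c₄ * X) + √‖k.opS‖ * (c₄ * X) := by
    have e1 := (sqrt_inner_le k.opA (d.E 0)).trans
      (mul_le_mul_of_nonneg_left i1 (Real.sqrt_nonneg _))
    have e2 := (sqrt_inner_le k.opS (d.ep 0)).trans
      (mul_le_mul_of_nonneg_left i2 (Real.sqrt_nonneg _))
    refine le_trans ?_ (add_le_add e1 e2)
    -- `√(x + y) ≤ √x + √y`, by squaring.
    refine (Real.sqrt_le_left (by positivity)).2 ?_
    nlinarith [Real.sq_sqrt (hA0 (d.E 0)), Real.sq_sqrt (k.opS_nonneg (d.ep 0)),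
      mul_nonneg (Real.sqrt_nonneg (inner ℝ (k.opA (d.E 0)) (d.E 0)))
        (Real.sqrt_nonneg (inner ℝ (k.opS (d.ep 0)) (d.ep 0)))]
  refine h1.trans ?_
  rw [div_mul_eq_mul_div]
  refine div_le_div_of_nonneg_right ?_ (Real.sqrt_nonneg _)
  have h5 : c₂ * intConst k cS * (d.h ^ d.m * N) ≤ c₂ * intConst k cS * X := by gcongr
  have h6 : √‖k.opK‖ * cS * (d.h ^ d.m * N) ≤ √‖k.opK‖ * cS * X := by gcongr
  linarith

end BiotErrorData

/-! ### The energy estimate for the flux. -/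

namespace BiotErrorData

variable {n : ℕ} {Ω : Set (Vec n)} {k : BiotCoeff Ω} {T : ℝ} {r r' : ℕ} {cS c₀ : ℝ}
  (d : BiotErrorData k T r r' cS c₀)

/-- The interpolation error `w ↦ Π_h^W w - w`. -/
noncomputable def fluxErr : L2 Ω (Vec n) →ₗ[ℝ] L2 Ω (Vec n) := d.S.PiW - LinearMap.id

theorem fluxErr_apply (w : L2 Ω (Vec n)) : d.fluxErr w = d.S.PiW w - w := rfl

theorem enorm_fluxErr_le (w : L2 Ω (Vec n)) :
    ‖d.fluxErr w‖ₑ ≤ ENNReal.ofReal (cS * d.h ^ d.m) * sobNorm d.m w := by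
  rw [fluxErr_apply, ← ofReal_norm, norm_sub_rev, ofReal_norm]
  exact d.S.PiW_err d.m d.one_le d.le_r w

theorem norm_fluxErr_le (hΩ : IsOpen Ω) (hT : 0 < T) (hcS : 0 < cS) {N : ℝ} (hN : 0 ≤ N)
    (hW : W1qHm T 1 d.m d.z ≤ ENNReal.ofReal N) {t : ℝ} (ht : t ∈ Icc 0 T) :
    ‖d.fluxErr (d.z t)‖ ≤ cS * (1 + 1 / T) * (d.h ^ d.m * N) := by
  have hh := d.h_pos
  have h1 := (d.enorm_fluxErr_le (d.z t)).trans
    (mul_le_mul_right ((sobNorm_le_W1qHm hΩ hT ht).trans (mul_le_mul_right hW _)) _)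
  rw [← ofReal_norm, ← ENNReal.ofReal_mul (by positivity), ← ENNReal.ofReal_mul (by positivity),
    ENNReal.ofReal_le_ofReal_iff (by positivity)] at h1
  refine h1.trans (le_of_eq ?_)
  ring

/-- The flux error is absolutely continuous. -/
theorem exists_isTimeDeriv_ez (hΩ : IsOpen Ω) (hT : 0 < T) (hcS : 0 < cS)
    {z' : ℝ → L2 Ω (Vec n)} (hz : IsTimeDeriv T d.z z') (hfin : LqHm T 1 d.m z' < ⊤) :
    ∃ z₁, IsTimeDeriv T d.ez z₁ ∧ IsTimeDeriv T (fun t => d.fluxErr (d.z t))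
      (fun t => d.fluxErr (z' t)) := by
  have hh := d.h_pos
  have hB := hz.comp_of_le_sobNorm hΩ d.fluxErr (by positivity) d.enorm_fluxErr_le hfin
  obtain ⟨L, hL⟩ := d.S.exists_flux_map hΩ k
  have hph := (IsTimeDeriv.of_contDiffOn hT d.semi.p_C1).clm_comp L
  -- The decomposition is `e_z = z + (Π_h^W z - z) - L p_h`, and each summand has an integrable time
  -- derivative.
  refine ⟨_, ((hz.add hB).sub hph).congr (fun t ht => ?_) (ae_eq_refl _), hB⟩
  have hzh := hL (d.zh t) (d.semi.z_mem t ht) (d.ph t) fun w hw => by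
    rw [← k.formK_eq]
    exact d.semi.eq3 t ht w hw
  rw [ez, hzh, fluxErr_apply]
  abel

/-- The time derivative of the error equation for Darcy's law. -/
theorem ae_err_eq3_deriv (hT : 0 < T) {z' z₁ : ℝ → L2 Ω (Vec n)}
    {p' : ℝ → L2 Ω ℝ} (hp : IsTimeDeriv T d.p p') (hez : IsTimeDeriv T d.ez z₁)
    (hB : IsTimeDeriv T (fun t => d.fluxErr (d.z t)) (fun t => d.fluxErr (z' t))) :
    ∀ᵐ t ∂(volume.restrict (Icc 0 T)), ∀ w ∈ d.S.W,
      inner ℝ (k.opK (z₁ t)) w + inner ℝ (d.ep' p' t) (divV w) =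
        inner ℝ (k.opK (d.fluxErr (z' t))) w := by
  filter_upwards [(hez.clm_comp k.opK).ae_hasDerivAt hT, (d.isTimeDeriv_ep hT hp).ae_hasDerivAt hT,
    (hB.clm_comp k.opK).ae_hasDerivAt hT] with t h1 h2 h3 w hw
  have e1 := (h1.2.inner ℝ (hasDerivAt_const t w)).add
    (h2.2.inner ℝ (hasDerivAt_const t (divV w)))
  have e2 := h3.2.inner ℝ (hasDerivAt_const t w)
  simp only [inner_zero_right, zero_add] at e1 e2
  refine e1.unique (e2.congr_of_eventuallyEq ?_)
  filter_upwards [Icc_mem_nhds h1.1.1 h1.1.2] with s hs using d.err_eq3 hs hw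

/-- The bound for the weighted norm of the flux error. -/
theorem sqrt_flux_energy_le (hΩ : IsOpen Ω) (hT : 0 < T) (hcS : 0 < cS) {a : ℝ} (ha : 0 < a)
    (hA : ∀ x, a * ‖x‖ ^ 2 ≤ inner ℝ (k.opA x) x) {N : ℝ} (hN : 0 ≤ N)
    (hW : W1qHm T 2 d.m d.σ + W1qHm T 2 d.m d.p + W1qHm T 2 d.m d.γ + W1qHm T 1 d.m d.z ≤
      ENNReal.ofReal N) {t : ℝ} (ht : t ∈ Icc 0 T) :
    √(inner ℝ (k.opK (d.ez t)) (d.ez t)) ≤ √(inner ℝ (k.opK (d.ez 0)) (d.ez 0)) +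
      2 * (√‖k.opK‖ * cS * (d.h ^ d.m * N)) +
      √(‖k.opA‖ + 1 / a + ‖k.opS‖) * intConst k cS * (d.h ^ d.m * N) := by
  have hh := d.h_pos
  obtain ⟨aK, haK, hK'⟩ := k.exists_opK_coercive
  have hA0 : ∀ x, 0 ≤ inner ℝ (k.opA x) x := fun x => le_trans (by positivity) (hA x)
  have hK : ∀ x, 0 ≤ inner ℝ (k.opK x) x := fun x => le_trans (by positivity) (hK' x)
  have hc := intConst_nonneg k hcS
  have hfin : W1qHm T 2 d.m d.σ + W1qHm T 2 d.m d.p + W1qHm T 2 d.m d.γ + W1qHm T 1 d.m d.z < ⊤ :=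
    hW.trans_lt ENNReal.ofReal_lt_top
  rw [ENNReal.add_lt_top, ENNReal.add_lt_top, ENNReal.add_lt_top] at hfin
  obtain ⟨σ', hσ, hσe⟩ := exists_W1qHm_eq hT hfin.1.1.1
  obtain ⟨p', hp, hpe⟩ := exists_W1qHm_eq hT hfin.1.1.2
  obtain ⟨γ', hγ, hγe⟩ := exists_W1qHm_eq hT hfin.1.2
  obtain ⟨z', hz, hze⟩ := exists_W1qHm_eq hT hfin.2
  have hW' : LqHm T 2 d.m σ' + LqHm T 2 d.m p' + LqHm T 2 d.m γ' ≤ ENNReal.ofReal N := by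
    refine le_trans ?_ hW
    rw [hσe, hpe, hγe]
    exact (add_le_add (add_le_add le_add_self le_add_self) le_add_self).trans le_self_add
  have hWz : W1qHm T 1 d.m d.z ≤ ENNReal.ofReal N := le_add_self.trans hW
  have hz'N : LqHm T 1 d.m z' ≤ ENNReal.ofReal N := by
    refine le_trans ?_ hWz
    rw [hze]
    exact le_add_self
  -- Here the W^{1,1} bound places `z t` in H¹ at every time.
  have hzfin : ∀ t ∈ Icc 0 T, sobNorm 1 (d.z t) < ⊤ := fun t ht =>
    (sobNorm_mono d.one_le _).trans_lt ((sobNorm_le_W1qHm hΩ hT ht).trans_lt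
      (ENNReal.mul_lt_top ENNReal.ofReal_lt_top hfin.2))
  obtain ⟨z₁, hez, hB⟩ := d.exists_isTimeDeriv_ez hΩ hT hcS hz (hz'N.trans_lt ENNReal.ofReal_lt_top)
  have hy := hez.quadratic hT k.opK k.opK_symm
  refine sqrt_le_of_deriv_le hT
    (a := fun t => √‖k.opK‖ * ‖d.fluxErr (z' t)‖)
    (b := fun t => ENNReal.ofReal (‖k.opA‖ + 1 / a + ‖k.opS‖) *
      ENNReal.ofReal (d.intErr (σ' t) (p' t) (γ' t)) ^ 2)
    (fun t _ => hK _) hy (hB.integrable.aestronglyMeasurable.norm.aemeasurable.const_mul _)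
    (fun t => by positivity) ?_ (by positivity) (by positivity) ?_ ?_ t ht
  · filter_upwards [d.ae_mem_kernel hΩ hT hσ, d.ae_ep'_mem hT hp,
      d.ae_err_eq1_deriv hΩ hT hσ hp hγ, d.ae_err_eq4 hΩ hT hσ hp,
      d.ae_err_eq3_deriv hT hp hez hB,
      d.ae_mem_skewL2 hT hγ, ae_restrict_mem measurableSet_Icc] with t hk hq h1 h4 h3 hsk ht
    have hez : d.ez t ∈ d.S.W := d.S.W.sub_mem (d.S.PiW_mem _ (hzfin t ht)) (d.semi.z_mem t ht)
    have hν : inner ℝ (d.S.PGam (γ' t) - γ' t) (k.opI (d.ep' p' t)) = 0 :=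
      k.inner_skew_opI (sub_mem_skewL2 (d.S.Gam_le (Submodule.starProjection_apply_mem _ _)) hsk) _
    -- Test functions: the time derivatives of e_σ and e_p, and e_z in the differentiated Darcy law.
    have hen := energy_ineq_deriv k.opA_symm ha hA k.opK_symm hK k.opS_symm k.opS_nonneg
      (h1 _ hk) hν (h3 _ hez) (h4 (hzfin t ht) _ hq)
    have hint : ‖k.opA‖ * ‖d.Xi (σ' t) (p' t)‖ ^ 2 + 1 / a * ‖d.S.PGam (γ' t) - γ' t‖ ^ 2 +
        ‖k.opS‖ * ‖d.S.PQ (p' t) - p' t‖ ^ 2 ≤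
        (‖k.opA‖ + 1 / a + ‖k.opS‖) * d.intErr (σ' t) (p' t) (γ' t) ^ 2 := by
      have i1 := norm_nonneg (d.Xi (σ' t) (p' t))
      have i2 := norm_nonneg (d.S.PGam (γ' t) - γ' t)
      have i3 := norm_nonneg (d.S.PQ (p' t) - p' t)
      rw [add_mul, add_mul]
      unfold intErr
      gcongr <;> linarith
    refine (ENNReal.ofReal_le_ofReal (hen.trans (add_le_add le_rfl hint))).trans
      (ENNReal.ofReal_add_le.trans (add_le_add le_rfl (le_of_eq ?_)))
    rw [ENNReal.ofReal_mul (by positivity), ENNReal.ofReal_pow (d.intErr_nonneg _ _ _)]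
  · simp_rw [ENNReal.ofReal_mul (Real.sqrt_nonneg ‖k.opK‖), ofReal_norm]
    rw [lintegral_const_mul' _ _ ENNReal.ofReal_ne_top]
    have h1 : ∫⁻ t in Icc 0 T, ‖d.fluxErr (z' t)‖ₑ ≤
        ENNReal.ofReal (cS * d.h ^ d.m) * LqHm T 1 d.m z' := by
      rw [LqHm_one, ← lintegral_const_mul' _ _ ENNReal.ofReal_ne_top]
      exact lintegral_mono fun t => d.enorm_fluxErr_le _
    refine (mul_le_mul_right (h1.trans (mul_le_mul_right hz'N _)) _).trans (le_of_eq ?_)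
    rw [← ENNReal.ofReal_mul (by positivity), ← ENNReal.ofReal_mul (by positivity)]
    congr 1
    ring
  · rw [lintegral_const_mul' _ _ ENNReal.ofReal_ne_top]
    have h1 := (d.lintegral_intErr_deriv_sq_le hΩ hT hcS hσ hp hγ).trans
      (pow_le_pow_left' (mul_le_mul_right hW' _) 2)
    refine (mul_le_mul_right h1 _).trans (le_of_eq ?_)
    rw [← ENNReal.ofReal_mul (by positivity), ← ENNReal.ofReal_pow (by positivity),
      ← ENNReal.ofReal_mul (by positivity)]
    congr 1
    rw [mul_assoc (√_), mul_pow (√_), Real.sq_sqrt (by positivity)]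
    ring

/-- The bound for the flux error. -/
theorem exists_norm_ez_le (hΩ : IsOpen Ω) (k : BiotCoeff Ω) (hT : 0 < T) (r r' : ℕ) (hcS : 0 < cS)
    (hc₀ : 0 ≤ c₀) :
    ∃ C, 0 ≤ C ∧ ∀ (d : BiotErrorData k T r r' cS c₀) (N : ℝ), 0 ≤ N →
      W1qHm T 2 d.m d.σ + W1qHm T 2 d.m d.p + W1qHm T 2 d.m d.γ + W1qHm T 1 d.m d.z ≤
        ENNReal.ofReal N →
      ∀ t ∈ Icc 0 T, ‖d.ez t‖ ≤ C * (d.h ^ d.m * (d.K + N)) := by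
  obtain ⟨a, ha, hA⟩ := k.exists_opA_coercive
  obtain ⟨b, hb, hK⟩ := k.exists_opK_coercive
  have hc := intConst_nonneg k hcS
  set c₂ := √(‖k.opA‖ + 1 / a + ‖k.opS‖) with hc₂
  have hc₂0 : 0 ≤ c₂ := Real.sqrt_nonneg _
  -- Interpolation error of z at time 0 plus the initial discrepancy; `1 + √T` passes from W^{1,2}
  -- to W^{1,1} for σ and p.
  set c₃ := cS * (1 + 1 / T) + (1 + c₀ * (1 + 1 / T)) * (1 + √T) with hc₃
  have hc₃0 : 0 ≤ c₃ := by positivity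
  refine ⟨(√‖k.opK‖ * c₃ + 2 * (√‖k.opK‖ * cS) + c₂ * intConst k cS) / √b, by positivity, ?_⟩
  intro d N hN hW t ht
  have hh := d.h_pos
  have hKd := d.K_nonneg
  have hWz : W1qHm T 1 d.m d.z ≤ ENNReal.ofReal N := le_add_self.trans hW
  have hW1 : W1qHm T 1 d.m d.σ + W1qHm T 1 d.m d.p + W1qHm T 1 d.m d.z ≤
      ENNReal.ofReal ((1 + √T) * N) := by
    have h1 : W1qHm T 2 d.m d.σ + W1qHm T 2 d.m d.p + W1qHm T 1 d.m d.z ≤ ENNReal.ofReal N :=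
      le_trans (add_le_add le_self_add le_rfl) hW
    rw [ENNReal.ofReal_mul (by positivity)]
    refine le_trans ?_ (mul_le_mul_right h1 _)
    rw [mul_add, mul_add]
    have h2 : ENNReal.ofReal √T ≤ ENNReal.ofReal (1 + √T) :=
      ENNReal.ofReal_le_ofReal (by linarith)
    have h3 : 1 ≤ ENNReal.ofReal (1 + √T) := by
      rw [← ENNReal.ofReal_one]
      exact ENNReal.ofReal_le_ofReal (by linarith [Real.sqrt_nonneg T])
    refine add_le_add (add_le_add ?_ ?_) (le_mul_of_one_le_left' h3)
    · exact (W1qHm_one_le hΩ hT).trans (by gcongr)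
    · exact (W1qHm_one_le hΩ hT).trans (by gcongr)
  have hini := d.init_z_le hΩ hT hc₀ (by positivity) hW1
  have hfl := d.norm_fluxErr_le hΩ hT hcS hN hWz ⟨le_rfl, hT.le⟩
  have h3 := d.sqrt_flux_energy_le hΩ hT hcS ha hA hN hW ht
  have hN1 : d.h ^ d.m * N ≤ d.h ^ d.m * (d.K + N) := by gcongr; linarith
  have hN2 : d.h ^ d.m * (d.K + (1 + √T) * N) ≤ (1 + √T) * (d.h ^ d.m * (d.K + N)) := by
    rw [mul_left_comm (1 + √T) (d.h ^ d.m)]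
    refine mul_le_mul_of_nonneg_left ?_ (pow_nonneg hh.le _)
    have : 0 ≤ √T * d.K := by positivity
    linarith
  set X := d.h ^ d.m * (d.K + N) with hX
  have i1 : ‖d.ez 0‖ ≤ c₃ * X := by
    have e1 : d.ez 0 = d.fluxErr (d.z 0) + (d.z 0 - d.zh 0) := by
      rw [ez, fluxErr_apply]
      abel
    have e2 := hfl.trans (mul_le_mul_of_nonneg_left hN1 (by positivity))
    have e3 := hini.trans (mul_le_mul_of_nonneg_left hN2 (by positivity))
    rw [e1]
    refine (norm_add_le _ _).trans ((add_le_add e2 e3).trans (le_of_eq ?_))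
    rw [hc₃]
    ring
  have h4 := (sqrt_inner_le k.opK (d.ez 0)).trans
    (mul_le_mul_of_nonneg_left i1 (Real.sqrt_nonneg _))
  refine (norm_le_sqrt_inner_div k.opK hb hK (d.ez t)).trans ?_
  rw [div_mul_eq_mul_div]
  refine div_le_div_of_nonneg_right ?_ (Real.sqrt_nonneg _)
  have h5 : c₂ * intConst k cS * (d.h ^ d.m * N) ≤ c₂ * intConst k cS * X := by gcongr
  have h6 : √‖k.opK‖ * cS * (d.h ^ d.m * N) ≤ √‖k.opK‖ * cS * X := by gcongr
  linarith

end BiotErrorData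

/-! ### The remaining errors and the assembly of the estimates. -/

theorem eLpNorm_top_le_of_forall_Icc {Y : Type*} [NormedAddCommGroup Y] {T B : ℝ} {F : ℝ → Y}
    (hF : ∀ t ∈ Icc 0 T, ‖F t‖ ≤ B) :
    eLpNorm F ⊤ (volume.restrict (Icc 0 T)) ≤ ENNReal.ofReal B := by
  rw [eLpNorm_exponent_top]
  refine eLpNormEssSup_le_of_ae_bound ?_
  filter_upwards [ae_restrict_mem measurableSet_Icc] with t ht using hF t ht

/-- A bound in terms of all finite upper bounds of `X` is a bound in terms of `X`. -/
theorem le_ofReal_mul_add_of_forall {X Y : ℝ≥0∞} {C c a K : ℝ} (ha : 0 < a) (hK : 0 ≤ K)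
    (hc : 0 < c) (hC : C ≤ c)
    (H : ∀ N, 0 ≤ N → X ≤ ENNReal.ofReal N → Y ≤ ENNReal.ofReal (C * (a * (K + N)))) :
    Y ≤ ENNReal.ofReal (c * a) * (ENNReal.ofReal K + X) := by
  have hca : 0 < c * a := mul_pos hc ha
  by_cases hX : X = ⊤
  · rw [hX, add_top, ENNReal.mul_top (ENNReal.ofReal_pos.2 hca).ne']
    exact le_top
  · have h1 := H X.toReal ENNReal.toReal_nonneg (ENNReal.ofReal_toReal hX).ge
    refine h1.trans ?_
    conv_rhs => rw [← ENNReal.ofReal_toReal hX]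
    have hN : 0 ≤ X.toReal := ENNReal.toReal_nonneg
    rw [← ENNReal.ofReal_add hK hN, ← ENNReal.ofReal_mul hca.le, mul_assoc]
    exact ENNReal.ofReal_le_ofReal (mul_le_mul_of_nonneg_right hC (by positivity))

namespace BiotErrorData

variable {n : ℕ} {Ω : Set (Vec n)} {k : BiotCoeff Ω} {T : ℝ} {r r' : ℕ} {cS c₀ : ℝ}
  (d : BiotErrorData k T r r' cS c₀)

theorem normA_total_le (t : ℝ) :
    ‖k.normA (k.total (d.es t) (d.ep t))‖ ≤ √‖k.opA‖ * ‖d.E t‖ := by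
  have h := k.total_ae (d.es t) (d.ep t)
  rw [BiotCoeff.normA, k.formA_eq h h, Real.norm_of_nonneg (Real.sqrt_nonneg _)]
  exact sqrt_inner_le k.opA (d.E t)

/-- The bound for the displacement and rotation errors. -/
theorem exists_norm_eu_add_norm_eg_le (hΩ : IsOpen Ω) (k : BiotCoeff Ω) (hT : 0 < T) (r r' : ℕ)
    (hcS : 0 < cS) (hc₀ : 0 ≤ c₀) :
    ∃ C, 0 ≤ C ∧ ∀ (d : BiotErrorData k T r r' cS c₀) (N : ℝ), 0 ≤ N →
      W1qHm T 1 d.m d.σ + W1qHm T 1 d.m d.p + W1qHm T 1 d.m d.γ ≤ ENNReal.ofReal N →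
      LqHm T 2 d.m d.z ≤ ENNReal.ofReal N →
      ∀ t ∈ Icc 0 T, ‖d.eu t‖ + ‖d.eg t‖ ≤ C * (d.h ^ d.m * (d.K + N)) := by
  obtain ⟨C, hC, hE⟩ := exists_norm_E_le hΩ k hT r r' hcS hc₀
  have hc := intConst_nonneg k hcS
  refine ⟨2 * cS * (‖k.opA‖ * C + (‖k.opA‖ + 1) * (intConst k cS * (1 + 1 / T))), by positivity, ?_⟩
  intro d N hN hW hz t ht
  have hh := d.h_pos
  have hKd := d.K_nonneg
  have hN1 : d.h ^ d.m * N ≤ d.h ^ d.m * (d.K + N) := by gcongr; linarith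
  have h1 := hE d N hN hW hz t ht
  have h2 := (d.intErr_le hΩ hT hcS hN hW ht).trans
    (mul_le_mul_of_nonneg_left hN1 (by positivity))
  set X := d.h ^ d.m * (d.K + N)
  calc ‖d.eu t‖ + ‖d.eg t‖
      ≤ 2 * cS * (‖k.opA‖ * ‖d.E t‖ + (‖k.opA‖ + 1) * d.intErr (d.σ t) (d.p t) (d.γ t)) :=
        d.norm_eu_add_norm_eg_le hcS ht
    _ ≤ 2 * cS * (‖k.opA‖ * (C * X) +
          (‖k.opA‖ + 1) * (intConst k cS * (1 + 1 / T) * X)) := by gcongr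
    _ = _ := by ring

/-- The bound for the pressure error. -/
theorem exists_norm_ep_le (hΩ : IsOpen Ω) (k : BiotCoeff Ω) (hT : 0 < T) (r r' : ℕ)
    (hcS : 0 < cS) (hc₀ : 0 ≤ c₀) :
    ∃ C, 0 ≤ C ∧ ∀ (d : BiotErrorData k T r r' cS c₀) (N : ℝ), 0 ≤ N →
      W1qHm T 2 d.m d.σ + W1qHm T 2 d.m d.p + W1qHm T 2 d.m d.γ + W1qHm T 1 d.m d.z ≤
        ENNReal.ofReal N →
      ∀ t ∈ Icc 0 T, ‖d.ep t‖ ≤ C * (d.h ^ d.m * (d.K + N)) := by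
  obtain ⟨C, hC, hez⟩ := exists_norm_ez_le hΩ k hT r r' hcS hc₀
  refine ⟨‖k.opK‖ * cS * (C + cS * (1 + 1 / T)), by positivity, ?_⟩
  intro d N hN hW t ht
  have hh := d.h_pos
  have hKd := d.K_nonneg
  have hN1 : d.h ^ d.m * N ≤ d.h ^ d.m * (d.K + N) := by gcongr; linarith
  have h1 := hez d N hN hW t ht
  have h2 := (d.norm_fluxErr_le hΩ hT hcS hN (le_add_self.trans hW) ht).trans
    (mul_le_mul_of_nonneg_left hN1 (by positivity))
  rw [fluxErr_apply] at h2
  set X := d.h ^ d.m * (d.K + N)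
  calc ‖d.ep t‖ ≤ ‖k.opK‖ * cS * (‖d.ez t‖ + ‖d.S.PiW (d.z t) - d.z t‖) := d.norm_ep_le hcS ht
    _ ≤ ‖k.opK‖ * cS * (C * X + cS * (1 + 1 / T) * X) := by gcongr
    _ = _ := by ring

/-- The bound for the stress error. -/
theorem exists_norm_es_le (hΩ : IsOpen Ω) (k : BiotCoeff Ω) (hT : 0 < T) (r r' : ℕ)
    (hcS : 0 < cS) (hc₀ : 0 ≤ c₀) :
    ∃ C, 0 ≤ C ∧ ∀ (d : BiotErrorData k T r r' cS c₀) (N : ℝ), 0 ≤ N →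
      W1qHm T 2 d.m d.σ + W1qHm T 2 d.m d.p + W1qHm T 2 d.m d.γ + W1qHm T 1 d.m d.z ≤
        ENNReal.ofReal N →
      ∀ t ∈ Icc 0 T, ‖d.es t‖ ≤ C * (d.h ^ d.m * (d.K + N)) := by
  obtain ⟨C, hC, hE⟩ := exists_norm_E_le hΩ k hT r r' hcS hc₀
  obtain ⟨C', hC', hep⟩ := exists_norm_ep_le hΩ k hT r r' hcS hc₀
  -- `√T` passes from W^{1,2} to W^{1,1}, `√T * (1 + 1 / T)` from W^{1,1} to L² for z, and the
  -- summand 1 makes `K + b N ≤ b (K + N)`.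
  set b := 1 + √T + √T * (1 + 1 / T) with hb
  have hb0 : 0 ≤ √T * (1 + 1 / T) := by positivity
  have hT0 := Real.sqrt_nonneg T
  have hb1 : 1 ≤ b := by linarith
  refine ⟨C * b + ‖k.opI‖ * C', by positivity, ?_⟩
  intro d N hN hW t ht
  have hh := d.h_pos
  have hKd := d.K_nonneg
  have h1 : W1qHm T 1 d.m d.σ + W1qHm T 1 d.m d.p + W1qHm T 1 d.m d.γ ≤
      ENNReal.ofReal (b * N) := by
    rw [ENNReal.ofReal_mul (by linarith)]
    refine le_trans ?_ (mul_le_mul_right (le_self_add.trans hW) _)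
    have h2 : ENNReal.ofReal √T ≤ ENNReal.ofReal b := ENNReal.ofReal_le_ofReal (by linarith)
    rw [mul_add, mul_add]
    exact add_le_add (add_le_add ((W1qHm_one_le hΩ hT).trans (mul_le_mul_left h2 _))
      ((W1qHm_one_le hΩ hT).trans (mul_le_mul_left h2 _)))
      ((W1qHm_one_le hΩ hT).trans (mul_le_mul_left h2 _))
  have h2 : LqHm T 2 d.m d.z ≤ ENNReal.ofReal (b * N) := by
    rw [ENNReal.ofReal_mul (by linarith)]
    refine (LqHm_two_le hΩ hT).trans ?_
    exact mul_le_mul' (ENNReal.ofReal_le_ofReal (by linarith)) (le_add_self.trans hW)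
  have h3 := hE d (b * N) (by positivity) h1 h2 t ht
  have h4 := hep d N hN hW t ht
  have h5 : d.h ^ d.m * (d.K + b * N) ≤ b * (d.h ^ d.m * (d.K + N)) := by
    rw [mul_left_comm b (d.h ^ d.m)]
    refine mul_le_mul_of_nonneg_left ?_ (pow_nonneg hh.le _)
    nlinarith
  set X := d.h ^ d.m * (d.K + N)
  have e1 : d.es t = d.E t - k.opI (d.ep t) := by rw [E, add_sub_cancel_right]
  calc ‖d.es t‖ ≤ ‖d.E t‖ + ‖k.opI (d.ep t)‖ := by rw [e1]; exact norm_sub_le _ _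
    _ ≤ C * (b * X) + ‖k.opI‖ * (C' * X) :=
        add_le_add (h3.trans (mul_le_mul_of_nonneg_left h5 hC))
          ((k.opI.le_opNorm _).trans (mul_le_mul_of_nonneg_left h4 (norm_nonneg _)))
    _ = _ := by ring

end BiotErrorData

theorem theorem3p2 {n : ℕ} (hn : n = 2 ∨ n = 3) (Ω : Set (Vec n)) (hΩ : IsOpen Ω)
    (hΩb : Bornology.IsBounded Ω) (k : BiotCoeff Ω) (T : ℝ) (hT : 0 < T)
    (r r' : ℕ) (hr' : 1 ≤ r') (hrr' : r' = r ∨ r' + 1 = r)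
    (cS c₀ : ℝ) (hcS : 0 < cS) (hc₀ : 0 ≤ c₀) :
    ∃ c : ℝ, 0 < c ∧
      ∀ (h : ℝ), 0 < h → ∀ (S : MixedPair Ω r r' cS h)
        (f : ℝ → L2 Ω (Vec n)) (g : ℝ → L2 Ω ℝ)
        (σ : ℝ → L2 Ω (Mat n)) (u : ℝ → L2 Ω (Vec n)) (γ : ℝ → L2 Ω (Mat n))
        (z : ℝ → L2 Ω (Vec n)) (p : ℝ → L2 Ω ℝ)
        (σh : ℝ → L2 Ω (Mat n)) (uh : ℝ → L2 Ω (Vec n)) (γh : ℝ → L2 Ω (Mat n))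
        (zh : ℝ → L2 Ω (Vec n)) (ph : ℝ → L2 Ω ℝ),
        IsBiotSolution k T f g σ u γ z p →
        S.IsSemidiscrete k T f g σh uh γh zh ph →
        ∀ m : ℕ, 1 ≤ m → m ≤ r → ∀ K : ℝ, 0 ≤ K →
        ‖σ 0 - σh 0‖ₑ + ‖p 0 - ph 0‖ₑ ≤ ENNReal.ofReal (h ^ m) *
          (ENNReal.ofReal K + ENNReal.ofReal c₀ * (sobNorm m (σ 0) + sobNorm m (p 0))) →
        ‖z 0 - zh 0‖ₑ ≤ ENNReal.ofReal (h ^ m) *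
          (ENNReal.ofReal K + ENNReal.ofReal c₀ *
            (sobNorm m (σ 0) + sobNorm m (p 0) + sobNorm m (z 0))) →
        eLpNorm (fun t => k.normA (k.total (S.ISig (σ t) - σh t) (S.PQ (p t) - ph t))) ⊤
            (volume.restrict (Icc 0 T))
          ≤ ENNReal.ofReal (c * h ^ m) * (ENNReal.ofReal K +
            max (W1qHm T 1 m σ + W1qHm T 1 m p + W1qHm T 1 m γ) (LqHm T 2 m z)) ∧
        LinftyL2 T (fun t => S.ISig (σ t) - σh t)
          ≤ ENNReal.ofReal (c * h ^ m) * (ENNReal.ofReal K +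
            (W1qHm T 2 m σ + W1qHm T 2 m p + W1qHm T 2 m γ + W1qHm T 1 m z)) ∧
        LinftyL2 T (fun t => S.PV (u t) - uh t) + LinftyL2 T (fun t => S.PGam (γ t) - γh t)
          ≤ ENNReal.ofReal (c * h ^ m) * (ENNReal.ofReal K +
            max (W1qHm T 1 m σ + W1qHm T 1 m p + W1qHm T 1 m γ) (LqHm T 2 m z)) ∧
        LinftyL2 T (fun t => S.PiW (z t) - zh t)
          ≤ ENNReal.ofReal (c * h ^ m) * (ENNReal.ofReal K +
            (W1qHm T 2 m σ + W1qHm T 2 m p + W1qHm T 2 m γ + W1qHm T 1 m z)) ∧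
        LinftyL2 T (fun t => S.PQ (p t) - ph t)
          ≤ ENNReal.ofReal (c * h ^ m) * (ENNReal.ofReal K +
            (W1qHm T 2 m σ + W1qHm T 2 m p + W1qHm T 2 m γ + W1qHm T 1 m z)) := by
  obtain ⟨CE, hCE, hE⟩ := BiotErrorData.exists_norm_E_le hΩ k hT r r' hcS hc₀
  obtain ⟨Cu, hCu, hu⟩ := BiotErrorData.exists_norm_eu_add_norm_eg_le hΩ k hT r r' hcS hc₀
  obtain ⟨Cz, hCz, hz⟩ := BiotErrorData.exists_norm_ez_le hΩ k hT r r' hcS hc₀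
  obtain ⟨Cp, hCp, hp⟩ := BiotErrorData.exists_norm_ep_le hΩ k hT r r' hcS hc₀
  obtain ⟨Cs, hCs, hs⟩ := BiotErrorData.exists_norm_es_le hΩ k hT r r' hcS hc₀
  have hA : 0 ≤ √‖k.opA‖ * CE := by positivity
  -- One constant dominates all five; the leading 1 makes it positive.
  refine ⟨1 + √‖k.opA‖ * CE + 2 * Cu + Cz + Cp + Cs, by linarith, ?_⟩
  intro h hh S f g σ u γ z p σh uh γh zh ph hex hsd m hm hmr K hK h0 hz0
  let d : BiotErrorData k T r r' cS c₀ :=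
    ⟨h, S, f, g, σ, u, γ, z, p, σh, uh, γh, zh, ph, m, K, hh, hex, hsd, hm, hmr, hK, h0, hz0⟩
  have ha : 0 < h ^ m := pow_pos hh m
  refine ⟨?_, ?_, ?_, ?_, ?_⟩
  · refine le_ofReal_mul_add_of_forall (C := √‖k.opA‖ * CE) ha hK (by linarith) (by linarith)
      fun N hN hX => eLpNorm_top_le_of_forall_Icc fun t ht => ?_
    refine (d.normA_total_le t).trans ?_
    rw [mul_assoc]
    exact mul_le_mul_of_nonneg_left
      (hE d N hN ((le_max_left _ _).trans hX) ((le_max_right _ _).trans hX) t ht)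
      (Real.sqrt_nonneg _)
  · exact le_ofReal_mul_add_of_forall (C := Cs) ha hK (by linarith) (by linarith)
      fun N hN hX => eLpNorm_top_le_of_forall_Icc (hs d N hN hX)
  -- The suprema of the two errors may be attained at different times, so the pointwise bound on
  -- their sum is used twice.
  · refine le_ofReal_mul_add_of_forall (C := 2 * Cu) ha hK (by linarith) (by linarith)
      fun N hN hX => ?_
    have h1 := hu d N hN ((le_max_left _ _).trans hX) ((le_max_right _ _).trans hX)
    have hB : 0 ≤ Cu * (h ^ m * (K + N)) := by positivity
    rw [mul_assoc, two_mul, ENNReal.ofReal_add hB hB]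
    exact add_le_add
      (eLpNorm_top_le_of_forall_Icc fun t ht => (le_add_of_nonneg_right (norm_nonneg _)).trans
        (h1 t ht))
      (eLpNorm_top_le_of_forall_Icc fun t ht => (le_add_of_nonneg_left (norm_nonneg _)).trans
        (h1 t ht))
  · exact le_ofReal_mul_add_of_forall (C := Cz) ha hK (by linarith) (by linarith)
      fun N hN hX => eLpNorm_top_le_of_forall_Icc (hz d N hN hX)
  · exact le_ofReal_mul_add_of_forall (C := Cp) ha hK (by linarith) (by linarith)
      fun N hN hX => eLpNorm_top_le_of_forall_Icc (hp d N hN hX)
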